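/- **Setting.** Let $T\ge 1$, let $\mu_i,s_i,d_i$ ($i=1,\dots,r$) be positive integers, and put $$\chi(e^{-i\lambda})=\prod_{j=1}^r(1-e^{-i\lambda\mu_js_j})^{d_j},\qquad \beta(i\lambda)=\prod_{j=1}^r\prod_{k=-[s_j/2]}^{[s_j/2]}(i\lambda-2\pi i k/s_j)^{d_j},\qquad w(\lambda)=\frac{|\chi(e^{-i\lambda})|^2}{|\beta(i\lambda)|^2}.$$ Let $\vec a(k)\in\mathbb C^T$, $k\ge 0$, not all zero, and $\vec b(k)=\sum_{m\ge k}d(m-k)\vec a(m)$ (convergent series; written $\mathbf b=D\mathbf a$), where $\sum_k d(k)x^k=\prod_i\big(\sum_{j\ge0}x^{\mu_is_ij}\big)^{d_i}$. Assume $\sum_k\|\vec a(k)\|$, $\sum_k(k+1)\|\vec a(k)\|^2$, $\sum_k\|\vec b(k)\|$ and $\sum_k(k+1)\|\vec b(k)\|^2$ are finite, and put $\vec B(\lambda)=\sum_{k\ge0}\vec b(k)e^{ik\lambda}$. A *spectral density* is an integrable Hermitian nonnegative definite $T\times T$ matrix function $f$ on $(-\pi,\pi]$; $L_2(f)$ carries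 the inner product $\frac1{2\pi}\int_{-\pi}^{\pi} g_1^\top f\,\overline{g_2}\,d\lambda$, and $L_2^{0-}(f)$ is the closed span in it of $e^{ik\lambda}\chi(e^{-i\lambda})\beta(i\lambda)^{-1}\boldsymbol\delta_l$, $k\le -1$, $l=1,\dots,T$. For $h\in L_2^{0-}(f)$ let $$\Delta(h;f)=\big\|\vec B\,\chi(e^{-i\lambda})/\beta(i\lambda)-h\big\|^2_{L_2(f)},$$ and let $h(f)$ be the orthogonal projection of $\vec B\chi/\beta$ on $L_2^{0-}(f)$. A density $f_0\in\mathcal D$ is *least favourable* in $\mathcal D$ if $\Delta(h(f_0);f_0)=\max_{f\in\mathcal D}\Delta(h(f);f)$. A function $h^0\in H_{\mathcal D}=\bigcap_{f\in\mathcal D}L_2^{0-}(f)$ is *minimax-robust* if it minimizes $\sup_{f\in\mathcal D}\Delta(h;f)$ over $h\in H_{\mathcal D}$. A density $f$ satisfies the *minimality condition* if it is invertible almost everywhere and $\int_{-\pi}^{\pi}\mathrm{Tr}[w^{-1}f^{-1}]d\lambda<\infty$. For such $f$ let $\mathbf F$ be the block Toeplitz operator with entries $F(j,k)=\frac1{2\pi}\int_{-\pi}^{\pi}e^{i\lambda(k-j)}w^{-1}(f^{-1})^\top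 d\lambda$, $j,k\ge 0$. We say that $\mathbf c=\mathbf F^{-1}D\mathbf a$, with $\vec C(\lambda)=\sum_{k\ge0}\vec c(k)e^{ik\lambda}$, if $\vec C$ is an integrable function with these Fourier coefficients (those of negative index being $0$), $w^{-1}(f^{-1})^\top\vec C$ is integrable, and its $j$-th Fourier coefficient is $\vec b(j)$ for every $j\ge0$. **Classes.** Let $f_1$ be a fixed spectral density, $B_2$ a positive definite Hermitian matrix, $\langle B,A\rangle=\sum_{i,j}B_{ij}\overline{A_{ij}}$, and $\|u\|_w=\frac1{2\pi}\int_{-\pi}^{\pi}w|u|\,d\lambda$. The classes consist of all spectral densities $f$ such that $$\begin{aligned}\mathcal D^1_{1\delta}:&\ \|\mathrm{Tr}(f-f_1)\|_w\le\delta;&\mathcal D^2_{1\delta}:&\ \|f_{kk}-f^1_{kk}\|_w\le\delta_k\ \ \forall k;\\ \mathcal D^3_{1\delta}:&\ \|\langle B_2,f-f_1\rangle\|_w\le\delta;&\mathcal D^4_{1\delta}:&\ \|f_{ij}-f^1_{ij}\|_w\le\delta_i^j\ \ \forall i,j.\end{aligned}$$ **Equations.** For a spectral density $f_0$ and $k=1,2,3,4$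 consider matrix functions $M$ of the following form, where $|\gamma|\le 1$ a.e. for all functions $\gamma$: 1. $M=\beta^2\gamma_2I$, $\beta\in\mathbb R$, $\gamma_2$ real, $\gamma_2=\mathrm{sign}\,\mathrm{Tr}(f_0-f_1)$ where $\mathrm{Tr}(f_0-f_1)\ne0$, and $\|\mathrm{Tr}(f_0-f_1)\|_w=\delta$; 2. $M=\mathrm{diag}(\beta_k^2\gamma_k^2)$, $\beta_k\in\mathbb R$, $\gamma^2_k$ (upper index) real, $\gamma_k^2=\mathrm{sign}(f^0_{kk}-f^1_{kk})$ where $f^0_{kk}\ne f^1_{kk}$, and $\|f^0_{kk}-f^1_{kk}\|_w=\delta_k$ for every $k$ with $\beta_k\ne0$; 3. $M=\beta^2\gamma_2'B_2^\top$, $\beta\in\mathbb R$, $\gamma_2'$ real, $\gamma_2'=\mathrm{sign}\langle B_2,f_0-f_1\rangle$ where $\langle B_2,f_0-f_1\rangle\ne0$, and $\|\langle B_2,f_0-f_1\rangle\|_w=\delta$; 4. $M=(\{\beta_{ij}\gamma_{ij}\}_{i,j})^\top$ with constants $\beta_{ij}\ge0$, $\gamma_{ij}$ complex, $\gamma_{ij}=(f^0_{ij}-f^1_{ij})/|f^0_{ij}-f^1_{ij}|$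 where $f^0_{ij}\ne f^1_{ij}$, and $\|f^0_{ij}-f^1_{ij}\|_w=\delta_i^j$ whenever $\beta_{ij}\ne0$. The equation for $f_0$ is, almost everywhere, $$\vec C\,\vec C^{*}=(w f_0^\top)\,M\,(w f_0^\top),\qquad \mathbf c=(\mathbf F^0)^{-1}D\mathbf a,\tag{E}$$ where $\mathbf F^0$ is the operator $\mathbf F$ of $f_0$. If $f_0$ admits a canonical factorization $wf_0=\Phi\Phi^*$, $\Phi(\lambda)=\sum_{k\ge0}\varphi(k)e^{-ik\lambda}$, with $T\times q$ matrices $\varphi(k)$, $\sum_k\|\varphi(k)\|^2<\infty$, canonical meaning that every constant vector in $\mathbb C^q$ is a limit in $L_2$ of functions $\Phi^\top\sum_{k=0}^ns(k)e^{-ik\lambda}$ with $s(k)\in\mathbb C^T$, put $\vec r(k)=\sum_m\varphi(m)^\top\vec b(m+k)$, let $\vec R$ be the integrable function with Fourier series $\sum_{k\ge0}\vec r(k)e^{ik\lambda}$, and consider, almost everywhere, $$\vec R\,\vec R^{*}=\Phi^\top M\,\overline{\Phi}.\tag{E$'$}$$ **Theorem.** (0) If $\vec\xi(m)$, $m\in\mathbb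 Z$, is a vector sequence whose increments of every positive step vector (with the given $s,d$) have finite second moments and mean zero, and are stationary with spectral density $f$, that is, for all step vectors $\mu',\mu''$ $$\mathsf E\big[\chi_{\mu'}\xi_p(m_0+m)\,\overline{\chi_{\mu''}\xi_q(m_0)}\big]=\frac1{2\pi}\int_{-\pi}^{\pi} e^{i\lambda m}\chi_{\mu'}(e^{-i\lambda})\,\overline{\chi_{\mu''}(e^{-i\lambda})}\,|\beta(i\lambda)|^{-2}f_{pq}(\lambda)\,d\lambda,$$ and if $X=\sum_{k\ge0}\vec b(k)^\top\chi_\mu\vec\xi(k)$ in mean square (the part to be predicted of the functional $A\vec\xi=\sum_{k\ge0}\vec a(k)^\top\vec\xi(k)$: formally $A\vec\xi$ is $X$ plus a linear combination of finitely many observed values $\vec\xi(k)$, $k\le -1$), then for $h\in L_2^{0-}(f)$ the linear estimate of $X$ with spectral characteristic $h$ (the mean-square limit of linear combinations of $\chi_\mu\xi_p(k)$, $k\le-1$, corresponding to $h$) has mean square error $\Delta(h;f)$. Let $f_0$ satisfy the minimality condition and let $\mathcal D=\mathcal D^k_{1\delta}$, $k\in\{1,2,3,4\}$. (1) If all radii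 $\delta,\delta_k,\delta_i^j$ are positive, $\delta_i^j=\delta_j^i$, and $f_0$ is least favourable in $\mathcal D$, then there are $\mathbf c=(\mathbf F^0)^{-1}D\mathbf a$ and $M$ of the $k$-th form such that (E) holds; if $f_0$ admits a canonical factorization, there is $M$ of the $k$-th form such that (E$'$) holds. (2) Conversely, let $f_0\in\mathcal D$, let $M$ be of the $k$-th form, and let (E) hold with $\mathbf c=(\mathbf F^0)^{-1}D\mathbf a$. Then $f_0$ is least favourable in $\mathcal D$, the maximum $\max_{f\in\mathcal D}\Delta(h(f);f)$ equals $\langle D\mathbf a,(\mathbf F^0)^{-1}D\mathbf a\rangle$, and $$h^0(\lambda)^\top=\vec B(\lambda)^\top\frac{\chi(e^{-i\lambda})}{\beta(i\lambda)}-\frac{\overline{\beta(i\lambda)}}{\chi(e^{i\lambda})}\,\vec C(\lambda)^\top f_0^{-1}(\lambda)$$ is the spectral characteristic $h(f_0)$ and is minimax-robust in $\mathcal D$. If $f_0\in\mathcal D$ admits a canonical factorization and (E$'$) holds with $M$ of the $k$-th form, then $f_0$ is least favourable in $\mathcal D$, and there is $\mathbf c=(\mathbf F^0)^{-1}D\mathbf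 a$ such that (E) holds with the same $M$ and the function $h^0$ given by this formula is minimax-robust in $\mathcal D$. -/

import Mathlib

open MeasureTheory Filter Topology
open scoped ENNReal Matrix ComplexOrder

noncomputable section

namespace GMForecast

/-! ### The multiple increment operator and its spectral factors -/

/-- The data `(μ, s, d)` of a generalized multiple increment
`∏ i, (1 - B ^ (μ i * s i)) ^ (d i)`: steps, seasonal parameters, orders. -/
structure GMIndex (r : ℕ) where
  step : Fin r → ℕ
  season : Fin r → ℕ
  order : Fin r → ℕ

/-- All steps, seasonal parameters and orders are positive integers. -/
def GMIndex.Positive {r : ℕ} (g : GMIndex r) : Prop :=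
  ∀ i, 0 < g.step i ∧ 0 < g.season i ∧ 0 < g.order i

/-- The increment polynomial in the backward shift, `∑ k, e(k) B ^ k`. -/
def incPoly {r : ℕ} (g : GMIndex r) : Polynomial ℂ :=
  ∏ i, (1 - Polynomial.X ^ (g.step i * g.season i)) ^ g.order i

/-- `χ(e^{-ix})`. -/
def chi {r : ℕ} (g : GMIndex r) (x : ℝ) : ℂ :=
  (incPoly g).eval (Complex.exp (-((x : ℂ) * Complex.I)))

/-- `β(ix) = ∏_j ∏_{|k| ≤ [s_j/2]} (i x - 2 π i k / s_j)^{d_j}`. -/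
def beta {r : ℕ} (g : GMIndex r) (x : ℝ) : ℂ :=
  ∏ i, ∏ k ∈ Finset.Icc (-((g.season i / 2 : ℕ) : ℤ)) ((g.season i / 2 : ℕ) : ℤ),
    (Complex.I * (x : ℂ) - 2 * (Real.pi : ℂ) * Complex.I * (k : ℂ) / (g.season i : ℂ)) ^ g.order i

/-- `|χ(e^{-ix})|² / |β(ix)|²`. -/
def weight {r : ℕ} (g : GMIndex r) (x : ℝ) : ℝ := ‖chi g x‖ ^ 2 / ‖beta g x‖ ^ 2

/-- Normalized Lebesgue measure `dx / 2π` on `(-π, π]`. -/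
def circ : Measure ℝ :=
  (ENNReal.ofReal (2 * Real.pi))⁻¹ • volume.restrict (Set.Ioc (-Real.pi) Real.pi)

/-- `e^{i k x}`. -/
def cis (k : ℤ) (x : ℝ) : ℂ := Complex.exp ((k : ℂ) * (x : ℂ) * Complex.I)

/-- The coefficients `d(k)` of `∏ i, (∑ j, X ^ (μ i * s i * j)) ^ (d i)`. -/
def dCoeff {r : ℕ} (g : GMIndex r) (k : ℕ) : ℂ :=
  PowerSeries.coeff k
    (∏ i, (PowerSeries.mk fun n => if g.step i * g.season i ∣ n then (1 : ℂ) else 0) ^ g.order i)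

/-- `b = D a`, that is, `b(k) = ∑_{m ≥ k} d(m - k) a(m)` (convergent series) for all `k`. -/
def IsDTransform {T r : ℕ} (g : GMIndex r) (a b : ℕ → Fin T → ℂ) : Prop :=
  ∀ k, Tendsto (fun n => ∑ m ∈ Finset.range n, dCoeff g m • a (k + m)) atTop (𝓝 (b k))

/-- `B(e^{ix}) = ∑_k b(k) e^{ikx}`. -/
def bSeries {T : ℕ} (b : ℕ → Fin T → ℂ) (x : ℝ) : Fin T → ℂ := ∑' k : ℕ, cis k x • b k

/-! ### Spectral densities and the spaces `L₂(f)`, `L₂⁰⁻(f)` -/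

/-- A matrix spectral density: Hermitian, nonnegative definite, integrable over `(-π, π]`. -/
def IsSpectralDensity {T : ℕ} (f : ℝ → Matrix (Fin T) (Fin T) ℂ) : Prop :=
  (∀ i j, Integrable (fun x => f x i j) circ) ∧ ∀ᵐ x ∂circ, (f x).PosSemidef

/-- The minimality condition; the inverse is meant as a genuine inverse almost everywhere. -/
def Minimality {T r : ℕ} (g : GMIndex r) (f : ℝ → Matrix (Fin T) (Fin T) ℂ) : Prop :=
  (∀ᵐ x ∂circ, (f x).PosDef) ∧
    Integrable (fun x => (((weight g x : ℂ)⁻¹) • (f x)⁻¹).trace) circ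

/-- `(1/2π) ∫ uᵀ f ū dx`, the squared norm of `L₂(f)`. -/
def normSq {T : ℕ} (f : ℝ → Matrix (Fin T) (Fin T) ℂ) (u : ℝ → Fin T → ℂ) : ℝ≥0∞ :=
  ∫⁻ x, ENNReal.ofReal (u x ⬝ᵥ (f x *ᵥ star (u x))).re ∂circ

/-- `(χ(e^{-ix}) / β(ix)) ∑_{k=1}^{n} s(k) e^{-ikx}` (with `s` indexed from `0`). -/
def pastPoly {T r : ℕ} (g : GMIndex r) (n : ℕ) (s : ℕ → Fin T → ℂ) (x : ℝ) : Fin T → ℂ :=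
  ∑ k ∈ Finset.range n, (cis (-((k : ℤ) + 1)) x * (chi g x / beta g x)) • s k

/-- `L₂⁰⁻(f)`: the closed span in `L₂(f)` of `e^{ikx} χ(e^{-ix}) β(ix)⁻¹ δ_l`, `k ≤ -1`. -/
def L2Past {T r : ℕ} (g : GMIndex r) (f : ℝ → Matrix (Fin T) (Fin T) ℂ) :
    Set (ℝ → Fin T → ℂ) :=
  {h | (∀ p, AEStronglyMeasurable (fun x => h x p) circ) ∧ normSq f h < ∞ ∧
    ∀ ε : ℝ≥0∞, 0 < ε → ∃ n s, normSq f (fun x => h x - pastPoly g n s x) ≤ ε}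

/-- `B(e^{ix}) χ(e^{-ix}) / β(ix)`, the element to be predicted. -/
def target {T r : ℕ} (g : GMIndex r) (b : ℕ → Fin T → ℂ) (x : ℝ) : Fin T → ℂ :=
  (chi g x / beta g x) • bSeries b x

/-- `Δ(h; f)`: mean square error, under the density `f`, of the estimate with spectral
characteristic `h`. -/
def mse {T r : ℕ} (g : GMIndex r) (b : ℕ → Fin T → ℂ) (h : ℝ → Fin T → ℂ)
    (f : ℝ → Matrix (Fin T) (Fin T) ℂ) : ℝ≥0∞ :=
  normSq f (fun x => target g b x - h x)

/-- `h` is the spectral characteristic `h(f)` of the optimal linear estimate: the orthogonal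
projection in `L₂(f)` of the target element on `L₂⁰⁻(f)`. -/
def IsSpectralCharacteristic {T r : ℕ} (g : GMIndex r) (b : ℕ → Fin T → ℂ)
    (f : ℝ → Matrix (Fin T) (Fin T) ℂ) (h : ℝ → Fin T → ℂ) : Prop :=
  h ∈ L2Past g f ∧
    ∀ u ∈ L2Past g f, ∫ x, (target g b x - h x) ⬝ᵥ (f x *ᵥ star (u x)) ∂circ = 0

/-- `f₀` is least favourable in `D`: `Δ(h(f₀); f₀) = max_{f ∈ D} Δ(h(f); f)`. -/
def IsLeastFavourable {T r : ℕ} (g : GMIndex r) (b : ℕ → Fin T → ℂ)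
    (D : Set (ℝ → Matrix (Fin T) (Fin T) ℂ)) (f₀ : ℝ → Matrix (Fin T) (Fin T) ℂ) : Prop :=
  f₀ ∈ D ∧ ∃ h₀, IsSpectralCharacteristic g b f₀ h₀ ∧
    ∀ f ∈ D, ∀ h, IsSpectralCharacteristic g b f h → mse g b h f ≤ mse g b h₀ f₀

/-- `h₀` is minimax-robust in `D`: it lies in `H_D = ⋂_{f ∈ D} L₂⁰⁻(f)` and minimizes
`sup_{f ∈ D} Δ(h; f)` over `h ∈ H_D`. -/
def IsMinimaxRobust {T r : ℕ} (g : GMIndex r) (b : ℕ → Fin T → ℂ)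
    (D : Set (ℝ → Matrix (Fin T) (Fin T) ℂ)) (h₀ : ℝ → Fin T → ℂ) : Prop :=
  (∀ f ∈ D, h₀ ∈ L2Past g f) ∧
    ∀ h, (∀ f ∈ D, h ∈ L2Past g f) → (⨆ f ∈ D, mse g b h₀ f) ≤ (⨆ f ∈ D, mse g b h f)

/-! ### The operator `F` and the spectral characteristic formula -/

/-- `C` is the integrable function with Fourier series `∑_{k ≥ 0} c(k) e^{ikx}`. -/
def IsAnalyticSeries {ι : Type} (C : ℝ → ι → ℂ) (c : ℕ → ι → ℂ) : Prop :=
  ∀ p, Integrable (fun x => C x p) circ ∧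
    (∀ k : ℕ, ∫ x, cis (-(k : ℤ)) x * C x p ∂circ = c k p) ∧
    ∀ k : ℕ, ∫ x, cis ((k : ℤ) + 1) x * C x p ∂circ = 0

/-- The symbol `(|β|² / |χ|²) (f⁻¹)ᵀ` of the block Toeplitz operator `F`. -/
def symbolF {T r : ℕ} (g : GMIndex r) (f : ℝ → Matrix (Fin T) (Fin T) ℂ) (x : ℝ) :
    Matrix (Fin T) (Fin T) ℂ :=
  ((weight g x : ℂ)⁻¹) • ((f x)⁻¹)ᵀ

/-- The matrix entries `F(j, k)`, the Fourier coefficients of the symbol. -/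
def entryF {T r : ℕ} (g : GMIndex r) (f : ℝ → Matrix (Fin T) (Fin T) ℂ) (j k : ℕ) :
    Matrix (Fin T) (Fin T) ℂ :=
  Matrix.of fun p q => ∫ x, cis ((k : ℤ) - (j : ℤ)) x * symbolF g f x p q ∂circ

/-- `c = F⁻¹ b`, with `C(x) = ∑_k c(k) e^{ikx}`. The operator `F` with matrix `F(j, k)` may be
unbounded, so `F c` is read as the sequence of nonnegative Fourier coefficients of
`(symbol of F) · C`; on finite sequences this is `∑_k F(j, k) c(k)`, see `entryF_action`. -/
structure IsInverseImage {T r : ℕ} (g : GMIndex r) (f : ℝ → Matrix (Fin T) (Fin T) ℂ)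
    (b c : ℕ → Fin T → ℂ) (C : ℝ → Fin T → ℂ) : Prop where
  series : IsAnalyticSeries C c
  integrable : ∀ p, Integrable (fun x => (symbolF g f x *ᵥ C x) p) circ
  eq : ∀ (j : ℕ) (p : Fin T),
    ∫ x, cis (-(j : ℤ)) x * (symbolF g f x *ᵥ C x) p ∂circ = b j p

/-- On finite sequences the operator acts through the matrix `F(j, k)`. -/
theorem entryF_action {T r : ℕ} (g : GMIndex r) (f : ℝ → Matrix (Fin T) (Fin T) ℂ)
    (hf : ∀ p q, Integrable (fun x => symbolF g f x p q) circ)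
    (c : ℕ → Fin T → ℂ) (n j : ℕ) (p : Fin T) :
    ∫ x, cis (-(j : ℤ)) x *
      (symbolF g f x *ᵥ (∑ k ∈ Finset.range n, cis (k : ℤ) x • c k)) p ∂circ
      = ∑ k ∈ Finset.range n, (entryF g f j k *ᵥ c k) p := by
  have hint : ∀ (m : ℤ) (q : Fin T),
      Integrable (fun x => cis m x * symbolF g f x p q) circ := by
    intro m q
    refine (hf p q).bdd_mul (c := 1) ?_ ?_
    · unfold cis
      fun_prop
    · refine Eventually.of_forall fun x => ?_
      have : (m : ℂ) * (x : ℂ) * Complex.I = ((m * x : ℝ) : ℂ) * Complex.I := by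
        push_cast; ring
      unfold cis
      rw [this, Complex.norm_exp_ofReal_mul_I]
  have hpt : ∀ x, cis (-(j : ℤ)) x *
      (symbolF g f x *ᵥ (∑ k ∈ Finset.range n, cis (k : ℤ) x • c k)) p
      = ∑ k ∈ Finset.range n, ∑ q,
        (cis ((k : ℤ) - (j : ℤ)) x * symbolF g f x p q) * c k q := by
    intro x
    simp only [Matrix.mulVec, dotProduct, Finset.sum_apply, Pi.smul_apply, smul_eq_mul,
      Finset.mul_sum]
    rw [Finset.sum_comm]
    refine Finset.sum_congr rfl fun k _ => Finset.sum_congr rfl fun q _ => ?_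
    have : cis ((k : ℤ) - (j : ℤ)) x = cis (-(j : ℤ)) x * cis (k : ℤ) x := by
      unfold cis
      rw [← Complex.exp_add]
      congr 1
      push_cast
      ring
    rw [this]
    ring
  simp_rw [hpt]
  rw [integral_finsetSum _ fun k _ =>
    integrable_finsetSum _ fun q _ => (hint _ q).mul_const _]
  refine Finset.sum_congr rfl fun k _ => ?_
  rw [integral_finsetSum _ fun q _ => (hint _ q).mul_const _]
  simp only [Matrix.mulVec, dotProduct, entryF, Matrix.of_apply]
  exact Finset.sum_congr rfl fun q _ => integral_mul_const _ _

/-- `hᵀ = Bᵀ χ/β - (β̄ / χ̄) Cᵀ f⁻¹`. -/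
def charFormula {T r : ℕ} (g : GMIndex r) (b : ℕ → Fin T → ℂ)
    (f : ℝ → Matrix (Fin T) (Fin T) ℂ) (C : ℝ → Fin T → ℂ) (x : ℝ) : Fin T → ℂ :=
  target g b x - (star (beta g x) / star (chi g x)) • (C x ᵥ* (f x)⁻¹)

/-! ### The neighbourhood classes and their Lagrange multipliers -/

/-- The four kinds of weighted `L₁`-neighbourhoods, with their radii. -/
inductive Nbhd (T : ℕ) where
  | trace (δ : ℝ)
  | diagonal (δ : Fin T → ℝ)
  | weighted (B : Matrix (Fin T) (Fin T) ℂ) (δ : ℝ)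
  | entrywise (δ : Fin T → Fin T → ℝ)

/-- The weight matrix is positive definite Hermitian. -/
def Nbhd.Admissible {T : ℕ} : Nbhd T → Prop
  | .trace _ => True
  | .diagonal _ => True
  | .weighted B _ => B.PosDef
  | .entrywise _ => True

/-- All radii are positive (and those of conjugate entries agree). -/
def Nbhd.NonDegenerate {T : ℕ} : Nbhd T → Prop
  | .trace δ => 0 < δ
  | .diagonal δ => ∀ k, 0 < δ k
  | .weighted _ δ => 0 < δ
  | .entrywise δ => ∀ i j, 0 < δ i j ∧ δ i j = δ j i

/-- `⟨B, A⟩ = ∑ i j, B i j * conj (A i j)`. -/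
def matInner {T : ℕ} (B A : Matrix (Fin T) (Fin T) ℂ) : ℂ := (B * Aᴴ).trace

/-- `(1/2π) ∫ (|χ|²/|β|²) |u(x)| dx`. -/
def wL1 {r : ℕ} (g : GMIndex r) (u : ℝ → ℂ) : ℝ := ∫ x, weight g x * ‖u x‖ ∂circ

/-- The class of spectral densities in the neighbourhood of `f₁`. -/
def Nbhd.densities {T r : ℕ} (g : GMIndex r) (f₁ : ℝ → Matrix (Fin T) (Fin T) ℂ) :
    Nbhd T → Set (ℝ → Matrix (Fin T) (Fin T) ℂ)
  | .trace δ => {f | IsSpectralDensity f ∧ wL1 g (fun x => (f x - f₁ x).trace) ≤ δ}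
  | .diagonal δ => {f | IsSpectralDensity f ∧ ∀ k, wL1 g (fun x => (f x - f₁ x) k k) ≤ δ k}
  | .weighted B δ => {f | IsSpectralDensity f ∧ wL1 g (fun x => matInner B (f x - f₁ x)) ≤ δ}
  | .entrywise δ =>
    {f | IsSpectralDensity f ∧ ∀ i j, wL1 g (fun x => (f x - f₁ x) i j) ≤ δ i j}

/-- `|γ| ≤ 1`, and `γ` is the sign of `u` where `u ≠ 0` (`u` is real almost everywhere). -/
def IsSignOf (γ : ℝ → ℝ) (u : ℝ → ℂ) : Prop :=
  ∀ᵐ x ∂circ, |γ x| ≤ 1 ∧ (u x ≠ 0 → γ x = Real.sign (u x).re)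

/-- `|γ| ≤ 1`, and `γ = u / |u|` where `u ≠ 0`. -/
def IsPhaseOf (γ u : ℝ → ℂ) : Prop :=
  ∀ᵐ x ∂circ, ‖γ x‖ ≤ 1 ∧ (u x ≠ 0 → γ x = u x / (‖u x‖ : ℂ))

/-- `M` is the multiplier matrix in the middle of the equation for the least favourable density
`f₀`, and the constraints are saturated (for a family of constraints: each one whose multiplier
does not vanish). -/
def Nbhd.IsMultiplier {T r : ℕ} (g : GMIndex r) (f₁ f₀ : ℝ → Matrix (Fin T) (Fin T) ℂ) :
    Nbhd T → (ℝ → Matrix (Fin T) (Fin T) ℂ) → Prop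
  | .trace δ, M => ∃ (β : ℝ) (γ : ℝ → ℝ),
      IsSignOf γ (fun x => (f₀ x - f₁ x).trace) ∧
      (∀ᵐ x ∂circ, M x = ((β ^ 2 * γ x : ℝ) : ℂ) • (1 : Matrix (Fin T) (Fin T) ℂ)) ∧
      wL1 g (fun x => (f₀ x - f₁ x).trace) = δ
  | .diagonal δ, M => ∃ (β : Fin T → ℝ) (γ : Fin T → ℝ → ℝ),
      (∀ k, IsSignOf (γ k) (fun x => (f₀ x - f₁ x) k k)) ∧
      (∀ᵐ x ∂circ, M x = Matrix.diagonal fun k => ((β k ^ 2 * γ k x : ℝ) : ℂ)) ∧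
      ∀ k, β k ≠ 0 → wL1 g (fun x => (f₀ x - f₁ x) k k) = δ k
  | .weighted B δ, M => ∃ (β : ℝ) (γ : ℝ → ℝ),
      IsSignOf γ (fun x => matInner B (f₀ x - f₁ x)) ∧
      (∀ᵐ x ∂circ, M x = ((β ^ 2 * γ x : ℝ) : ℂ) • Bᵀ) ∧
      wL1 g (fun x => matInner B (f₀ x - f₁ x)) = δ
  | .entrywise δ, M => ∃ (β : Fin T → Fin T → ℝ) (γ : Fin T → Fin T → ℝ → ℂ),
      (∀ i j, 0 ≤ β i j) ∧
      (∀ i j, IsPhaseOf (γ i j) (fun x => (f₀ x - f₁ x) i j)) ∧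
      (∀ᵐ x ∂circ, M x = (Matrix.of fun i j => (β i j : ℂ) * γ i j x)ᵀ) ∧
      ∀ i j, β i j ≠ 0 → wL1 g (fun x => (f₀ x - f₁ x) i j) = δ i j

/-- `C C* = (w f₀ᵀ) M (w f₀ᵀ)` almost everywhere, `w = |χ|²/|β|²`. -/
def DensityEquation {T r : ℕ} (g : GMIndex r) (f₀ M : ℝ → Matrix (Fin T) (Fin T) ℂ)
    (C : ℝ → Fin T → ℂ) : Prop :=
  ∀ᵐ x ∂circ, Matrix.vecMulVec (C x) (star (C x)) =
    ((weight g x : ℂ) • (f₀ x)ᵀ) * M x * ((weight g x : ℂ) • (f₀ x)ᵀ)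

/-! ### Canonical factorization -/

/-- The canonical factorization `(|χ|²/|β|²) f = Φ Φ*`, `Φ(x) = ∑_{k ≥ 0} φ(k) e^{-ikx}`,
square summable. The last field says that the white noise of the moving average representation
is an innovation sequence: each of its components at time `0` lies in the closed span of the
present and past increments. -/
structure IsCanonicalFactorization {T r q : ℕ} (g : GMIndex r)
    (f : ℝ → Matrix (Fin T) (Fin T) ℂ)
    (φ : ℕ → Matrix (Fin T) (Fin q) ℂ) (Φ : ℝ → Matrix (Fin T) (Fin q) ℂ) : Prop where
  summable : ∀ i j, Summable fun k => ‖φ k i j‖ ^ 2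
  integrable : ∀ i j, Integrable (fun x => Φ x i j) circ
  coeff : ∀ (k : ℕ) (i j), ∫ x, cis (k : ℤ) x * Φ x i j ∂circ = φ k i j
  coeff_neg : ∀ (k : ℕ) (i j), ∫ x, cis (-((k : ℤ) + 1)) x * Φ x i j ∂circ = 0
  fact : ∀ᵐ x ∂circ, (weight g x : ℂ) • f x = Φ x * (Φ x)ᴴ
  innovation : ∀ (j : Fin q) (ε : ℝ≥0∞), 0 < ε → ∃ (n : ℕ) (s : ℕ → Fin T → ℂ),
    ∫⁻ x, ‖(Φ x)ᵀ *ᵥ (∑ k ∈ Finset.range n, cis (-(k : ℤ)) x • s k) - Pi.single j 1‖ₑ ^ 2 ∂circ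
      ≤ ε

/-- `(D A φ)_k = ∑_m φ(m)ᵀ b(m + k)`, where `b = D a`. -/
def hankel {T q : ℕ} (φ : ℕ → Matrix (Fin T) (Fin q) ℂ) (b : ℕ → Fin T → ℂ) (k : ℕ) :
    Fin q → ℂ :=
  ∑' m, (φ m)ᵀ *ᵥ b (m + k)

/-- `R R* = Φᵀ M Φ̄` almost everywhere. -/
def FactorEquation {T q : ℕ} (Φ : ℝ → Matrix (Fin T) (Fin q) ℂ)
    (M : ℝ → Matrix (Fin T) (Fin T) ℂ) (R : ℝ → Fin q → ℂ) : Prop :=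
  ∀ᵐ x ∂circ, Matrix.vecMulVec (R x) (star (R x)) = (Φ x)ᵀ * M x * (Φ x).map star

/-! ### Stochastic sequences with stationary increments -/

/-- The increment `χ(B) ξ(m) = ∑_k e(k) ξ(m - k)`. -/
def increment {r : ℕ} {Ω : Type*} (g : GMIndex r) (ξ : ℤ → Ω → ℂ) (m : ℤ) (ω : Ω) : ℂ :=
  (incPoly g).sum fun k e => e * ξ (m - k) ω

/-- `ξ` is a vector sequence with centred stationary increments (of the given seasons and orders,
for all positive steps) and spectral density `f`. -/
structure HasSpectralDensity {T r : ℕ} {Ω : Type*} [MeasurableSpace Ω] (P : Measure Ω)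
    (g : GMIndex r) (ξ : ℤ → Fin T → Ω → ℂ) (f : ℝ → Matrix (Fin T) (Fin T) ℂ) : Prop where
  memLp : ∀ μ : Fin r → ℕ, (∀ i, 0 < μ i) → ∀ p m,
    MemLp (increment { g with step := μ } (fun k => ξ k p) m) 2 P
  mean : ∀ μ : Fin r → ℕ, (∀ i, 0 < μ i) → ∀ p m,
    ∫ ω, increment { g with step := μ } (fun k => ξ k p) m ω ∂P = 0
  cov : ∀ μ ν : Fin r → ℕ, (∀ i, 0 < μ i) → (∀ i, 0 < ν i) → ∀ (p q : Fin T) (m m₀ : ℤ),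
    ∫ ω, increment { g with step := μ } (fun k => ξ k p) (m₀ + m) ω *
        star (increment { g with step := ν } (fun k => ξ k q) m₀ ω) ∂P =
      ∫ x, cis m x * chi { g with step := μ } x * star (chi { g with step := ν } x) *
        ((‖beta g x‖ ^ 2 : ℝ) : ℂ)⁻¹ * f x p q ∂circ

/-- `∑_p u p * χ(B) ξ_p(m)`. -/
def incDot {T r : ℕ} {Ω : Type*} (g : GMIndex r) (ξ : ℤ → Fin T → Ω → ℂ) (u : Fin T → ℂ)
    (m : ℤ) (ω : Ω) : ℂ :=
  ∑ p, u p * increment g (fun k => ξ k p) m ω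

/-- `X = ∑_{k ≥ 0} b(k)ᵀ χ(B) ξ(k)` in mean square. -/
def IsFunctional {T r : ℕ} {Ω : Type*} [MeasurableSpace Ω] (P : Measure Ω) (g : GMIndex r)
    (ξ : ℤ → Fin T → Ω → ℂ) (b : ℕ → Fin T → ℂ) (X : Ω → ℂ) : Prop :=
  MemLp X 2 P ∧ Tendsto (fun n : ℕ =>
    ∫⁻ ω, ‖X ω - ∑ k ∈ Finset.range n, incDot g ξ (b k) k ω‖ₑ ^ 2 ∂P) atTop (𝓝 0)

/-- `η = ∫ hᵀ dZ` is the linear estimate with spectral characteristic `h`: finite linear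
combinations of the increments at times `k ≤ -1` approximate `η` in mean square while their
spectral characteristics approximate `h` in `L₂(f)`. -/
def IsEstimate {T r : ℕ} {Ω : Type*} [MeasurableSpace Ω] (P : Measure Ω) (g : GMIndex r)
    (ξ : ℤ → Fin T → Ω → ℂ) (f : ℝ → Matrix (Fin T) (Fin T) ℂ) (h : ℝ → Fin T → ℂ)
    (η : Ω → ℂ) : Prop :=
  MemLp η 2 P ∧ ∀ ε : ℝ≥0∞, 0 < ε → ∃ (n : ℕ) (s : ℕ → Fin T → ℂ),
    normSq f (fun x => h x - pastPoly g n s x) ≤ ε ∧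
    ∫⁻ ω, ‖η ω - ∑ k ∈ Finset.range n, incDot g ξ (s k) (-((k : ℤ) + 1)) ω‖ₑ ^ 2 ∂P ≤ ε

end GMForecast

end

/-!
Multiplication by `χ / β` is an isometry from `L₂(F)`, `F = w f`, onto `L₂(f)`, and it maps the
polynomials with negative frequencies onto the linear span of the observed past. Hence everything
is about the projection `v` of `B` on the closure of these polynomials in `L₂(F)`
(`isProj_of_isSpectralCharacteristic`), and about the error `G = B - v`.

The minimality condition says that `∫ Tr F⁻¹` is finite. By the Cauchy–Schwarz inequality it embeds
`L₂(F)` continuously into `L₁` (`IsCoercive`, `Minimality.exists_isCoercive`), so that the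
projection exists as a function and has no Fourier coefficients of nonnegative index. Orthogonality
of `G` to the past says that `C = Fᵀ G` is an analytic series; since the coefficients of
`(Fᵀ)⁻¹ C = G` of nonnegative index are those of `B`, this is the Toeplitz system
`c = F⁻¹ D a` (`exists_isInverseImage`, `isProj_of_analytic`), and `⟨b, c⟩` is the error
(`nsq_eq_tsum`). In terms of `G`, the equation for `C` reads `G G* = M`
(`densityEquation_of_vecMulVec`, `vecMulVec_of_densityEquation`). For a canonical factorization
`F = Φ Φ*`, comparison of Fourier coefficients gives `Φᵀ G = R` (`mulVec_ae_eq`), so the equation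
for `R` is equivalent to the same one.

Necessity. Along a segment of densities the minimal error is concave, and its derivative at `f₀`
is that of the error of the fixed estimate `v`. Therefore a least favourable `f₀` maximizes the
linear functional `f ↦ ∫ Gᵀ (w f) Ḡ` over the neighbourhood (`normSq_le_of_mix_le`). The
neighbourhoods are balls, or products of balls, of weighted `L₁` norms of linear functions of
`f - f₁`, intersected with the cone of nonnegative matrices; the almost everywhere invertibility of
`f₀` makes the cone constraint inactive for suitable perturbations. A maximizer of a linear
functional on an `L₁` ball sees an outer normal of the ball, a constant times a measurable
direction field (`exists_multiplier_of_maximal`, `exists_multiplier_of_direction`), and this is the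
multiplier `M` (`Nbhd.exists_multiplier`). Here `G ≠ 0` is needed; it holds because `D` is
injective (`IsDTransform.eq_zero`).

Sufficiency. If `G G* = M`, then `G` is bounded, as the multipliers are, and so is `v = B - G`. A
subsequence of the Fejér means of `v` therefore converges to `v` in `L₂(F)` for every density `F`,
so the estimate belongs to the past of every density of the class (`mem_negPast_of_bounded`).
The subgradient inequality for the `L₁` norm (`Nbhd.IsMultiplier.normSq_le`) shows that the error
of this estimate is largest at `f₀`. So `f₀` and the estimate form a saddle point, which is both
assertions on optimality (`isLeastFavourable_of_densityEquation`).

The stochastic part is the isometry between linear combinations of increments and trigonometric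
polynomials in `L₂(f)` (`HasSpectralDensity.integral_norm_sq`), extended to limits
(`lintegral_eq_mse`).
-/

namespace GMForecast

/-! ### The Hermitian form of a nonnegative definite matrix -/

section Form

variable {ι : Type*} [Fintype ι]

/-- The sesquilinear form `uᵀ A v̄`, whose integrals are the inner products of `L₂(f)`. -/
noncomputable def form (A : Matrix ι ι ℂ) (u v : ι → ℂ) : ℂ := u ⬝ᵥ (A *ᵥ star v)

/-- The quadratic form `uᵀ A ū`. -/
noncomputable def quad (A : Matrix ι ι ℂ) (u : ι → ℂ) : ℝ := (form A u u).re

lemma form_eq_sum (A : Matrix ι ι ℂ) (u v : ι → ℂ) :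
    form A u v = ∑ i, ∑ j, u i * (A i j * star (v j)) := by
  simp [form, dotProduct, Matrix.mulVec, Finset.mul_sum]

lemma form_add_left (A : Matrix ι ι ℂ) (u u' v : ι → ℂ) :
    form A (u + u') v = form A u v + form A u' v := by
  simp [form, add_dotProduct]

lemma form_add_right (A : Matrix ι ι ℂ) (u v v' : ι → ℂ) :
    form A u (v + v') = form A u v + form A u v' := by
  simp [form, dotProduct_add, Matrix.mulVec_add]

lemma form_sub_right (A : Matrix ι ι ℂ) (u v v' : ι → ℂ) :
    form A u (v - v') = form A u v - form A u v' := by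
  simp [form, dotProduct_sub, Matrix.mulVec_sub]

lemma form_smul_left (A : Matrix ι ι ℂ) (z : ℂ) (u v : ι → ℂ) :
    form A (z • u) v = z * form A u v := by
  simp [form]

lemma form_smul_right (A : Matrix ι ι ℂ) (z : ℂ) (u v : ι → ℂ) :
    form A u (z • v) = star z * form A u v := by
  simp [form, Matrix.mulVec_smul]

lemma form_smul_mat (A : Matrix ι ι ℂ) (z : ℂ) (u v : ι → ℂ) :
    form (z • A) u v = z * form A u v := by
  simp [form, Matrix.smul_mulVec]

lemma form_add_mat (A A' : Matrix ι ι ℂ) (u v : ι → ℂ) :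
    form (A + A') u v = form A u v + form A' u v := by
  simp [form, Matrix.add_mulVec]

lemma quad_add_mat (A A' : Matrix ι ι ℂ) (u : ι → ℂ) :
    quad (A + A') u = quad A u + quad A' u := by
  simp [quad, form_add_mat]

lemma quad_smul_mat (A : Matrix ι ι ℂ) (t : ℝ) (u : ι → ℂ) :
    quad ((t : ℂ) • A) u = t * quad A u := by
  rw [quad, form_smul_mat, Complex.re_ofReal_mul, quad]

lemma quad_smul (A : Matrix ι ι ℂ) (z : ℂ) (u : ι → ℂ) :
    quad A (z • u) = ‖z‖ ^ 2 * quad A u := by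
  have h : z * star z = ((‖z‖ ^ 2 : ℝ) : ℂ) := by
    have := Complex.mul_conj z
    rw [Complex.normSq_eq_norm_sq] at this
    exact this
  rw [quad, form_smul_left, form_smul_right, ← mul_assoc, h, Complex.re_ofReal_mul, quad]

lemma form_star (A : Matrix ι ι ℂ) (hA : A.IsHermitian) (u v : ι → ℂ) :
    star (form A u v) = form A v u := by
  rw [form_eq_sum, form_eq_sum, star_sum, Finset.sum_comm]
  refine Finset.sum_congr rfl fun j _ => ?_
  rw [star_sum]
  refine Finset.sum_congr rfl fun i _ => ?_
  rw [← hA.apply j i]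
  simp only [star_mul', star_star]
  ring

lemma quad_zero (A : Matrix ι ι ℂ) : quad A 0 = 0 := by
  simp [quad, form]

lemma quad_add {A : Matrix ι ι ℂ} (hA : A.IsHermitian) (u v : ι → ℂ) :
    quad A (u + v) = quad A u + quad A v + 2 * (form A u v).re := by
  have h : (form A v u).re = (form A u v).re := by
    rw [← form_star A hA u v]; simp
  simp only [quad, form_add_left, form_add_right, Complex.add_re, h]
  ring

lemma quad_nonneg {A : Matrix ι ι ℂ} (hA : A.PosSemidef) (u : ι → ℂ) : 0 ≤ quad A u := by
  have := hA.dotProduct_mulVec_nonneg (star u)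
  rw [star_star] at this
  exact (Complex.le_def.1 this).1

lemma form_self {A : Matrix ι ι ℂ} (hA : A.IsHermitian) (u : ι → ℂ) :
    form A u u = (quad A u : ℂ) := by
  have h := form_star A hA u u
  exact (Complex.conj_eq_iff_re.1 h).symm

/-- The discriminant form of the Cauchy–Schwarz inequality. -/
lemma quad_discrim {A : Matrix ι ι ℂ} (hA : A.PosSemidef) (u v : ι → ℂ) (t : ℝ) :
    0 ≤ t ^ 2 * quad A u + quad A v - 2 * t * ‖form A u v‖ := by
  obtain ⟨z, hz, hz'⟩ : ∃ z : ℂ, ‖z‖ = 1 ∧ star z * form A u v = (‖form A u v‖ : ℂ) := by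
    by_cases h : form A u v = 0
    · exact ⟨1, by simp, by simp [h]⟩
    · have hn : (‖form A u v‖ : ℂ) ≠ 0 := by simpa using h
      refine ⟨form A u v / ‖form A u v‖, by simp [h], ?_⟩
      rw [star_div₀]
      have : star (form A u v) * form A u v = (‖form A u v‖ : ℂ) ^ 2 := by
        rw [mul_comm]; exact Complex.mul_conj' _
      have h2 : star ((‖form A u v‖ : ℂ)) = ‖form A u v‖ := Complex.conj_ofReal _
      rw [h2, div_mul_eq_mul_div, this]
      field_simp
  have := quad_nonneg hA ((t : ℂ) • u + (-z) • v)
  rw [quad_add hA.1, quad_smul, quad_smul, form_smul_left, form_smul_right, star_neg,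
    neg_mul, hz'] at this
  simp [hz] at this
  nlinarith [this]

lemma norm_form_le {A : Matrix ι ι ℂ} (hA : A.PosSemidef) (u v : ι → ℂ) {t : ℝ} (ht : 0 < t) :
    ‖form A u v‖ ≤ (t * quad A u + quad A v / t) / 2 := by
  have h := quad_discrim hA u v t
  have : 2 * t * ‖form A u v‖ ≤ t ^ 2 * quad A u + quad A v := by linarith
  have h3 : (t * quad A u + quad A v / t) / 2 = (t ^ 2 * quad A u + quad A v) / (2 * t) := by
    field_simp
  rw [h3, le_div_iff₀ (by positivity)]
  linarith

lemma norm_form_sq_le {A : Matrix ι ι ℂ} (hA : A.PosSemidef) (u v : ι → ℂ) :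
    ‖form A u v‖ ^ 2 ≤ quad A u * quad A v := by
  have h : ∀ t : ℝ, 0 ≤ quad A u * (t * t) + (-(2 * ‖form A u v‖)) * t + quad A v := fun t => by
    have := quad_discrim hA u v t
    linarith
  have := discrim_le_zero h
  rw [discrim] at this
  nlinarith

lemma quad_add_le {A : Matrix ι ι ℂ} (hA : A.PosSemidef) (u v : ι → ℂ) {t : ℝ} (ht : 0 < t) :
    quad A (u + v) ≤ (1 + t) * quad A u + (1 + 1 / t) * quad A v := by
  rw [quad_add hA.1]
  have h1 := norm_form_le hA u v ht
  have h2 := Complex.re_le_norm (form A u v)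
  have : quad A v / t = 1 / t * quad A v := by ring
  linarith

variable [DecidableEq ι]

lemma form_single (A : Matrix ι ι ℂ) (u : ι → ℂ) (p : ι) :
    form A u (Pi.single p 1) = (Aᵀ *ᵥ u) p := by
  have : star (Pi.single p (1 : ℂ)) = (Pi.single p (1 : ℂ) : ι → ℂ) := by
    ext i; by_cases h : i = p
    · subst h; simp
    · simp [h]
  rw [form, this, Matrix.mulVec_single_one]
  simp [Matrix.mulVec, dotProduct, mul_comm]

/-- A positive definite form dominates the Euclidean one with the constant `tr A⁻¹`. -/
lemma sum_norm_sq_le {A : Matrix ι ι ℂ} (hA : A.PosDef) (v : ι → ℂ) :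
    ∑ p, ‖v p‖ ^ 2 ≤ (A⁻¹).trace.re * quad A v := by
  have hdet : IsUnit A.det := (Matrix.isUnit_iff_isUnit_det A).1 hA.isUnit
  have key : ∀ p, ‖v p‖ ^ 2 ≤ quad A v * (A⁻¹ p p).re := by
    intro p
    have h1 : A *ᵥ star (star (A⁻¹ *ᵥ Pi.single p 1)) = Pi.single p 1 := by
      rw [star_star, Matrix.mulVec_mulVec, Matrix.mul_nonsing_inv _ hdet, Matrix.one_mulVec]
    have h := norm_form_sq_le hA.posSemidef v (star (A⁻¹ *ᵥ Pi.single p 1))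
    have h2 : form A v (star (A⁻¹ *ᵥ Pi.single p 1)) = v p := by
      rw [form, h1]; simp
    have h3 : quad A (star (A⁻¹ *ᵥ Pi.single p 1)) = (A⁻¹ p p).re := by
      rw [quad, form, h1]; simp
    rwa [h2, h3] at h
  calc ∑ p, ‖v p‖ ^ 2 ≤ ∑ p, quad A v * (A⁻¹ p p).re := Finset.sum_le_sum fun p _ => key p
    _ = _ := by rw [← Finset.mul_sum, Matrix.trace, Complex.re_sum, mul_comm]; rfl

end Form

/-! ### The circle, its characters, and the spectral factors -/

instance : IsProbabilityMeasure circ := by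
  constructor
  have h : (0 : ℝ) < 2 * Real.pi := by positivity
  rw [circ, Measure.smul_apply, Measure.restrict_apply_univ, Real.volume_Ioc, smul_eq_mul]
  rw [show Real.pi - -Real.pi = 2 * Real.pi by ring]
  exact ENNReal.inv_mul_cancel (by simpa using Real.pi_pos) ENNReal.ofReal_ne_top

lemma circ_absolutelyContinuous : circ ≪ volume :=
  (Measure.smul_absolutelyContinuous).trans Measure.restrict_le_self.absolutelyContinuous

lemma ae_circ_mem : ∀ᵐ x ∂circ, x ∈ Set.Ioc (-Real.pi) Real.pi :=
  Measure.smul_absolutelyContinuous.ae_le (ae_restrict_mem measurableSet_Ioc)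

lemma cis_eq (k : ℤ) (x : ℝ) : cis k x = Complex.exp ((k * x : ℝ) * Complex.I) := by
  simp [cis]

lemma norm_cis (k : ℤ) (x : ℝ) : ‖cis k x‖ = 1 := by
  rw [cis_eq, Complex.norm_exp_ofReal_mul_I]

lemma cis_add (k l : ℤ) (x : ℝ) : cis (k + l) x = cis k x * cis l x := by
  rw [cis, cis, cis, ← Complex.exp_add]; congr 1; push_cast; ring

lemma cis_zero (x : ℝ) : cis 0 x = 1 := by simp [cis]

lemma star_cis (k : ℤ) (x : ℝ) : star (cis k x) = cis (-k) x := by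
  rw [cis_eq, cis_eq]
  change (starRingEnd ℂ) _ = _
  rw [← Complex.exp_conj, map_mul, Complex.conj_ofReal, Complex.conj_I]
  push_cast; ring_nf

lemma continuous_cis (k : ℤ) : Continuous (cis k) := by
  unfold cis; fun_prop

lemma aesm_cis (k : ℤ) : AEStronglyMeasurable (cis k) circ :=
  (continuous_cis k).aestronglyMeasurable

lemma integrable_cis_mul {u : ℝ → ℂ} (hu : Integrable u circ) (k : ℤ) :
    Integrable (fun x => cis k x * u x) circ :=
  hu.bdd_mul (c := 1) (aesm_cis k) (Eventually.of_forall fun x => (norm_cis k x).le)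

lemma integrable_cis (k : ℤ) : Integrable (cis k) circ :=
  (integrable_const (1 : ℝ)).mono' (aesm_cis k) (Eventually.of_forall fun x => (norm_cis k x).le)

lemma integral_cis (k : ℤ) : ∫ x, cis k x ∂circ = if k = 0 then 1 else 0 := by
  split_ifs with h
  · subst h
    simp [cis_zero]
  · rw [circ, integral_smul_measure, ← intervalIntegral.integral_of_le (by linarith [Real.pi_pos])]
    have hk : (k : ℂ) * Complex.I ≠ 0 := by simp [h]
    have : ∀ x : ℝ, cis k x = Complex.exp ((k : ℂ) * Complex.I * x) := fun x => by
      rw [cis]; ring_nf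
    simp_rw [this]
    rw [integral_exp_mul_complex hk]
    have : Complex.exp ((k : ℂ) * Complex.I * (Real.pi : ℝ))
        = Complex.exp ((k : ℂ) * Complex.I * (-Real.pi : ℝ)) := by
      rw [Complex.exp_eq_exp_iff_exists_int]
      exact ⟨k, by push_cast; ring⟩
    rw [this]; simp

/-- The ratio `χ(e^{-ix}) / β(ix)`, a spectral square root of the weight. -/
noncomputable def rho {r : ℕ} (g : GMIndex r) (x : ℝ) : ℂ := chi g x / beta g x

lemma norm_rho_sq {r : ℕ} (g : GMIndex r) (x : ℝ) : ‖rho g x‖ ^ 2 = weight g x := by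
  rw [rho, norm_div, div_pow, weight]

lemma weight_nonneg {r : ℕ} (g : GMIndex r) (x : ℝ) : 0 ≤ weight g x := by
  rw [← norm_rho_sq]; positivity

lemma continuous_chi {r : ℕ} (g : GMIndex r) : Continuous (chi g) := by
  unfold chi
  exact (incPoly g).continuous.comp (by fun_prop)

lemma continuous_beta {r : ℕ} (g : GMIndex r) : Continuous (beta g) := by
  unfold beta; fun_prop

lemma measurable_rho {r : ℕ} (g : GMIndex r) : Measurable (rho g) :=
  (continuous_chi g).measurable.div (continuous_beta g).measurable

lemma measurable_weight {r : ℕ} (g : GMIndex r) : Measurable (weight g) := by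
  simp_rw [funext fun x => (norm_rho_sq g x).symm]
  exact (measurable_rho g).norm.pow_const 2

lemma chi_eq {r : ℕ} (g : GMIndex r) (x : ℝ) :
    chi g x = ∏ i, (1 - cis (-((g.step i * g.season i : ℕ) : ℤ)) x) ^ g.order i := by
  simp only [chi, incPoly, Polynomial.eval_prod, Polynomial.eval_pow, Polynomial.eval_sub,
    Polynomial.eval_one, Polynomial.eval_X, ← Complex.exp_nat_mul]
  refine Finset.prod_congr rfl fun i _ => ?_
  rw [cis]; congr 3; push_cast; ring

/-- A nontrivial character equals one only on a countable set. -/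
lemma countable_cis_eq_one {k : ℤ} (hk : k ≠ 0) : {x : ℝ | cis k x = 1}.Countable := by
  refine (Set.countable_range fun n : ℤ => (n * (2 * Real.pi) / k : ℝ)).mono ?_
  intro x hx
  rw [Set.mem_ofPred_eq, cis_eq, Complex.exp_eq_one_iff] at hx
  obtain ⟨n, hn⟩ := hx
  refine ⟨n, ?_⟩
  have hk' : (k : ℝ) ≠ 0 := by exact_mod_cast hk
  have h2 : ((k * x : ℝ) : ℂ) = ((n * (2 * Real.pi) : ℝ) : ℂ) := by
    apply mul_right_cancel₀ Complex.I_ne_zero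
    rw [hn]; push_cast; ring
  have h3 : k * x = n * (2 * Real.pi) := by exact_mod_cast h2
  simp only
  field_simp
  linarith

lemma ae_chi_ne_zero {r : ℕ} (g : GMIndex r) (hg : g.Positive) : ∀ᵐ x ∂circ, chi g x ≠ 0 := by
  refine circ_absolutelyContinuous.ae_le ?_
  have : ∀ᵐ x : ℝ, ∀ i : Fin r, cis (-((g.step i * g.season i : ℕ) : ℤ)) x ≠ 1 := by
    rw [ae_all_iff]
    intro i
    have h := Nat.mul_pos (hg i).1 (hg i).2.1
    have := (countable_cis_eq_one (k := -((g.step i * g.season i : ℕ) : ℤ))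
      (by omega)).ae_notMem volume
    filter_upwards [this] with x hx using hx
  filter_upwards [this] with x hx
  rw [chi_eq]
  exact Finset.prod_ne_zero_iff.2 fun i _ => pow_ne_zero _ (sub_ne_zero.2 (hx i).symm)

lemma beta_factor_eq (x : ℝ) (s : ℕ) (k : ℤ) :
    Complex.I * (x : ℂ) - 2 * (Real.pi : ℂ) * Complex.I * (k : ℂ) / (s : ℂ)
      = Complex.I * ((x - 2 * Real.pi * k / s : ℝ) : ℂ) := by
  push_cast; ring

lemma ae_beta_ne_zero {r : ℕ} (g : GMIndex r) : ∀ᵐ x ∂circ, beta g x ≠ 0 := by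
  refine circ_absolutelyContinuous.ae_le ?_
  have : ∀ᵐ x : ℝ, ∀ (i : Fin r) (k : ℤ), x ≠ 2 * Real.pi * k / g.season i := by
    rw [ae_all_iff]; intro i
    rw [ae_all_iff]; intro k
    exact Measure.ae_ne volume _
  filter_upwards [this] with x hx
  refine Finset.prod_ne_zero_iff.2 fun i _ => Finset.prod_ne_zero_iff.2 fun k _ => pow_ne_zero _ ?_
  rw [beta_factor_eq]
  exact mul_ne_zero Complex.I_ne_zero (by exact_mod_cast sub_ne_zero.2 (hx i k))

lemma ae_rho_ne_zero {r : ℕ} (g : GMIndex r) (hg : g.Positive) : ∀ᵐ x ∂circ, rho g x ≠ 0 := by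
  filter_upwards [ae_chi_ne_zero g hg, ae_beta_ne_zero g] with x h1 h2 using div_ne_zero h1 h2

lemma ae_weight_pos {r : ℕ} (g : GMIndex r) (hg : g.Positive) : ∀ᵐ x ∂circ, 0 < weight g x := by
  filter_upwards [ae_rho_ne_zero g hg] with x h
  rw [← norm_rho_sq]; positivity

/-- One seasonal factor of `χ` is dominated by the corresponding factor of `β`: near the zero
`2πk/s` closest to `x` both vanish to first order, and the other zeros are at distance at least
`π/s` from `x`. -/
lemma norm_one_sub_cis_le (m s : ℕ) (hs : 0 < s) : ∃ K : ℝ, ∀ x : ℝ,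
    ‖1 - cis (-((m * s : ℕ) : ℤ)) x‖ ≤
      K * ∏ k ∈ Finset.Icc (-((s / 2 : ℕ) : ℤ)) ((s / 2 : ℕ) : ℤ), |x - 2 * Real.pi * k / s| := by
  set S := Finset.Icc (-((s / 2 : ℕ) : ℤ)) ((s / 2 : ℕ) : ℤ) with hS
  have hs' : (0 : ℝ) < s := by exact_mod_cast hs
  have hps : 0 < Real.pi / s := by positivity
  refine ⟨(m * s) * ((Real.pi / s) ^ (S.card - 1))⁻¹, fun x => ?_⟩
  have hne : S.Nonempty := ⟨0, by rw [hS, Finset.mem_Icc]; omega⟩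
  obtain ⟨k₀, hk₀, hmin⟩ := S.exists_min_image (fun k : ℤ => |x - 2 * Real.pi * k / s|) hne
  have h1 : ‖1 - cis (-((m * s : ℕ) : ℤ)) x‖ ≤ (m * s) * |x - 2 * Real.pi * k₀ / s| := by
    have hc : cis (-((m * s : ℕ) : ℤ)) x
        = Complex.exp (Complex.I * ((-(m * s) * (x - 2 * Real.pi * k₀ / s) : ℝ) : ℂ)) := by
      rw [cis, Complex.exp_eq_exp_iff_exists_int]
      refine ⟨-(m * k₀), ?_⟩
      have : (s : ℂ) ≠ 0 := by exact_mod_cast hs.ne'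
      push_cast
      field_simp
      ring
    rw [norm_sub_rev, hc]
    refine (Real.norm_exp_I_mul_ofReal_sub_one_le).trans ?_
    rw [Real.norm_eq_abs, abs_mul, abs_neg, abs_of_nonneg (by positivity : (0 : ℝ) ≤ m * s)]
  have h2 : (Real.pi / s) ^ (S.card - 1) ≤ ∏ k ∈ S.erase k₀, |x - 2 * Real.pi * k / s| := by
    rw [← Finset.card_erase_of_mem hk₀, ← Finset.prod_const]
    refine Finset.prod_le_prod (fun _ _ => hps.le) fun k hk => ?_
    obtain ⟨hk1, hk2⟩ := Finset.mem_erase.1 hk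
    have hm := hmin k hk2
    have h3 : 2 * Real.pi / s ≤ |2 * Real.pi * k / s - 2 * Real.pi * k₀ / s| := by
      have h4 : (2 * Real.pi * k / s - 2 * Real.pi * k₀ / s : ℝ)
          = 2 * Real.pi / s * ((k - k₀ : ℤ) : ℝ) := by push_cast; ring
      rw [h4, abs_mul, abs_of_pos (by positivity : 0 < 2 * Real.pi / s)]
      have h5 : (1 : ℝ) ≤ |((k - k₀ : ℤ) : ℝ)| := by
        rw [← Int.cast_abs]; exact_mod_cast Int.one_le_abs (sub_ne_zero.2 hk1)
      have : 0 < 2 * Real.pi / s := by positivity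
      nlinarith
    have h6 : |2 * Real.pi * k / s - 2 * Real.pi * k₀ / s|
        ≤ |x - 2 * Real.pi * k / s| + |x - 2 * Real.pi * k₀ / s| := by
      have := abs_sub_le (2 * Real.pi * k / s) x (2 * Real.pi * k₀ / s)
      rwa [abs_sub_comm _ x] at this
    have h7 : 2 * Real.pi / s = Real.pi / s + Real.pi / s := by ring
    linarith
  rw [← Finset.mul_prod_erase S _ hk₀]
  have hpos : 0 < (Real.pi / s) ^ (S.card - 1) := by positivity
  calc _ ≤ (m * s) * |x - 2 * Real.pi * k₀ / s| := h1
    _ = (m * s) * ((Real.pi / s) ^ (S.card - 1))⁻¹ *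
        (|x - 2 * Real.pi * k₀ / s| * (Real.pi / s) ^ (S.card - 1)) := by field_simp
    _ ≤ _ := by gcongr

/-- Every zero of `β` is a zero of `χ` of at least the same order, so the weight is bounded. -/
lemma exists_weight_le {r : ℕ} (g : GMIndex r) (hg : g.Positive) :
    ∃ K : ℝ, ∀ x, weight g x ≤ K := by
  choose K hK using fun i => norm_one_sub_cis_le (g.step i) (g.season i) (hg i).2.1
  refine ⟨(∏ i, |K i| ^ g.order i) ^ 2, fun x => ?_⟩
  rw [← norm_rho_sq]
  refine pow_le_pow_left₀ (norm_nonneg _) ?_ 2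
  rw [rho, norm_div]
  refine div_le_of_le_mul₀ (norm_nonneg _) (by positivity) ?_
  rw [chi_eq, beta, norm_prod, norm_prod, ← Finset.prod_mul_distrib]
  refine Finset.prod_le_prod (fun i _ => norm_nonneg _) fun i _ => ?_
  rw [norm_pow, Finset.prod_pow, norm_pow, ← mul_pow]
  refine pow_le_pow_left₀ (norm_nonneg _) ?_ _
  rw [norm_prod]
  simp_rw [beta_factor_eq, norm_mul, Complex.norm_I, one_mul, Complex.norm_real, Real.norm_eq_abs]
  refine (hK i x).trans ?_
  gcongr
  exact le_abs_self _

/-! ### The Hilbert space of a matrix density -/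

section L2

variable {T : ℕ} {F : ℝ → Matrix (Fin T) (Fin T) ℂ} {u v : ℝ → Fin T → ℂ}

/-- Square integrability with respect to a matrix density. -/
def MemL2 (F : ℝ → Matrix (Fin T) (Fin T) ℂ) (u : ℝ → Fin T → ℂ) : Prop :=
  (∀ p, AEStronglyMeasurable (fun x => u x p) circ) ∧ normSq F u < ∞

/-- The squared norm of `L₂(F)` as a real number. -/
noncomputable def nsq (F : ℝ → Matrix (Fin T) (Fin T) ℂ) (u : ℝ → Fin T → ℂ) : ℝ :=
  ∫ x, quad (F x) (u x) ∂circ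

lemma normSq_def (F : ℝ → Matrix (Fin T) (Fin T) ℂ) (u : ℝ → Fin T → ℂ) :
    normSq F u = ∫⁻ x, ENNReal.ofReal (quad (F x) (u x)) ∂circ := rfl

lemma normSq_congr_ae (h : u =ᵐ[circ] v) : normSq F u = normSq F v :=
  lintegral_congr_ae (h.mono fun x hx => by simp only [hx])

lemma aesm_form (hF : ∀ i j, AEStronglyMeasurable (fun x => F x i j) circ)
    (hu : ∀ p, AEStronglyMeasurable (fun x => u x p) circ)
    (hv : ∀ p, AEStronglyMeasurable (fun x => v x p) circ) :
    AEStronglyMeasurable (fun x => form (F x) (u x) (v x)) circ := by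
  simp_rw [form_eq_sum]
  refine Finset.aestronglyMeasurable_fun_sum _ fun i _ =>
    Finset.aestronglyMeasurable_fun_sum _ fun j _ => ?_
  exact (hu i).mul ((hF i j).mul (continuous_star.comp_aestronglyMeasurable (hv j)))

lemma IsSpectralDensity.aesm (hF : IsSpectralDensity F) (i j : Fin T) :
    AEStronglyMeasurable (fun x => F x i j) circ := (hF.1 i j).1

lemma aesm_quad (hF : ∀ i j, AEStronglyMeasurable (fun x => F x i j) circ)
    (hu : ∀ p, AEStronglyMeasurable (fun x => u x p) circ) :
    AEStronglyMeasurable (fun x => quad (F x) (u x)) circ :=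
  Complex.continuous_re.comp_aestronglyMeasurable (aesm_form hF hu hu)

lemma ae_quad_nonneg (hF : IsSpectralDensity F) (u : ℝ → Fin T → ℂ) :
    ∀ᵐ x ∂circ, 0 ≤ quad (F x) (u x) := hF.2.mono fun _ hx => quad_nonneg hx _

lemma MemL2.integrable_quad (hF : IsSpectralDensity F) (hu : MemL2 F u) :
    Integrable (fun x => quad (F x) (u x)) circ :=
  (lintegral_ofReal_ne_top_iff_integrable (aesm_quad hF.aesm hu.1) (ae_quad_nonneg hF u)).1
    hu.2.ne

lemma normSq_eq_ofReal (hF : IsSpectralDensity F) (hu : MemL2 F u) :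
    normSq F u = ENNReal.ofReal (nsq F u) :=
  (ofReal_integral_eq_lintegral_ofReal (hu.integrable_quad hF) (ae_quad_nonneg hF u)).symm

lemma nsq_nonneg (hF : IsSpectralDensity F) (u : ℝ → Fin T → ℂ) : 0 ≤ nsq F u :=
  integral_nonneg_of_ae (ae_quad_nonneg hF u)

lemma nsq_le_iff (hF : IsSpectralDensity F) (hu : MemL2 F u) {K : ℝ} (hK : 0 ≤ K) :
    nsq F u ≤ K ↔ normSq F u ≤ ENNReal.ofReal K := by
  rw [normSq_eq_ofReal hF hu, ENNReal.ofReal_le_ofReal_iff hK]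

lemma memL2_of_integrable_quad (hF : IsSpectralDensity F)
    (hu : ∀ p, AEStronglyMeasurable (fun x => u x p) circ)
    (h : Integrable (fun x => quad (F x) (u x)) circ) : MemL2 F u :=
  ⟨hu, lt_top_iff_ne_top.2 <| (lintegral_ofReal_ne_top_iff_integrable (aesm_quad hF.aesm hu)
    (ae_quad_nonneg hF u)).2 h⟩

lemma integrable_form (hF : IsSpectralDensity F) (hu : MemL2 F u) (hv : MemL2 F v) :
    Integrable (fun x => form (F x) (u x) (v x)) circ := by
  refine ((hu.integrable_quad hF).add (hv.integrable_quad hF)).mono'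
    (aesm_form hF.aesm hu.1 hv.1) ?_
  filter_upwards [hF.2] with x hx
  have h := norm_form_le hx (u x) (v x) one_pos
  have h1 := quad_nonneg hx (u x)
  have h2 := quad_nonneg hx (v x)
  simp only [Pi.add_apply]
  linarith

lemma MemL2.add (hF : IsSpectralDensity F) (hu : MemL2 F u) (hv : MemL2 F v) :
    MemL2 F (fun x => u x + v x) := by
  refine memL2_of_integrable_quad hF (fun p => (hu.1 p).add (hv.1 p)) ?_
  refine (((hu.integrable_quad hF).add (hv.integrable_quad hF)).add
    ((integrable_form hF hu hv).re.const_mul 2)).congr ?_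
  filter_upwards [hF.2] with x hx using (quad_add hx.1 _ _).symm

lemma MemL2.smul (hu : MemL2 F u) (z : ℂ) : MemL2 F (fun x => z • u x) := by
  refine ⟨fun p => (hu.1 p).const_mul z, ?_⟩
  rw [normSq_def]
  simp_rw [quad_smul, ENNReal.ofReal_mul (sq_nonneg ‖z‖)]
  rw [lintegral_const_mul' _ _ ENNReal.ofReal_ne_top]
  exact ENNReal.mul_lt_top ENNReal.ofReal_lt_top hu.2

lemma MemL2.sub (hF : IsSpectralDensity F) (hu : MemL2 F u) (hv : MemL2 F v) :
    MemL2 F (fun x => u x - v x) := by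
  simpa [sub_eq_add_neg] using hu.add hF (hv.smul (-1))

lemma nsq_add (hF : IsSpectralDensity F) (hu : MemL2 F u) (hv : MemL2 F v) :
    nsq F (fun x => u x + v x)
      = nsq F u + nsq F v + 2 * (∫ x, form (F x) (u x) (v x) ∂circ).re := by
  have h1 : (∫ x, form (F x) (u x) (v x) ∂circ).re = ∫ x, (form (F x) (u x) (v x)).re ∂circ :=
    (integral_re (integrable_form hF hu hv)).symm
  have h2 : Integrable (fun x => quad (F x) (u x) + quad (F x) (v x)) circ :=
    (hu.integrable_quad hF).add (hv.integrable_quad hF)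
  have h3 : Integrable (fun x => 2 * (form (F x) (u x) (v x)).re) circ :=
    (integrable_form hF hu hv).re.const_mul 2
  rw [h1, nsq, nsq, nsq, ← integral_const_mul, ← integral_add (hu.integrable_quad hF)
    (hv.integrable_quad hF), ← integral_add h2 h3]
  refine integral_congr_ae ?_
  filter_upwards [hF.2] with x hx using quad_add hx.1 _ _

lemma nsq_smul (z : ℂ) : nsq F (fun x => z • u x) = ‖z‖ ^ 2 * nsq F u := by
  simp_rw [nsq, quad_smul]
  rw [integral_const_mul]

lemma nsq_add_le (hF : IsSpectralDensity F) (hu : MemL2 F u) (hv : MemL2 F v) {t : ℝ}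
    (ht : 0 < t) :
    nsq F (fun x => u x + v x) ≤ (1 + t) * nsq F u + (1 + 1 / t) * nsq F v := by
  rw [nsq, nsq, nsq, ← integral_const_mul, ← integral_const_mul,
    ← integral_add ((hu.integrable_quad hF).const_mul _) ((hv.integrable_quad hF).const_mul _)]
  refine integral_mono_ae ((hu.add hF hv).integrable_quad hF)
    (((hu.integrable_quad hF).const_mul _).add ((hv.integrable_quad hF).const_mul _)) ?_
  filter_upwards [hF.2] with x hx using quad_add_le hx _ _ ht

lemma norm_integral_form_le (hF : IsSpectralDensity F) (hu : MemL2 F u) (hv : MemL2 F v) {t : ℝ}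
    (ht : 0 < t) :
    ‖∫ x, form (F x) (u x) (v x) ∂circ‖ ≤ (t * nsq F u + nsq F v / t) / 2 := by
  have h : (t * nsq F u + nsq F v / t) / 2
      = ∫ x, (t * quad (F x) (u x) + quad (F x) (v x) / t) / 2 ∂circ := by
    rw [integral_div, integral_add ((hu.integrable_quad hF).const_mul _)
      ((hv.integrable_quad hF).div_const _), integral_const_mul, integral_div]
    rfl
  rw [h]
  refine norm_integral_le_of_norm_le ((((hu.integrable_quad hF).const_mul _).add
      ((hv.integrable_quad hF).div_const _)).div_const _) ?_
  filter_upwards [hF.2] with x hx using norm_form_le hx _ _ ht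

/-- A quadratic form is dominated by the entries of its matrix on bounded vectors. -/
lemma quad_le_of_norm_le {A : Matrix (Fin T) (Fin T) ℂ} {w : Fin T → ℂ} {K : ℝ}
    (hw : ‖w‖ ≤ K) : quad A w ≤ ∑ i, ∑ j, K ^ 2 * ‖A i j‖ := by
  have hK : 0 ≤ K := (norm_nonneg _).trans hw
  refine (Complex.re_le_norm _).trans ?_
  rw [form_eq_sum]
  refine (norm_sum_le _ _).trans (Finset.sum_le_sum fun i _ => (norm_sum_le _ _).trans
    (Finset.sum_le_sum fun j _ => ?_))
  rw [norm_mul, norm_mul, norm_star]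
  have h1 := (norm_le_pi_norm w i).trans hw
  have h2 := (norm_le_pi_norm w j).trans hw
  calc ‖w i‖ * (‖A i j‖ * ‖w j‖) ≤ K * (‖A i j‖ * K) := by gcongr
    _ = _ := by ring

lemma integrable_sum_norm (hF : IsSpectralDensity F) (K : ℝ) :
    Integrable (fun x => ∑ i, ∑ j, K * ‖F x i j‖) circ :=
  integrable_finsetSum _ fun i _ => integrable_finsetSum _ fun j _ => (hF.1 i j).norm.const_mul _

lemma memL2_of_bounded (hF : IsSpectralDensity F)
    (hu : ∀ p, AEStronglyMeasurable (fun x => u x p) circ) {K : ℝ}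
    (hK : ∀ᵐ x ∂circ, ‖u x‖ ≤ K) : MemL2 F u := by
  refine memL2_of_integrable_quad hF hu ?_
  refine (integrable_sum_norm hF (K ^ 2)).mono' (aesm_quad hF.aesm hu) ?_
  filter_upwards [hK, hF.2] with x hx hx'
  rw [Real.norm_of_nonneg (quad_nonneg hx' _)]
  exact quad_le_of_norm_le hx

lemma tendsto_quad {A : Matrix (Fin T) (Fin T) ℂ} {w : ℕ → Fin T → ℂ} {w' : Fin T → ℂ}
    (h : Tendsto w atTop (𝓝 w')) : Tendsto (fun n => quad A (w n)) atTop (𝓝 (quad A w')) := by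
  have : Continuous (quad A) := by
    unfold quad
    simp_rw [form_eq_sum]
    fun_prop
  exact (this.tendsto w').comp h

/-- Fatou's lemma in `L₂(F)`. -/
lemma normSq_le_of_tendsto (hF : IsSpectralDensity F) {w : ℕ → ℝ → Fin T → ℂ} {K : ℝ≥0∞}
    (hw : ∀ n p, AEStronglyMeasurable (fun x => w n x p) circ)
    (h : ∀ᵐ x ∂circ, Tendsto (fun n => w n x) atTop (𝓝 (u x)))
    (hK : ∀ᶠ n in atTop, normSq F (w n) ≤ K) : normSq F u ≤ K := by
  have h1 : normSq F u
      = ∫⁻ x, liminf (fun n => ENNReal.ofReal (quad (F x) (w n x))) atTop ∂circ := by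
    refine lintegral_congr_ae ?_
    filter_upwards [h] with x hx
    exact ((ENNReal.tendsto_ofReal (tendsto_quad hx)).liminf_eq).symm
  rw [h1]
  refine (lintegral_liminf_le' fun n =>
    (aesm_quad hF.aesm (hw n)).aemeasurable.ennreal_ofReal).trans
    ?_
  exact liminf_le_of_frequently_le' hK.frequently

/-- Bounded pointwise convergence implies convergence in `L₂(F)`. -/
lemma tendsto_normSq_of_bounded (hF : IsSpectralDensity F) {w : ℕ → ℝ → Fin T → ℂ} {K : ℝ}
    (hw : ∀ n p, AEStronglyMeasurable (fun x => w n x p) circ)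
    (h : ∀ᵐ x ∂circ, Tendsto (fun n => w n x) atTop (𝓝 0))
    (hK : ∀ n, ∀ᵐ x ∂circ, ‖w n x‖ ≤ K) : Tendsto (fun n => normSq F (w n)) atTop (𝓝 0) := by
  have h0 : (0 : ℝ≥0∞) = ∫⁻ x, ENNReal.ofReal (quad (F x) 0) ∂circ := by simp [quad_zero]
  rw [h0]
  refine tendsto_lintegral_of_dominated_convergence'
    (fun x => ENNReal.ofReal (∑ i, ∑ j, K ^ 2 * ‖F x i j‖))
    (fun n => (aesm_quad hF.aesm (hw n)).aemeasurable.ennreal_ofReal) ?_ ?_ ?_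
  · intro n
    filter_upwards [hK n] with x hx using ENNReal.ofReal_le_ofReal (quad_le_of_norm_le hx)
  · exact ((integrable_sum_norm hF (K ^ 2)).lintegral_lt_top).ne
  · filter_upwards [h] with x hx using ENNReal.tendsto_ofReal (tendsto_quad hx)

/-! ### Trigonometric polynomials with negative frequencies and their closure -/

/-- The polynomial `∑_{k=1}^n s(k) e^{-ikx}` (with `s` indexed from `0`). -/
noncomputable def negPoly (n : ℕ) (s : ℕ → Fin T → ℂ) (x : ℝ) : Fin T → ℂ :=
  ∑ k ∈ Finset.range n, cis (-((k : ℤ) + 1)) x • s k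

/-- A vector trigonometric polynomial with negative frequencies only. -/
def IsNegPoly (p : ℝ → Fin T → ℂ) : Prop := ∃ n s, p = negPoly n s

lemma isNegPoly_zero : IsNegPoly (fun _ => (0 : Fin T → ℂ)) := ⟨0, 0, by ext; simp [negPoly]⟩

lemma IsNegPoly.add {p p' : ℝ → Fin T → ℂ} (hp : IsNegPoly p) (hp' : IsNegPoly p') :
    IsNegPoly (fun x => p x + p' x) := by
  obtain ⟨n, s, rfl⟩ := hp
  obtain ⟨m, s', rfl⟩ := hp'
  have key : ∀ (n N : ℕ) (s : ℕ → Fin T → ℂ) (x : ℝ), n ≤ N →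
      negPoly n s x = negPoly N (fun k => if k < n then s k else 0) x := by
    intro n N s x h
    rw [negPoly, negPoly, ← Finset.sum_subset (Finset.range_subset_range.2 h)]
    · exact Finset.sum_congr rfl fun k hk => by rw [if_pos (Finset.mem_range.1 hk)]
    · intro k _ hk
      rw [if_neg (by simpa using hk), smul_zero]
  refine ⟨max n m, fun k => (if k < n then s k else 0) + (if k < m then s' k else 0),
    funext fun x => ?_⟩
  rw [key n (max n m) s x (le_max_left _ _), key m (max n m) s' x (le_max_right _ _), negPoly,
    negPoly, negPoly, ← Finset.sum_add_distrib]
  simp_rw [← smul_add]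

lemma IsNegPoly.smul {p : ℝ → Fin T → ℂ} (hp : IsNegPoly p) (z : ℂ) :
    IsNegPoly (fun x => z • p x) := by
  obtain ⟨n, s, rfl⟩ := hp
  refine ⟨n, fun k => z • s k, funext fun x => ?_⟩
  simp_rw [negPoly, Finset.smul_sum, smul_comm z]

lemma isNegPoly_cis (m : ℕ) (c : Fin T → ℂ) :
    IsNegPoly (fun x => cis (-((m : ℤ) + 1)) x • c) := by
  refine ⟨m + 1, fun k => if k = m then c else 0, funext fun x => ?_⟩
  rw [negPoly, Finset.sum_eq_single m]
  · simp
  · intro k _ hk; simp [hk]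
  · intro h; simp at h

lemma IsNegPoly.sum {ι : Type*} (s : Finset ι) {p : ι → ℝ → Fin T → ℂ}
    (hp : ∀ i ∈ s, IsNegPoly (p i)) : IsNegPoly (fun x => ∑ i ∈ s, p i x) := by
  classical
  induction s using Finset.induction_on with
  | empty => simpa using isNegPoly_zero
  | insert i s hi ih =>
    simp_rw [Finset.sum_insert hi]
    exact (hp i (Finset.mem_insert_self i s)).add
      (ih fun j hj => hp j (Finset.mem_insert_of_mem hj))

lemma IsNegPoly.aesm {p : ℝ → Fin T → ℂ} (hp : IsNegPoly p) (q : Fin T) :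
    AEStronglyMeasurable (fun x => p x q) circ := by
  obtain ⟨n, s, rfl⟩ := hp
  refine Continuous.aestronglyMeasurable ?_
  simp only [negPoly, Finset.sum_apply, Pi.smul_apply]
  exact continuous_finsetSum _ fun k _ => (continuous_cis _).smul continuous_const

lemma IsNegPoly.bounded {p : ℝ → Fin T → ℂ} (hp : IsNegPoly p) : ∃ K : ℝ, ∀ x, ‖p x‖ ≤ K := by
  obtain ⟨n, s, rfl⟩ := hp
  refine ⟨∑ k ∈ Finset.range n, ‖s k‖, fun x => (norm_sum_le _ _).trans ?_⟩
  simp [norm_smul, norm_cis]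

lemma IsNegPoly.memL2 (hF : IsSpectralDensity F) {p : ℝ → Fin T → ℂ} (hp : IsNegPoly p) :
    MemL2 F p := by
  obtain ⟨K, hK⟩ := hp.bounded
  exact memL2_of_bounded hF hp.aesm (Eventually.of_forall hK)

/-- The closure in `L₂(F)` of the trigonometric polynomials with negative frequencies. -/
def NegPast (F : ℝ → Matrix (Fin T) (Fin T) ℂ) : Set (ℝ → Fin T → ℂ) :=
  {v | MemL2 F v ∧ ∀ ε : ℝ≥0∞, 0 < ε → ∃ p, IsNegPoly p ∧ normSq F (fun x => v x - p x) ≤ ε}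

lemma NegPast.exists_nsq_le (hF : IsSpectralDensity F) (hv : v ∈ NegPast F) {ε : ℝ}
    (hε : 0 < ε) : ∃ p, IsNegPoly p ∧ nsq F (fun x => v x - p x) ≤ ε := by
  obtain ⟨p, hp, h⟩ := hv.2 (ENNReal.ofReal ε) (by simpa using hε)
  exact ⟨p, hp, (nsq_le_iff hF (hv.1.sub hF (hp.memL2 hF)) hε.le).2 h⟩

lemma negPast_of_nsq (hF : IsSpectralDensity F) (hv : MemL2 F v)
    (h : ∀ ε : ℝ, 0 < ε → ∃ p, IsNegPoly p ∧ nsq F (fun x => v x - p x) ≤ ε) :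
    v ∈ NegPast F := by
  refine ⟨hv, fun ε hε => ?_⟩
  by_cases hε' : ε = ∞
  · exact ⟨_, isNegPoly_zero, by simp [hε']⟩
  · obtain ⟨p, hp, h⟩ := h ε.toReal (ENNReal.toReal_pos hε.ne' hε')
    refine ⟨p, hp, ?_⟩
    rw [nsq_le_iff hF (hv.sub hF (hp.memL2 hF)) ENNReal.toReal_nonneg] at h
    exact h.trans (ENNReal.ofReal_toReal_le)

lemma IsNegPoly.mem_negPast (hF : IsSpectralDensity F) {p : ℝ → Fin T → ℂ} (hp : IsNegPoly p) :
    p ∈ NegPast F :=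
  ⟨hp.memL2 hF, fun ε _ => ⟨p, hp, by simp [normSq]⟩⟩

lemma NegPast.add_smul (hF : IsSpectralDensity F) (hu : u ∈ NegPast F) (hv : v ∈ NegPast F)
    (z : ℂ) : (fun x => u x + z • v x) ∈ NegPast F := by
  refine negPast_of_nsq hF (hu.1.add hF (hv.1.smul z)) fun ε hε => ?_
  obtain ⟨p, hp, h⟩ := NegPast.exists_nsq_le hF hu (ε := ε / 4) (by positivity)
  obtain ⟨p', hp', h'⟩ := NegPast.exists_nsq_le hF hv (ε := ε / (4 * (‖z‖ ^ 2 + 1)))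
    (by positivity)
  refine ⟨_, hp.add (hp'.smul z), ?_⟩
  have := nsq_add_le hF (hu.1.sub hF (hp.memL2 hF))
    ((hv.1.sub hF (hp'.memL2 hF)).smul z) one_pos
  rw [nsq_smul] at this
  have h3 : ‖z‖ ^ 2 * nsq F (fun x => v x - p' x) ≤ ε / 4 := by
    calc _ ≤ (‖z‖ ^ 2 + 1) * (ε / (4 * (‖z‖ ^ 2 + 1))) := by
          gcongr
          · exact nsq_nonneg hF _
          · linarith
      _ = ε / 4 := by field_simp
  have h4 : (fun x => u x + z • v x - (p x + z • p' x))
      = fun x => (u x - p x) + z • (v x - p' x) := by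
    funext x; rw [smul_sub]; abel
  rw [h4]
  linarith

lemma NegPast.sub (hF : IsSpectralDensity F) (hu : u ∈ NegPast F) (hv : v ∈ NegPast F) :
    (fun x => u x - v x) ∈ NegPast F := by
  simpa [sub_eq_add_neg] using NegPast.add_smul hF hu hv (-1)

/-- Orthogonality to the polynomials extends to their closure. -/
lemma integral_form_eq_zero_of_negPoly (hF : IsSpectralDensity F) (hu : MemL2 F u)
    (h : ∀ p, IsNegPoly p → ∫ x, form (F x) (u x) (p x) ∂circ = 0) (hv : v ∈ NegPast F) :
    ∫ x, form (F x) (u x) (v x) ∂circ = 0 := by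
  have key : ∀ t : ℝ, 0 < t →
      ‖∫ x, form (F x) (u x) (v x) ∂circ‖ ≤ t * (nsq F u + 1) / 2 := by
    intro t ht
    obtain ⟨p, hp, hle⟩ := NegPast.exists_nsq_le hF hv (ε := t ^ 2) (by positivity)
    have h1 := norm_integral_form_le hF hu (hv.1.sub hF (hp.memL2 hF)) ht
    have h2 : ∫ x, form (F x) (u x) (v x - p x) ∂circ = ∫ x, form (F x) (u x) (v x) ∂circ := by
      simp_rw [form_sub_right]
      rw [integral_sub (integrable_form hF hu hv.1) (integrable_form hF hu (hp.memL2 hF)),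
        h p hp, sub_zero]
    rw [h2] at h1
    have h3 : nsq F (fun x => v x - p x) / t ≤ t := by
      rw [div_le_iff₀ ht]; linarith [sq t]
    linarith
  rw [← norm_le_zero_iff]
  refine le_of_forall_pos_le_add fun ε hε => ?_
  have hn : 0 < nsq F u + 1 := by linarith [nsq_nonneg hF u]
  have := key (2 * ε / (nsq F u + 1)) (by positivity)
  rw [div_mul_cancel₀ _ hn.ne'] at this
  linarith

/-! ### Projections -/

/-- `v` is the orthogonal projection of `B` on the closure of the negative polynomials. -/
def IsProj (F : ℝ → Matrix (Fin T) (Fin T) ℂ) (B v : ℝ → Fin T → ℂ) : Prop :=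
  v ∈ NegPast F ∧ ∀ u ∈ NegPast F, ∫ x, form (F x) (B x - v x) (u x) ∂circ = 0

lemma IsProj.nsq_eq (hF : IsSpectralDensity F) {B : ℝ → Fin T → ℂ} (hB : MemL2 F B)
    (hv : IsProj F B v) (hu : u ∈ NegPast F) :
    nsq F (fun x => B x - u x) = nsq F (fun x => B x - v x) + nsq F (fun x => v x - u x) := by
  have h := nsq_add hF (hB.sub hF hv.1.1) (hv.1.1.sub hF hu.1)
  rw [hv.2 _ (NegPast.sub hF hv.1 hu)] at h
  simpa using h

lemma IsProj.normSq_le (hF : IsSpectralDensity F) {B : ℝ → Fin T → ℂ} (hB : MemL2 F B)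
    (hv : IsProj F B v) (hu : u ∈ NegPast F) :
    normSq F (fun x => B x - v x) ≤ normSq F (fun x => B x - u x) := by
  rw [normSq_eq_ofReal hF (hB.sub hF hv.1.1), normSq_eq_ofReal hF (hB.sub hF hu.1),
    hv.nsq_eq hF hB hu]
  exact ENNReal.ofReal_le_ofReal (by linarith [nsq_nonneg hF (fun x => v x - u x)])

/-- The Euclidean norm is dominated by the form of `F` up to an integrable factor. This is how
the minimality condition enters: it embeds `L₂(F)` continuously into `L₁`. -/
structure IsCoercive (F : ℝ → Matrix (Fin T) (Fin T) ℂ) (τ : ℝ → ℝ) : Prop where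
  integrable : Integrable τ circ
  nonneg : ∀ᵐ x ∂circ, 0 ≤ τ x
  le : ∀ᵐ x ∂circ, ∀ w : Fin T → ℂ, ‖w‖ ^ 2 ≤ τ x * quad (F x) w

lemma norm_le_of_sq_le {a b y t : ℝ} (h : y ^ 2 ≤ a * b) (ha : 0 ≤ a) (hb : 0 ≤ b)
    (ht : 0 < t) : y ≤ (t * a + b / t) / 2 := by
  have h1 : (t * a) * (b / t) = a * b := by field_simp
  have h2 : 0 ≤ t * a := by positivity
  have h3 : 0 ≤ b / t := by positivity
  refine le_of_sq_le_sq ?_ (by positivity)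
  nlinarith [sq_nonneg (t * a - b / t)]

lemma aesm_pi (hu : ∀ p, AEStronglyMeasurable (fun x => u x p) circ) :
    AEStronglyMeasurable u circ :=
  (aemeasurable_pi_iff.2 fun p => (hu p).aemeasurable).aestronglyMeasurable

lemma IsCoercive.lintegral_le {τ : ℝ → ℝ} (hτ : IsCoercive F τ) (hF : IsSpectralDensity F)
    (hu : MemL2 F u) {t : ℝ} (ht : 0 < t) :
    ∫⁻ x, ‖u x‖ₑ ∂circ ≤ ENNReal.ofReal ((t * ∫ x, τ x ∂circ + nsq F u / t) / 2) := by
  have h : (t * ∫ x, τ x ∂circ + nsq F u / t) / 2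
      = ∫ x, (t * τ x + quad (F x) (u x) / t) / 2 ∂circ := by
    rw [integral_div, integral_add (hτ.integrable.const_mul _)
      ((hu.integrable_quad hF).div_const _), integral_const_mul, integral_div]
    rfl
  have hle : ∀ᵐ x ∂circ, ‖u x‖ ≤ (t * τ x + quad (F x) (u x) / t) / 2 := by
    filter_upwards [hτ.nonneg, hτ.le, hF.2] with x h1 h2 h3
    exact norm_le_of_sq_le (h2 _) h1 (quad_nonneg h3 _) ht
  have hint : Integrable (fun x => (t * τ x + quad (F x) (u x) / t) / 2) circ :=
    ((hτ.integrable.const_mul _).add ((hu.integrable_quad hF).div_const _)).div_const _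
  rw [h, ofReal_integral_eq_lintegral_ofReal hint (hle.mono fun x hx =>
      (norm_nonneg _).trans hx)]
  refine lintegral_mono_ae (hle.mono fun x hx => ?_)
  rw [← ofReal_norm]
  exact ENNReal.ofReal_le_ofReal hx

lemma IsCoercive.integrable_apply {τ : ℝ → ℝ} (hτ : IsCoercive F τ) (hF : IsSpectralDensity F)
    (hu : MemL2 F u) : Integrable u circ :=
  ⟨aesm_pi hu.1, (hτ.lintegral_le hF hu one_pos).trans_lt ENNReal.ofReal_lt_top⟩

/-- Convergence in `L₂(F)` implies almost everywhere convergence of a subsequence. -/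
lemma IsCoercive.exists_subseq {τ : ℝ → ℝ} (hτ : IsCoercive F τ) (hF : IsSpectralDensity F)
    {w : ℕ → ℝ → Fin T → ℂ} (hw : ∀ n, MemL2 F (w n))
    (h : Tendsto (fun n => nsq F (w n)) atTop (𝓝 0)) :
    ∃ ns : ℕ → ℕ, StrictMono ns ∧ ∀ᵐ x ∂circ, Tendsto (fun n => w (ns n) x) atTop (𝓝 0) := by
  have h1 : TendstoInMeasure circ (fun n x => quad (F x) (w n x)) atTop (fun _ => (0 : ℝ)) := by
    refine tendstoInMeasure_of_tendsto_eLpNorm one_ne_zero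
      (fun n => aesm_quad hF.aesm (hw n).1) aestronglyMeasurable_const ?_
    have : ∀ n, eLpNorm ((fun x => quad (F x) (w n x)) - fun _ => (0 : ℝ)) 1 circ
        = ENNReal.ofReal (nsq F (w n)) := by
      intro n
      rw [eLpNorm_one_eq_lintegral_enorm, ← normSq_eq_ofReal hF (hw n), normSq_def]
      refine lintegral_congr_ae ?_
      filter_upwards [hF.2] with x hx
      simp only [Pi.sub_apply, sub_zero]
      rw [Real.enorm_of_nonneg (quad_nonneg hx _)]
    simp_rw [this]
    simpa using ENNReal.tendsto_ofReal h
  obtain ⟨ns, hns, hx⟩ := h1.exists_seq_tendsto_ae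
  refine ⟨ns, hns, ?_⟩
  filter_upwards [hx, hτ.le] with x h2 h3
  rw [tendsto_zero_iff_norm_tendsto_zero]
  have h4 : Tendsto (fun n => τ x * quad (F x) (w (ns n) x)) atTop (𝓝 0) := by
    simpa using h2.const_mul (τ x)
  have h5 : Tendsto (fun n => ‖w (ns n) x‖ ^ 2) atTop (𝓝 0) :=
    squeeze_zero (fun _ => by positivity) (fun n => h3 _) h4
  have h6 := (Real.continuous_sqrt.tendsto 0).comp h5
  simpa [Function.comp_def, Real.sqrt_sq (norm_nonneg _)] using h6

end L2

section Projection

variable {T : ℕ} {F : ℝ → Matrix (Fin T) (Fin T) ℂ} {B u v : ℝ → Fin T → ℂ}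

lemma nsq_parallelogram (hF : IsSpectralDensity F) (hu : MemL2 F u) (hv : MemL2 F v) :
    nsq F (fun x => u x + v x) + nsq F (fun x => u x - v x) = 2 * (nsq F u + nsq F v) := by
  have h1 := nsq_add hF hu hv
  have h2 := nsq_add hF hu (hv.smul (-1))
  rw [nsq_smul] at h2
  simp_rw [form_smul_right] at h2
  rw [integral_const_mul] at h2
  simp only [neg_smul, one_smul, ← sub_eq_add_neg, norm_neg, norm_one, one_pow, one_mul, star_neg,
    star_one, neg_mul, Complex.neg_re] at h2
  linarith

/-- The infimum over polynomials is a lower bound for the whole closure. -/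
lemma NegPast.le_nsq (hF : IsSpectralDensity F) (hB : MemL2 F B) {d : ℝ}
    (hd : ∀ p, IsNegPoly p → d ≤ nsq F (fun x => B x - p x)) (hu : u ∈ NegPast F) :
    d ≤ nsq F (fun x => B x - u x) := by
  set N := nsq F (fun x => B x - u x) with hN
  have hN0 : 0 ≤ N := nsq_nonneg hF _
  have key : ∀ t : ℝ, 0 < t → d ≤ (1 + t) * N + t := by
    intro t ht
    obtain ⟨p, hp, hle⟩ := NegPast.exists_nsq_le hF hu (ε := t / (1 + 1 / t)) (by positivity)
    have h1 := nsq_add_le hF (hB.sub hF hu.1) (hu.1.sub hF (hp.memL2 hF)) ht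
    simp only [sub_add_sub_cancel] at h1
    have h2 : (1 + 1 / t) * nsq F (fun x => u x - p x) ≤ t := by
      rw [le_div_iff₀ (by positivity)] at hle; linarith
    linarith [hd p hp]
  refine le_of_forall_pos_le_add fun ε hε => ?_
  have := key (ε / (N + 1)) (by positivity)
  have h3 : ε / (N + 1) * (N + 1) = ε := by field_simp
  nlinarith

/-- The elements of the closure nearest to `B` are the orthogonal projections. -/
lemma isProj_of_forall_le (hF : IsSpectralDensity F) (hB : MemL2 F B) (hv : v ∈ NegPast F)
    (h : ∀ u ∈ NegPast F, nsq F (fun x => B x - v x) ≤ nsq F (fun x => B x - u x)) :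
    IsProj F B v := by
  refine ⟨hv, fun u hu => ?_⟩
  set I := ∫ x, form (F x) (B x - v x) (u x) ∂circ with hI
  set s : ℝ := 1 / (nsq F u + 1) with hs
  have hu0 := nsq_nonneg hF u
  have hs0 : 0 < s := by positivity
  have h1 := h _ (NegPast.add_smul hF hv hu ((s : ℂ) * I))
  have h2 := nsq_add hF (hB.sub hF hv.1) (hu.1.smul (-((s : ℂ) * I)))
  rw [nsq_smul] at h2
  simp_rw [form_smul_right] at h2
  rw [integral_const_mul, ← hI] at h2
  have h3 : (fun x => B x - v x + -((s : ℂ) * I) • u x)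
      = fun x => B x - (v x + ((s : ℂ) * I) • u x) := by
    funext x; rw [neg_smul]; abel
  have h4 : (star (-((s : ℂ) * I)) * I).re = -(s * ‖I‖ ^ 2) := by
    have : star I * I = ((‖I‖ ^ 2 : ℝ) : ℂ) := by
      push_cast; exact Complex.conj_mul' I
    have h5 : star (s : ℂ) = s := Complex.conj_ofReal s
    rw [star_neg, star_mul', h5, neg_mul, mul_assoc, this, Complex.neg_re, Complex.re_ofReal_mul,
      Complex.ofReal_re]
  rw [h3, h4, norm_neg, norm_mul, Complex.norm_real, Real.norm_of_nonneg hs0.le] at h2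
  rw [h2] at h1
  have h6 : s * nsq F u ≤ 1 := by
    rw [hs, one_div, inv_mul_le_iff₀ (by positivity)]; linarith
  have h7 : s * ‖I‖ ^ 2 ≤ 0 := by
    have : (s * ‖I‖) ^ 2 * nsq F u = (s * ‖I‖ ^ 2) * (s * nsq F u) := by ring
    have h8 : 0 ≤ s * ‖I‖ ^ 2 := by positivity
    nlinarith
  have h9 : ‖I‖ ^ 2 ≤ 0 := by
    by_contra hc
    push Not at hc
    have := mul_pos hs0 hc
    linarith
  have : ‖I‖ = 0 := by nlinarith [norm_nonneg I]
  simpa using this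

/-- For a coercive density the projection on the past exists. A minimizing sequence of polynomials
is Cauchy by the parallelogram law; coercivity makes it convergent almost everywhere, and Fatou's
lemma identifies the limit. -/
theorem exists_isProj (hF : IsSpectralDensity F) {τ : ℝ → ℝ} (hτ : IsCoercive F τ)
    (hB : MemL2 F B) : ∃ v, IsProj F B v := by
  set S : Set ℝ := {y | ∃ p, IsNegPoly p ∧ y = nsq F (fun x => B x - p x)} with hS
  have hSne : S.Nonempty := ⟨_, _, isNegPoly_zero, rfl⟩
  have hSbd : BddBelow S := ⟨0, by rintro _ ⟨p, -, rfl⟩; exact nsq_nonneg hF _⟩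
  set d := sInf S with hd
  have hd0 : 0 ≤ d := le_csInf hSne (by rintro _ ⟨p, -, rfl⟩; exact nsq_nonneg hF _)
  have hdle : ∀ p, IsNegPoly p → d ≤ nsq F (fun x => B x - p x) := fun p hp =>
    csInf_le hSbd ⟨p, hp, rfl⟩
  have hex : ∀ n : ℕ, ∃ p, IsNegPoly p ∧ nsq F (fun x => B x - p x) < d + ((1 / 2) ^ n) ^ 2 := by
    intro n
    obtain ⟨_, ⟨p, hp, rfl⟩, h⟩ := exists_lt_of_csInf_lt hSne
      (lt_add_of_pos_right d (by positivity : (0 : ℝ) < ((1 / 2) ^ n) ^ 2))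
    exact ⟨p, hp, h⟩
  choose p hp hpd using hex
  have hpm : ∀ n, MemL2 F (p n) := fun n => (hp n).memL2 hF
  have hmono : ∀ N n : ℕ, N ≤ n → ((1 / 2 : ℝ) ^ n) ^ 2 ≤ ((1 / 2) ^ N) ^ 2 := fun N n h =>
    pow_le_pow_left₀ (by positivity) (pow_le_pow_of_le_one (by norm_num) (by norm_num) h) 2
  have hcau : ∀ N n m : ℕ, N ≤ n → N ≤ m →
      nsq F (fun x => p n x - p m x) ≤ 4 * ((1 / 2) ^ N) ^ 2 := by
    intro N n m hn hm
    have h1 := nsq_parallelogram hF (hB.sub hF (hpm m)) (hB.sub hF (hpm n))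
    have h2 : (fun x => B x - p m x - (B x - p n x)) = fun x => p n x - p m x := by
      funext x; abel
    have h3 : (fun x => B x - p m x + (B x - p n x))
        = fun x => (2 : ℂ) • (B x - ((1 / 2 : ℂ) • (p n x + p m x))) := by
      funext x; ext i
      simp only [Pi.add_apply, Pi.sub_apply, Pi.smul_apply, smul_eq_mul]
      ring
    rw [h2, h3, nsq_smul] at h1
    have h4 := hdle _ (((hp n).add (hp m)).smul (1 / 2))
    have h5 := hpd n
    have h6 := hpd m
    have h7 := hmono N n hn
    have h8 := hmono N m hm
    have h9 : ‖(2 : ℂ)‖ ^ 2 = 4 := by norm_num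
    rw [h9] at h1
    linarith
  set Iτ := ∫ x, τ x ∂circ with hIτ
  have hIτ0 : 0 ≤ Iτ := integral_nonneg_of_ae hτ.nonneg
  have hlim : ∀ᵐ x ∂circ, ∃ l, Tendsto (fun n => p n x) atTop (𝓝 l) := by
    refine MeasureTheory.Lp.ae_tendsto_of_cauchy_eLpNorm (p := 1)
      (B := fun N => ENNReal.ofReal ((1 / 2 : ℝ) ^ N * (Iτ + 5)))
      (fun n => aesm_pi (hpm n).1) le_rfl ?_ ?_
    · have hs : Summable fun N : ℕ => (1 / 2 : ℝ) ^ N * (Iτ + 5) :=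
        (summable_geometric_of_lt_one (by norm_num) (by norm_num)).mul_right _
      exact hs.tsum_ofReal_ne_top
    · intro N n m hn hm
      rw [eLpNorm_one_eq_lintegral_enorm]
      have ht : (0 : ℝ) < (1 / 2) ^ N := by positivity
      refine (hτ.lintegral_le hF ((hpm n).sub hF (hpm m)) ht).trans_lt ?_
      refine (ENNReal.ofReal_lt_ofReal_iff (by positivity)).2 ?_
      have h1 : nsq F (fun x => p n x - p m x) / (1 / 2) ^ N ≤ 4 * (1 / 2) ^ N := by
        rw [div_le_iff₀ ht]; linarith [hcau N n m hn hm]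
      nlinarith
  obtain ⟨v, hvm, hv⟩ := exists_stronglyMeasurable_limit_of_tendsto_ae
    (fun n => aesm_pi (hpm n).1) hlim
  have hvp : ∀ q, AEStronglyMeasurable (fun x => v x q) circ := fun q =>
    (continuous_apply q).comp_aestronglyMeasurable hvm.aestronglyMeasurable
  have hclose : ∀ n, normSq F (fun x => v x - p n x)
      ≤ ENNReal.ofReal (4 * ((1 / 2) ^ n) ^ 2) := by
    intro n
    refine normSq_le_of_tendsto hF (w := fun m x => p m x - p n x)
      (fun m q => ((hpm m).sub hF (hpm n)).1 q) ?_ ?_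
    · filter_upwards [hv] with x hx using hx.sub_const _
    · filter_upwards [eventually_ge_atTop n] with m hm
      rw [normSq_eq_ofReal hF ((hpm m).sub hF (hpm n))]
      exact ENNReal.ofReal_le_ofReal (hcau n m n hm le_rfl)
  have hvL : MemL2 F v := by
    have h : MemL2 F (fun x => v x - p 0 x) :=
      ⟨fun q => (hvp q).sub ((hpm 0).1 q), (hclose 0).trans_lt ENNReal.ofReal_lt_top⟩
    simpa using h.add hF (hpm 0)
  have hvP : v ∈ NegPast F := by
    refine negPast_of_nsq hF hvL fun ε hε => ?_
    have : Tendsto (fun n : ℕ => 4 * ((1 / 2 : ℝ) ^ n) ^ 2) atTop (𝓝 (4 * 0 ^ 2)) :=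
      ((tendsto_pow_atTop_nhds_zero_of_lt_one (by norm_num) (by norm_num)).pow 2).const_mul 4
    obtain ⟨n, hn⟩ := (this.eventually (gt_mem_nhds (by simpa using hε))).exists
    exact ⟨p n, hp n, ((nsq_le_iff hF (hvL.sub hF (hpm n)) (by positivity)).2
      (hclose n)).trans hn.le⟩
  refine ⟨v, isProj_of_forall_le hF hB hvP fun u hu => le_trans ?_ (NegPast.le_nsq hF hB hdle hu)⟩
  refine le_of_forall_pos_le_add fun ε hε => ?_
  rw [nsq_le_iff hF (hB.sub hF hvL) (by positivity)]
  refine normSq_le_of_tendsto hF (w := fun m x => B x - p m x)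
    (fun m q => (hB.sub hF (hpm m)).1 q) ?_ ?_
  · filter_upwards [hv] with x hx using hx.const_sub _
  · have : Tendsto (fun n : ℕ => d + ((1 / 2 : ℝ) ^ n) ^ 2) atTop (𝓝 (d + 0 ^ 2)) :=
      ((tendsto_pow_atTop_nhds_zero_of_lt_one (by norm_num) (by norm_num)).pow 2).const_add d
    filter_upwards [this.eventually (gt_mem_nhds (by simpa using hε : d + 0 ^ 2 < d + ε))]
      with n hn
    rw [normSq_eq_ofReal hF (hB.sub hF (hpm n))]
    exact ENNReal.ofReal_le_ofReal ((hpd n).le.trans hn.le)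

/-! ### Convex combinations of densities -/

/-- The segment from `F` to `F'`. -/
noncomputable def mix (ε : ℝ) (F F' : ℝ → Matrix (Fin T) (Fin T) ℂ) (x : ℝ) :
    Matrix (Fin T) (Fin T) ℂ :=
  ((1 - ε : ℝ) : ℂ) • F x + ((ε : ℝ) : ℂ) • F' x

variable {F' : ℝ → Matrix (Fin T) (Fin T) ℂ} {ε : ℝ}

lemma quad_mix (x : ℝ) (w : Fin T → ℂ) :
    quad (mix ε F F' x) w = (1 - ε) * quad (F x) w + ε * quad (F' x) w := by
  rw [mix, quad_add_mat, quad_smul_mat, quad_smul_mat]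

lemma isSpectralDensity_mix (hF : IsSpectralDensity F) (hF' : IsSpectralDensity F')
    (h0 : 0 ≤ ε) (h1 : ε ≤ 1) : IsSpectralDensity (mix ε F F') := by
  refine ⟨fun i j => ?_, ?_⟩
  · exact ((hF.1 i j).const_mul _).add ((hF'.1 i j).const_mul _)
  · filter_upwards [hF.2, hF'.2] with x hx hx'
    refine (hx.smul ?_).add (hx'.smul ?_)
    · exact_mod_cast sub_nonneg.2 h1
    · exact_mod_cast h0

lemma normSq_mix (hF : IsSpectralDensity F) (hF' : IsSpectralDensity F')
    (hu : ∀ p, AEStronglyMeasurable (fun x => u x p) circ) (h0 : 0 ≤ ε) (h1 : ε ≤ 1) :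
    normSq (mix ε F F') u
      = ENNReal.ofReal (1 - ε) * normSq F u + ENNReal.ofReal ε * normSq F' u := by
  rw [normSq_def, normSq_def, normSq_def, ← lintegral_const_mul' _ _ ENNReal.ofReal_ne_top,
    ← lintegral_const_mul' _ _ ENNReal.ofReal_ne_top, ← lintegral_add_left']
  · refine lintegral_congr_ae ?_
    filter_upwards [ae_quad_nonneg hF u, ae_quad_nonneg hF' u] with x h2 h3
    rw [quad_mix, ENNReal.ofReal_add (mul_nonneg (by linarith) h2) (mul_nonneg h0 h3),
      ENNReal.ofReal_mul (by linarith), ENNReal.ofReal_mul h0]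
  · exact (aesm_quad hF.aesm hu).aemeasurable.ennreal_ofReal.const_mul _

lemma isCoercive_mix {τ : ℝ → ℝ} (hτ : IsCoercive F τ) (hF' : IsSpectralDensity F')
    (h0 : 0 ≤ ε) (h1 : ε < 1) : IsCoercive (mix ε F F') (fun x => τ x / (1 - ε)) := by
  have h : 0 < 1 - ε := by linarith
  refine ⟨hτ.integrable.div_const _, hτ.nonneg.mono fun x hx => div_nonneg hx h.le, ?_⟩
  filter_upwards [hτ.nonneg, hτ.le, hF'.2] with x h2 h3 h4 w
  rw [quad_mix]
  have h5 := quad_nonneg h4 w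
  have h6 : τ x / (1 - ε) * ((1 - ε) * quad (F x) w + ε * quad (F' x) w)
      = τ x * quad (F x) w + τ x / (1 - ε) * (ε * quad (F' x) w) := by
    field_simp
  rw [h6]
  have : 0 ≤ τ x / (1 - ε) * (ε * quad (F' x) w) := by positivity
  linarith [h3 w]

lemma ofReal_mul_normSq_le_mix (hF : IsSpectralDensity F) (hF' : IsSpectralDensity F')
    (hu : ∀ p, AEStronglyMeasurable (fun x => u x p) circ) (h0 : 0 ≤ ε) (h1 : ε ≤ 1) :
    ENNReal.ofReal (1 - ε) * normSq F u ≤ normSq (mix ε F F') u := by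
  rw [normSq_mix hF hF' hu h0 h1]; exact le_self_add

lemma MemL2.of_mix (hF : IsSpectralDensity F) (hF' : IsSpectralDensity F') (h0 : 0 ≤ ε)
    (h1 : ε < 1) (hu : MemL2 (mix ε F F') u) : MemL2 F u := by
  refine ⟨hu.1, ?_⟩
  have h := (ofReal_mul_normSq_le_mix hF hF' hu.1 h0 h1.le).trans_lt hu.2
  by_contra hc
  rw [not_lt, top_le_iff] at hc
  rw [hc, ENNReal.mul_top (by simpa using h1)] at h
  exact absurd h (lt_irrefl _)

lemma NegPast.of_mix (hF : IsSpectralDensity F) (hF' : IsSpectralDensity F') (h0 : 0 ≤ ε)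
    (h1 : ε < 1) (hu : u ∈ NegPast (mix ε F F')) : u ∈ NegPast F := by
  have hM := isSpectralDensity_mix hF hF' h0 h1.le
  have h2 : 0 < 1 - ε := by linarith
  refine negPast_of_nsq hF (hu.1.of_mix hF hF' h0 h1) fun δ hδ => ?_
  obtain ⟨p, hp, hle⟩ := hu.2 (ENNReal.ofReal ((1 - ε) * δ)) (by simp; positivity)
  refine ⟨p, hp, ?_⟩
  have hm := (hu.1.of_mix hF hF' h0 h1).sub hF (hp.memL2 hF)
  have h3 := (ofReal_mul_normSq_le_mix hF hF' hm.1 h0 h1.le).trans hle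
  rw [normSq_eq_ofReal hF hm, ← ENNReal.ofReal_mul h2.le,
    ENNReal.ofReal_le_ofReal_iff (by positivity)] at h3
  exact le_of_mul_le_mul_left h3 h2

/-- The saddle point inequality. If the prediction error does not increase along the segment
from `F` to `F'`, then the predictor optimal for `F` has under `F'` an error at most its error
under `F`. The predictors `v_ε` optimal for the mixtures satisfy this bound by comparison, they
converge to `v` in `L₂(F)` by Pythagoras, and the bound passes to the limit by Fatou's lemma. -/
theorem normSq_le_of_mix_le (hF : IsSpectralDensity F) {τ : ℝ → ℝ} (hτ : IsCoercive F τ)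
    (hF' : IsSpectralDensity F') (hB : ∀ G, IsSpectralDensity G → MemL2 G B)
    (hv : IsProj F B v)
    (hmax : ∀ ε : ℝ, 0 < ε → ε < 1 → ∀ w, IsProj (mix ε F F') B w →
      normSq (mix ε F F') (fun x => B x - w x) ≤ normSq F (fun x => B x - v x)) :
    normSq F' (fun x => B x - v x) ≤ normSq F (fun x => B x - v x) := by
  set ε : ℕ → ℝ := fun n => 1 / ((n : ℝ) + 2) with hε
  have hε0 : ∀ n, 0 < ε n := fun n => by simp only [hε]; positivity
  have hε1 : ∀ n, ε n ≤ 1 / 2 := fun n => by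
    simp only [hε]
    exact one_div_le_one_div_of_le (by norm_num) (by linarith [n.cast_nonneg (α := ℝ)])
  have hε2 : ∀ n, ε n < 1 := fun n => (hε1 n).trans_lt (by norm_num)
  have hMx := fun n => isSpectralDensity_mix hF hF' (hε0 n).le (hε2 n).le
  choose w hw using fun n => exists_isProj (hMx n) (isCoercive_mix hτ hF' (hε0 n).le (hε2 n))
    (hB _ (hMx n))
  have hwF : ∀ n, w n ∈ NegPast F := fun n => NegPast.of_mix hF hF' (hε0 n).le (hε2 n) (hw n).1
  set V := nsq F (fun x => B x - v x) with hV
  have hV0 : 0 ≤ V := nsq_nonneg hF _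
  have hBv := (hB F hF).sub hF hv.1.1
  have hBw := fun n => (hB F hF).sub hF (hwF n).1
  -- Expand the error of `w n` under the mixture and use Pythagoras under `F`.
  have key : ∀ n, ENNReal.ofReal (1 - ε n) * ENNReal.ofReal (V + nsq F (fun x => v x - w n x))
      + ENNReal.ofReal (ε n) * normSq F' (fun x => B x - w n x) ≤ ENNReal.ofReal V := by
    intro n
    have h := hmax (ε n) (hε0 n) (hε2 n) (w n) (hw n)
    rwa [normSq_mix hF hF' (hBw n).1 (hε0 n).le (hε2 n).le, normSq_eq_ofReal hF (hBw n),
      normSq_eq_ofReal hF hBv, hv.nsq_eq hF (hB F hF) (hwF n)] at h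
  have hD : ∀ n, nsq F (fun x => v x - w n x) ≤ 2 * V * ε n := by
    intro n
    have h := le_self_add.trans (key n)
    have hD0 := nsq_nonneg hF (fun x => v x - w n x)
    rw [← ENNReal.ofReal_mul (by linarith [hε2 n]), ENNReal.ofReal_le_ofReal_iff hV0] at h
    nlinarith [hε1 n, hε0 n]
  have hQ : ∀ n, normSq F' (fun x => B x - w n x) ≤ ENNReal.ofReal V := by
    intro n
    have h := key n
    have h1 : ENNReal.ofReal (1 - ε n) * ENNReal.ofReal V + ENNReal.ofReal (ε n) *
        normSq F' (fun x => B x - w n x) ≤ ENNReal.ofReal (1 - ε n) * ENNReal.ofReal V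
        + ENNReal.ofReal (ε n) * ENNReal.ofReal V := by
      have h2 : ENNReal.ofReal (1 - ε n) * ENNReal.ofReal V
          + ENNReal.ofReal (ε n) * ENNReal.ofReal V = ENNReal.ofReal V := by
        rw [← add_mul, ← ENNReal.ofReal_add (by linarith [hε2 n]) (hε0 n).le]; simp
      rw [h2]
      refine le_trans ?_ h
      gcongr
      linarith [nsq_nonneg hF (fun x => v x - w n x)]
    have h3 := (ENNReal.add_le_add_iff_left (ENNReal.mul_ne_top ENNReal.ofReal_ne_top
      ENNReal.ofReal_ne_top)).1 h1
    exact (ENNReal.mul_le_mul_iff_right (by simpa using hε0 n) ENNReal.ofReal_ne_top).1 h3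
  have hεlim : Tendsto ε atTop (𝓝 0) := by
    have := tendsto_one_div_add_atTop_nhds_zero_nat (𝕜 := ℝ)
    refine ((tendsto_add_atTop_iff_nat 1).2 this).congr fun n => ?_
    simp only [hε]; push_cast; ring
  have hlim : Tendsto (fun n => nsq F (fun x => v x - w n x)) atTop (𝓝 0) := by
    refine squeeze_zero (fun n => nsq_nonneg hF _) hD ?_
    simpa using hεlim.const_mul (2 * V)
  obtain ⟨ns, -, hns⟩ := hτ.exists_subseq hF (fun n => hv.1.1.sub hF (hwF n).1) hlim
  rw [normSq_eq_ofReal hF hBv]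
  refine normSq_le_of_tendsto hF' (w := fun n x => B x - w (ns n) x)
    (fun n => (hBw (ns n)).1) ?_ (Eventually.of_forall fun n => hQ (ns n))
  filter_upwards [hns] with x hx
  have : Tendsto (fun n => B x - v x + (v x - w (ns n) x)) atTop (𝓝 (B x - v x + 0)) :=
    hx.const_add _
  simpa using this

end Projection

/-! ### Passing to the weighted density -/

section Weighted

variable {T r : ℕ} {g : GMIndex r} {f : ℝ → Matrix (Fin T) (Fin T) ℂ} {b : ℕ → Fin T → ℂ}

/-- The weighted density `(|χ|² / |β|²) f`. Multiplication by `χ / β` is an isometry from its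
`L₂` space onto `L₂(f)`. -/
noncomputable def wdens (g : GMIndex r) (f : ℝ → Matrix (Fin T) (Fin T) ℂ) (x : ℝ) :
    Matrix (Fin T) (Fin T) ℂ :=
  (weight g x : ℂ) • f x

lemma quad_wdens (x : ℝ) (u : Fin T → ℂ) : quad (wdens g f x) u = weight g x * quad (f x) u :=
  quad_smul_mat _ _ _

lemma quad_rho_smul (x : ℝ) (u : Fin T → ℂ) :
    quad (f x) (rho g x • u) = quad (wdens g f x) u := by
  rw [quad_smul, quad_wdens, norm_rho_sq]

lemma isSpectralDensity_wdens (hg : g.Positive) (hf : IsSpectralDensity f) :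
    IsSpectralDensity (wdens g f) := by
  obtain ⟨K, hK⟩ := exists_weight_le g hg
  refine ⟨fun i j => ?_, ?_⟩
  · refine (hf.1 i j).bdd_mul (c := K)
      (Complex.measurable_ofReal.comp (measurable_weight g)).aestronglyMeasurable
      (Eventually.of_forall fun x => ?_)
    rw [Complex.norm_real, Real.norm_of_nonneg (weight_nonneg g x)]
    exact hK x
  · filter_upwards [hf.2] with x hx
    exact hx.smul (by exact_mod_cast weight_nonneg g x)

lemma normSq_rho_smul (v : ℝ → Fin T → ℂ) :
    normSq f (fun x => rho g x • v x) = normSq (wdens g f) v := by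
  simp_rw [normSq_def, quad_rho_smul]

lemma pastPoly_eq (n : ℕ) (s : ℕ → Fin T → ℂ) (x : ℝ) :
    pastPoly g n s x = rho g x • negPoly n s x := by
  simp_rw [pastPoly, negPoly, Finset.smul_sum, smul_smul, mul_comm (rho g x)]
  rfl

lemma rho_smul_inv (hg : g.Positive) (h : ℝ → Fin T → ℂ) :
    (fun x => rho g x • (rho g x)⁻¹ • h x) =ᵐ[circ] h := by
  filter_upwards [ae_rho_ne_zero g hg] with x hx
  rw [smul_smul, mul_inv_cancel₀ hx, one_smul]

lemma rho_smul_mem_L2Past {v : ℝ → Fin T → ℂ} (hv : v ∈ NegPast (wdens g f)) :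
    (fun x => rho g x • v x) ∈ L2Past g f := by
  refine ⟨fun p => (measurable_rho g).aestronglyMeasurable.mul (hv.1.1 p), ?_, fun ε hε => ?_⟩
  · rw [normSq_rho_smul]; exact hv.1.2
  · obtain ⟨_, ⟨n, s, rfl⟩, hle⟩ := hv.2 ε hε
    refine ⟨n, s, ?_⟩
    simp_rw [pastPoly_eq, ← smul_sub]
    rwa [normSq_rho_smul]

lemma inv_rho_smul_mem_negPast (hg : g.Positive) {h : ℝ → Fin T → ℂ} (hh : h ∈ L2Past g f) :
    (fun x => (rho g x)⁻¹ • h x) ∈ NegPast (wdens g f) := by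
  refine ⟨⟨fun p => (measurable_rho g).inv.aestronglyMeasurable.mul (hh.1 p), ?_⟩, fun ε hε => ?_⟩
  · rw [← normSq_rho_smul, normSq_congr_ae (rho_smul_inv hg h)]; exact hh.2.1
  · obtain ⟨n, s, hle⟩ := hh.2.2 ε hε
    refine ⟨_, ⟨n, s, rfl⟩, ?_⟩
    rw [← normSq_rho_smul]
    refine le_of_eq_of_le (normSq_congr_ae ?_) hle
    filter_upwards [rho_smul_inv hg h] with x hx
    rw [smul_sub, hx, pastPoly_eq]

lemma mem_L2Past_congr_ae {h h' : ℝ → Fin T → ℂ} (hh : h ∈ L2Past g f) (he : h =ᵐ[circ] h') :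
    h' ∈ L2Past g f := by
  refine ⟨fun p => (hh.1 p).congr (he.mono fun x hx => by simp only [hx]), ?_, fun ε hε => ?_⟩
  · rw [← normSq_congr_ae he]; exact hh.2.1
  · obtain ⟨n, s, hle⟩ := hh.2.2 ε hε
    refine ⟨n, s, le_of_eq_of_le (normSq_congr_ae ?_) hle⟩
    filter_upwards [he] with x hx
    rw [hx]

lemma mse_rho_smul (v : ℝ → Fin T → ℂ) :
    mse g b (fun x => rho g x • v x) f
      = normSq (wdens g f) (fun x => bSeries b x - v x) := by
  rw [mse, ← normSq_rho_smul]
  simp_rw [smul_sub]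
  rfl

lemma mse_congr_ae {h h' : ℝ → Fin T → ℂ} (he : h =ᵐ[circ] h') : mse g b h f = mse g b h' f :=
  normSq_congr_ae (he.mono fun x hx => by simp only [hx])

lemma mse_eq (hg : g.Positive) (h : ℝ → Fin T → ℂ) :
    mse g b h f
      = normSq (wdens g f) (fun x => bSeries b x - (rho g x)⁻¹ • h x) := by
  rw [← mse_rho_smul, mse_congr_ae (rho_smul_inv hg h)]

lemma form_rho_smul (x : ℝ) (u v : Fin T → ℂ) :
    form (f x) (rho g x • u) (rho g x • v) = form (wdens g f x) u v := by
  have h : rho g x * star (rho g x) = (weight g x : ℂ) := by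
    rw [← norm_rho_sq]; push_cast; exact Complex.mul_conj' _
  rw [form_smul_left, form_smul_right, ← mul_assoc, h, wdens, form_smul_mat]

lemma isSpectralCharacteristic_of_isProj (hg : g.Positive) {v : ℝ → Fin T → ℂ}
    (hv : IsProj (wdens g f) (bSeries b) v) :
    IsSpectralCharacteristic g b f (fun x => rho g x • v x) := by
  refine ⟨rho_smul_mem_L2Past hv.1, fun u hu => ?_⟩
  rw [← hv.2 _ (inv_rho_smul_mem_negPast hg hu)]
  refine integral_congr_ae ?_
  filter_upwards [rho_smul_inv hg u] with x hx
  rw [← form_rho_smul, hx, smul_sub]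
  rfl

lemma isProj_of_isSpectralCharacteristic (hg : g.Positive) {h : ℝ → Fin T → ℂ}
    (hh : IsSpectralCharacteristic g b f h) :
    IsProj (wdens g f) (bSeries b) (fun x => (rho g x)⁻¹ • h x) := by
  refine ⟨inv_rho_smul_mem_negPast hg hh.1, fun u hu => ?_⟩
  rw [← hh.2 _ (rho_smul_mem_L2Past hu)]
  refine integral_congr_ae ?_
  filter_upwards [rho_smul_inv hg h] with x hx
  rw [← form_rho_smul, smul_sub, hx]
  rfl

lemma isSpectralCharacteristic_congr_ae {h h' : ℝ → Fin T → ℂ}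
    (hh : IsSpectralCharacteristic g b f h) (he : h =ᵐ[circ] h') :
    IsSpectralCharacteristic g b f h' := by
  refine ⟨mem_L2Past_congr_ae hh.1 he, fun u hu => ?_⟩
  rw [← hh.2 u hu]
  refine integral_congr_ae ?_
  filter_upwards [he] with x hx
  rw [hx]

/-- The minimality condition makes the weighted density coercive. -/
lemma Minimality.exists_isCoercive (hg : g.Positive) (hm : Minimality g f) :
    IsCoercive (wdens g f) (fun x => (((weight g x : ℂ)⁻¹) • (f x)⁻¹).trace.re) := by
  have hre : ∀ x, (((weight g x : ℂ)⁻¹) • (f x)⁻¹).trace.re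
      = (weight g x)⁻¹ * (f x)⁻¹.trace.re := fun x => by
    rw [Matrix.trace_smul, smul_eq_mul, ← Complex.ofReal_inv, Complex.re_ofReal_mul]
  refine ⟨hm.2.re, ?_, ?_⟩
  · filter_upwards [hm.1] with x hx
    rw [hre]
    exact mul_nonneg (inv_nonneg.2 (weight_nonneg g x))
      (Complex.le_def.1 hx.posSemidef.inv.trace_nonneg).1
  · filter_upwards [hm.1, ae_weight_pos g hg] with x hx hw v
    have h1 : ‖v‖ ^ 2 ≤ ∑ p, ‖v p‖ ^ 2 := by
      have h2 : ‖v‖ ≤ √(∑ p, ‖v p‖ ^ 2) := by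
        refine (pi_norm_le_iff_of_nonneg (Real.sqrt_nonneg _)).2 fun p => ?_
        refine Real.le_sqrt_of_sq_le ?_
        exact Finset.single_le_sum (f := fun p => ‖v p‖ ^ 2) (fun _ _ => by positivity)
          (Finset.mem_univ p)
      calc ‖v‖ ^ 2 ≤ (√(∑ p, ‖v p‖ ^ 2)) ^ 2 := by gcongr
        _ = _ := Real.sq_sqrt (Finset.sum_nonneg fun _ _ => by positivity)
    refine h1.trans ((sum_norm_sq_le hx v).trans_eq ?_)
    rw [hre, quad_wdens]
    field_simp

end Weighted

/-! ### The target and its Fourier coefficients -/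

section Target

variable {T : ℕ} {b : ℕ → Fin T → ℂ}

lemma summable_cis_smul (hb : Summable fun k => ‖b k‖) (x : ℝ) :
    Summable fun k : ℕ => cis k x • b k :=
  Summable.of_norm (by simpa [norm_smul, norm_cis] using hb)

lemma norm_bSeries_le (hb : Summable fun k => ‖b k‖) (x : ℝ) :
    ‖bSeries b x‖ ≤ ∑' k, ‖b k‖ := by
  refine (norm_tsum_le_tsum_norm (by simpa [norm_smul, norm_cis] using hb)).trans_eq ?_
  simp [norm_smul, norm_cis]

lemma continuous_bSeries (hb : Summable fun k => ‖b k‖) : Continuous (bSeries b) :=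
  continuous_tsum (fun k => (continuous_cis k).smul continuous_const) hb
    fun k x => by simp [norm_smul, norm_cis]

lemma aesm_bSeries (hb : Summable fun k => ‖b k‖) (p : Fin T) :
    AEStronglyMeasurable (fun x => bSeries b x p) circ :=
  ((continuous_apply p).comp (continuous_bSeries hb)).aestronglyMeasurable

lemma memL2_bSeries (hb : Summable fun k => ‖b k‖) {F : ℝ → Matrix (Fin T) (Fin T) ℂ}
    (hF : IsSpectralDensity F) : MemL2 F (bSeries b) :=
  memL2_of_bounded hF (aesm_bSeries hb) (Eventually.of_forall (norm_bSeries_le hb))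

lemma summable_norm_apply (hb : Summable fun k => ‖b k‖) (p : Fin T) :
    Summable fun k => ‖b k p‖ :=
  Summable.of_nonneg_of_le (fun _ => norm_nonneg _) (fun k => norm_le_pi_norm (b k) p) hb

/-- Termwise integration of the target against an integrable function. -/
lemma hasSum_integral_mul_bSeries (hb : Summable fun k => ‖b k‖) {φ : ℝ → ℂ}
    (hφ : Integrable φ circ) (p : Fin T) :
    HasSum (fun k : ℕ => (∫ x, cis k x * φ x ∂circ) * b k p)
      (∫ x, φ x * bSeries b x p ∂circ) := by
  have h := hasSum_integral_of_summable_integral_norm (μ := circ)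
    (F := fun (k : ℕ) x => cis k x * φ x * b k p)
    (fun k => (integrable_cis_mul hφ k).mul_const _) (by
      have : ∀ k : ℕ, ∫ x, ‖cis k x * φ x * b k p‖ ∂circ = (∫ x, ‖φ x‖ ∂circ) * ‖b k p‖ := by
        intro k
        simp_rw [norm_mul, norm_cis, one_mul]
        rw [integral_mul_const]
      simp_rw [this]
      exact (summable_norm_apply hb p).mul_left _)
  simp_rw [integral_mul_const] at h
  have h1 : ∫ x, φ x * bSeries b x p ∂circ = ∫ x, ∑' k : ℕ, cis k x * φ x * b k p ∂circ := by
    refine integral_congr_ae (Eventually.of_forall fun x => ?_)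
    have h2 : bSeries b x p = ∑' k : ℕ, (cis k x • b k) p := tsum_apply (summable_cis_smul hb x)
    simp only [h2, Pi.smul_apply, smul_eq_mul, ← tsum_mul_left]
    refine tsum_congr fun k => ?_
    ring
  rwa [h1]

lemma integral_cis_mul_bSeries (hb : Summable fun k => ‖b k‖) (j : ℕ) (p : Fin T) :
    ∫ x, cis (-(j : ℤ)) x * bSeries b x p ∂circ = b j p := by
  have h := hasSum_integral_mul_bSeries hb (integrable_cis (-(j : ℤ))) p
  simp_rw [← cis_add, integral_cis] at h
  have h2 := hasSum_single (f := fun k : ℕ =>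
    (if (k : ℤ) + -(j : ℤ) = 0 then (1 : ℂ) else 0) * b k p) j (fun k hk => by
      rw [if_neg (by omega), zero_mul])
  rw [h.unique h2]
  simp

lemma integral_cis_mul_negPoly {p : ℝ → Fin T → ℂ} (hp : IsNegPoly p) (j : ℕ) (q : Fin T) :
    ∫ x, cis (-(j : ℤ)) x * p x q ∂circ = 0 := by
  obtain ⟨n, s, rfl⟩ := hp
  simp only [negPoly, Finset.sum_apply, Pi.smul_apply, smul_eq_mul, Finset.mul_sum]
  simp_rw [← mul_assoc, ← cis_add]
  rw [integral_finsetSum _ fun k _ => (integrable_cis _).mul_const _]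
  refine Finset.sum_eq_zero fun k _ => ?_
  rw [integral_mul_const, integral_cis, if_neg (by omega), zero_mul]

lemma integrable_apply {u : ℝ → Fin T → ℂ} (hu : Integrable u circ) (p : Fin T) :
    Integrable (fun x => u x p) circ :=
  hu.mono ((continuous_apply p).comp_aestronglyMeasurable hu.1)
    (Eventually.of_forall fun x => norm_le_pi_norm (u x) p)

/-- By coercivity, the elements of the past have no Fourier coefficients with nonnegative index. -/
lemma NegPast.integral_cis_mul {F : ℝ → Matrix (Fin T) (Fin T) ℂ} {τ : ℝ → ℝ}
    (hF : IsSpectralDensity F) (hτ : IsCoercive F τ) {v : ℝ → Fin T → ℂ} (hv : v ∈ NegPast F)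
    (j : ℕ) (q : Fin T) : ∫ x, cis (-(j : ℤ)) x * v x q ∂circ = 0 := by
  set I := ∫ x, cis (-(j : ℤ)) x * v x q ∂circ with hI
  set Iτ := ∫ x, τ x ∂circ with hIτ
  have hIτ0 : 0 ≤ Iτ := integral_nonneg_of_ae hτ.nonneg
  have key : ∀ t : ℝ, 0 < t → ‖I‖ ≤ t * (Iτ + 1) / 2 := by
    intro t ht
    obtain ⟨p, hp, hle⟩ := NegPast.exists_nsq_le hF hv (ε := t ^ 2) (by positivity)
    have hm := hv.1.sub hF (hp.memL2 hF)
    have h1 : I = ∫ x, cis (-(j : ℤ)) x * (v x q - p x q) ∂circ := by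
      simp_rw [mul_sub]
      rw [integral_sub (integrable_cis_mul (integrable_apply (hτ.integrable_apply hF hv.1) q) _)
        (integrable_cis_mul (integrable_apply (hτ.integrable_apply hF (hp.memL2 hF)) q) _),
        integral_cis_mul_negPoly hp, sub_zero]
    have h3 : nsq F (fun x => v x - p x) / t ≤ t := by
      rw [div_le_iff₀ ht]; linarith [sq t]
    have h2 : ‖I‖ₑ ≤ ENNReal.ofReal ((t * Iτ + nsq F (fun x => v x - p x) / t) / 2) := by
      rw [h1]
      refine (enorm_integral_le_lintegral_enorm _).trans
        (le_trans (lintegral_mono fun x => ?_) (hτ.lintegral_le hF hm ht))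
      rw [← ofReal_norm, ← ofReal_norm, norm_mul, norm_cis, one_mul]
      exact ENNReal.ofReal_le_ofReal (norm_le_pi_norm (v x - p x) q)
    have hn := nsq_nonneg hF (fun x => v x - p x)
    rw [← ofReal_norm, ENNReal.ofReal_le_ofReal_iff (by positivity)] at h2
    linarith
  rw [← norm_le_zero_iff]
  refine le_of_forall_pos_le_add fun ε hε => ?_
  have := key (2 * ε / (Iτ + 1)) (by positivity)
  rw [div_mul_cancel₀ _ (by positivity)] at this
  linarith

end Target

/-! ### The prediction error and the operator `F` -/

section InverseImage

variable {T r : ℕ} {g : GMIndex r} {f F : ℝ → Matrix (Fin T) (Fin T) ℂ} {b c : ℕ → Fin T → ℂ}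

lemma form_eq_dotProduct {A : Matrix (Fin T) (Fin T) ℂ} (u v : Fin T → ℂ) :
    form A u v = (Aᵀ *ᵥ u) ⬝ᵥ star v := by
  rw [form, Matrix.dotProduct_mulVec, Matrix.mulVec_transpose]

lemma memL2_single (hF : IsSpectralDensity F) (k : ℤ) (p : Fin T) :
    MemL2 F (fun x => cis k x • Pi.single p (1 : ℂ)) := by
  refine memL2_of_bounded hF (K := ‖(Pi.single p (1 : ℂ) : Fin T → ℂ)‖) (fun q => ?_)
    (Eventually.of_forall fun x => ?_)
  · exact (aesm_cis k).mul aestronglyMeasurable_const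
  · rw [norm_smul, norm_cis, one_mul]

lemma symbolF_mulVec {x : ℝ} (hx : (f x).PosDef) (hw : 0 < weight g x) (u : Fin T → ℂ) :
    symbolF g f x *ᵥ ((wdens g f x)ᵀ *ᵥ u) = u := by
  have hdet : IsUnit (f x).det := (Matrix.isUnit_iff_isUnit_det _).1 hx.isUnit
  have hw' : (weight g x : ℂ) ≠ 0 := by exact_mod_cast hw.ne'
  rw [Matrix.mulVec_mulVec, symbolF, wdens, Matrix.transpose_smul, Matrix.smul_mul,
    Matrix.mul_smul, smul_smul, inv_mul_cancel₀ hw', one_smul, ← Matrix.transpose_mul,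
    Matrix.mul_nonsing_inv _ hdet, Matrix.transpose_one, Matrix.one_mulVec]

lemma mulVec_symbolF {x : ℝ} (hx : (f x).PosDef) (hw : 0 < weight g x) (u : Fin T → ℂ) :
    (wdens g f x)ᵀ *ᵥ (symbolF g f x *ᵥ u) = u := by
  have hdet : IsUnit (f x).det := (Matrix.isUnit_iff_isUnit_det _).1 hx.isUnit
  have hw' : (weight g x : ℂ) ≠ 0 := by exact_mod_cast hw.ne'
  rw [Matrix.mulVec_mulVec, symbolF, wdens, Matrix.transpose_smul, Matrix.smul_mul,
    Matrix.mul_smul, smul_smul, mul_inv_cancel₀ hw', one_smul, ← Matrix.transpose_mul,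
    Matrix.nonsing_inv_mul _ hdet, Matrix.transpose_one, Matrix.one_mulVec]

/-- The projection error `u` solves the Toeplitz system: `C = Fᵀ u` is analytic because `u` is
orthogonal to the past, and `u` has the nonnegative Fourier coefficients of the target. -/
lemma exists_isInverseImage (hg : g.Positive) (hb : Summable fun k => ‖b k‖)
    (hf : IsSpectralDensity f) (hm : Minimality g f) {v : ℝ → Fin T → ℂ}
    (hv : IsProj (wdens g f) (bSeries b) v) :
    ∃ c, IsInverseImage g f b c
      (fun x => (wdens g f x)ᵀ *ᵥ (bSeries b x - v x)) := by
  have hF := isSpectralDensity_wdens hg hf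
  have hτ := hm.exists_isCoercive hg
  have hB := memL2_bSeries hb hF
  have hu := hB.sub hF hv.1.1
  have hae : ∀ᵐ x ∂circ, symbolF g f x *ᵥ ((wdens g f x)ᵀ *ᵥ (bSeries b x - v x))
      = bSeries b x - v x := by
    filter_upwards [hm.1, ae_weight_pos g hg] with x h1 h2 using symbolF_mulVec h1 h2 _
  have hint : Integrable (fun x => bSeries b x - v x) circ := hτ.integrable_apply hF hu
  have hintp : ∀ p, Integrable (fun x => bSeries b x p - v x p) circ := integrable_apply hint
  refine ⟨fun k p => ∫ x, cis (-(k : ℤ)) x *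
    ((wdens g f x)ᵀ *ᵥ (bSeries b x - v x)) p ∂circ, ⟨fun p => ⟨?_, fun k => rfl, fun k => ?_⟩,
    fun p => ?_, fun j p => ?_⟩⟩
  · simp_rw [← form_single]
    simpa [cis_zero] using integrable_form hF hu (memL2_single hF 0 p)
  · rw [← hv.2 _ ((isNegPoly_cis k (Pi.single p 1)).mem_negPast hF)]
    simp_rw [form_smul_right, star_cis, form_single, neg_neg]
  · refine (hintp p).congr ?_
    filter_upwards [hae] with x hx
    rw [hx]; rfl
  · have h1 : ∫ x, cis (-(j : ℤ)) x *
        (symbolF g f x *ᵥ ((wdens g f x)ᵀ *ᵥ (bSeries b x - v x))) p ∂circ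
        = ∫ x, (cis (-(j : ℤ)) x * bSeries b x p - cis (-(j : ℤ)) x * v x p) ∂circ := by
      refine integral_congr_ae ?_
      filter_upwards [hae] with x hx
      rw [hx, ← mul_sub]; rfl
    rw [h1, integral_sub (integrable_cis_mul (integrable_apply (hτ.integrable_apply hF hB) p) _)
      (integrable_cis_mul (integrable_apply (hτ.integrable_apply hF hv.1.1) p) _),
      integral_cis_mul_bSeries hb, NegPast.integral_cis_mul hF hτ hv.1, sub_zero]

/-- Conversely, if `Fᵀ u` is analytic and `B - u` belongs to the past, then `u` is the projection
error. -/
lemma isProj_of_analytic (hF : IsSpectralDensity F) {B C u : ℝ → Fin T → ℂ}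
    (hC : IsAnalyticSeries C c) (hu : MemL2 F u)
    (hCu : ∀ᵐ x ∂circ, (F x)ᵀ *ᵥ u x = C x) (hmem : (fun x => B x - u x) ∈ NegPast F) :
    IsProj F B (fun x => B x - u x) := by
  refine ⟨hmem, fun w hw => ?_⟩
  simp_rw [sub_sub_cancel]
  refine integral_form_eq_zero_of_negPoly hF hu ?_ hw
  rintro _ ⟨n, s, rfl⟩
  have h1 : ∫ x, form (F x) (u x) (negPoly n s x) ∂circ
      = ∫ x, ∑ k ∈ Finset.range n, ∑ q, cis ((k : ℤ) + 1) x * C x q * star (s k q) ∂circ := by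
    refine integral_congr_ae ?_
    filter_upwards [hCu] with x hx
    rw [form_eq_dotProduct, hx, negPoly, star_sum, dotProduct_sum]
    refine Finset.sum_congr rfl fun k _ => Finset.sum_congr rfl fun q _ => ?_
    simp only [Pi.star_apply, Pi.smul_apply, smul_eq_mul, star_mul', star_cis, neg_neg]
    ring
  rw [h1, integral_finsetSum _ fun k _ => integrable_finsetSum _ fun q _ =>
    (integrable_cis_mul (hC q).1 _).mul_const _]
  refine Finset.sum_eq_zero fun k _ => ?_
  rw [integral_finsetSum _ fun q _ => (integrable_cis_mul (hC q).1 _).mul_const _]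
  refine Finset.sum_eq_zero fun q _ => ?_
  rw [integral_mul_const, (hC q).2.2 k, zero_mul]

/-- The projection error equals `⟨b, c⟩`. -/
lemma nsq_eq_tsum (hF : IsSpectralDensity F) (hb : Summable fun k => ‖b k‖)
    {C u : ℝ → Fin T → ℂ} (hC : IsAnalyticSeries C c) (hu : MemL2 F u)
    (hCu : ∀ᵐ x ∂circ, (F x)ᵀ *ᵥ u x = C x)
    (hmem : (fun x => bSeries b x - u x) ∈ NegPast F) :
    nsq F u = (∑' k, b k ⬝ᵥ star (c k)).re := by
  have hB := memL2_bSeries hb hF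
  have horth := (isProj_of_analytic hF hC hu hCu hmem).2 _ hmem
  simp_rw [sub_sub_cancel, form_sub_right] at horth
  rw [integral_sub (integrable_form hF hu hB) (integrable_form hF hu hu), sub_eq_zero] at horth
  have h1 : (nsq F u : ℂ) = ∫ x, form (F x) (u x) (u x) ∂circ := by
    rw [nsq, ← integral_complex_ofReal]
    refine integral_congr_ae ?_
    filter_upwards [hF.2] with x hx using (form_self hx.1 _).symm
  have hstar : ∀ q, Integrable (fun x => star (C x q)) circ := fun q =>
    ⟨continuous_star.comp_aestronglyMeasurable (hC q).1.1, by
      have := (hC q).1.2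
      rw [hasFiniteIntegral_iff_norm] at this ⊢
      simpa using this⟩
  have h2 : ∫ x, form (F x) (u x) (bSeries b x) ∂circ
      = star (∑ q, ∫ x, star (C x q) * bSeries b x q ∂circ) := by
    have h3 : ∀ q, Integrable (fun x => star (C x q) * bSeries b x q) circ := fun q =>
      (hstar q).mul_bdd (c := ∑' k, ‖b k‖) (aesm_bSeries hb q)
        (Eventually.of_forall fun x => (norm_le_pi_norm _ q).trans (norm_bSeries_le hb x))
    rw [← integral_finsetSum _ fun q _ => h3 q]
    have h4 := integral_conj (μ := circ) (𝕜 := ℂ)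
      (f := fun x => ∑ q, star (C x q) * bSeries b x q)
    refine Eq.trans (integral_congr_ae ?_) h4
    filter_upwards [hCu] with x hx
    rw [form_eq_dotProduct, hx, map_sum]
    refine Finset.sum_congr rfl fun q _ => ?_
    rw [map_mul]
    congr 1
    exact (star_star _).symm
  have h5 : HasSum (fun k => b k ⬝ᵥ star (c k))
      (∑ q, ∫ x, star (C x q) * bSeries b x q ∂circ) := by
    have := hasSum_sum (s := Finset.univ) fun q _ => hasSum_integral_mul_bSeries hb (hstar q) q
    refine this.congr_fun ?_
    intro k
    refine Finset.sum_congr rfl fun q _ => ?_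
    have h6 : ∫ x, cis (k : ℤ) x * star (C x q) ∂circ = star (c k q) := by
      rw [← (hC q).2.1 k]
      refine Eq.trans (integral_congr_ae (Eventually.of_forall fun x => ?_))
        (integral_conj (μ := circ) (𝕜 := ℂ) (f := fun x => cis (-(k : ℤ)) x * C x q))
      change _ = star (cis (-(k : ℤ)) x * C x q)
      rw [star_mul', star_cis, neg_neg]
    rw [h6, mul_comm]; rfl
  have h6 := congrArg Complex.re (h1.trans (horth.symm.trans h2))
  rw [h5.tsum_eq, ← Complex.ofReal_re (nsq F u), h6]
  simp

/-- The formula for the spectral characteristic is the target minus `F⁻¹ᵀ C`. -/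
lemma charFormula_ae_eq (hg : g.Positive) (C : ℝ → Fin T → ℂ) :
    charFormula g b f C =ᵐ[circ]
      fun x => rho g x • (bSeries b x - symbolF g f x *ᵥ C x) := by
  filter_upwards [ae_chi_ne_zero g hg, ae_beta_ne_zero g] with x h1 h2
  have h3 : star (beta g x) / star (chi g x) = rho g x * (weight g x : ℂ)⁻¹ := by
    have hr : rho g x ≠ 0 := div_ne_zero h1 h2
    have h : rho g x * star (rho g x) = (weight g x : ℂ) := by
      rw [← norm_rho_sq]; push_cast; exact Complex.mul_conj' _
    have hs : star (rho g x) ≠ 0 := star_ne_zero.2 hr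
    rw [← h, mul_inv, ← mul_assoc, mul_inv_cancel₀ hr, one_mul, rho, star_div₀, inv_div]
  rw [charFormula, h3, smul_sub, symbolF, Matrix.smul_mulVec, smul_smul, Matrix.mulVec_transpose]
  rfl

end InverseImage

/-! ### The normal cone of an `L₁` ball -/

section NormalCone

variable {α V : Type*} [MeasurableSpace α] {μ : Measure α}
  [NormedAddCommGroup V] [InnerProductSpace ℝ V]

/-- The direction `z / ‖z‖` of a vector, zero for `z = 0`. -/
noncomputable def dir (z : V) : V := ‖z‖⁻¹ • z

lemma norm_dir_le (z : V) : ‖dir z‖ ≤ 1 := by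
  rw [dir, norm_smul, norm_inv, norm_norm]
  exact inv_mul_le_one

lemma norm_dir {z : V} (hz : z ≠ 0) : ‖dir z‖ = 1 := by
  rw [dir, norm_smul, norm_inv, norm_norm, inv_mul_cancel₀ (norm_ne_zero_iff.2 hz)]

lemma inner_dir_self (z : V) : inner ℝ z (dir z) = ‖z‖ := by
  rw [dir, inner_smul_right, real_inner_self_eq_norm_sq]
  by_cases h : ‖z‖ = 0
  · simp [h]
  · field_simp

lemma aesm_dir {u : α → V} (hu : AEStronglyMeasurable u μ) :
    AEStronglyMeasurable (fun x => dir (u x)) μ :=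
  hu.norm.aemeasurable.inv.aestronglyMeasurable.smul hu

lemma norm_sub_smul_dir {z : V} {c : ℝ} (hz : z ≠ 0) (hcz : c ≤ ‖z‖) :
    ‖z - c • dir z‖ = ‖z‖ - c := by
  have hn : 0 < ‖z‖ := norm_pos_iff.2 hz
  have h1 : z - c • dir z = ((‖z‖ - c) / ‖z‖) • z := by
    rw [dir, smul_smul, sub_div, div_self hn.ne', sub_smul, one_smul, div_eq_mul_inv]
  rw [h1, norm_smul, Real.norm_of_nonneg (div_nonneg (by linarith) hn.le), div_mul_cancel₀ _ hn.ne']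

/-- A set of positive measure meets one of the sets of an exhausting sequence in positive
measure. -/
lemma exists_measure_inter_pos {E : Set α} {S : ℕ → Set α}
    (hcov : ∀ᵐ x ∂μ, x ∈ E → ∃ n, x ∈ S n) (hE : μ E ≠ 0) : ∃ n, μ (E ∩ S n) ≠ 0 := by
  by_contra! hc
  refine hE (measure_mono_null_ae ?_ (measure_iUnion_null hc))
  filter_upwards [hcov] with x hx hxE
  obtain ⟨n, hn⟩ := hx hxE
  exact Set.mem_iUnion.2 ⟨n, hxE, hn⟩

variable {u q : α → V} {δ : ℝ} {S : ℕ → Set α}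

lemma integrable_inner_of_support (hq : AEStronglyMeasurable q μ)
    {E : Set α} (hE : NullMeasurableSet E μ) (hint : IntegrableOn q E μ) {ψ : α → V}
    (hψ : AEStronglyMeasurable ψ μ) {κ : ℝ} (hκ : ∀ x, ‖ψ x‖ ≤ κ) (hsupp : ∀ x ∉ E, ψ x = 0) :
    Integrable (fun x => inner ℝ (q x) (ψ x)) μ := by
  refine ((hint.integrable_indicator₀ hE).norm.const_mul κ).mono' (hq.inner hψ)
    (Eventually.of_forall fun x => ?_)
  by_cases hx : x ∈ E
  · rw [Set.indicator_of_mem hx, mul_comm]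
    exact (norm_inner_le_norm _ _).trans (by gcongr; exact hκ x)
  · rw [hsupp x hx, Set.indicator_of_notMem hx]; simp

variable [IsFiniteMeasure μ]

/-- If mass of `u` can be moved from a set where the pairing of `q` with the direction of `u` is
at most `r` to a set where `‖q‖` is at least `r' > r`, the linear functional `q` increases. -/
lemma transfer_contradiction (hu : Integrable u μ) (hq : AEStronglyMeasurable q μ)
    (hle : ∫ x, ‖u x‖ ∂μ ≤ δ)
    {E A B : Set α} (hE : NullMeasurableSet E μ) (hint : IntegrableOn q E μ)
    (hA : NullMeasurableSet A μ) (hB : NullMeasurableSet B μ) (hAE : A ⊆ E) (hBE : B ⊆ E)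
    (hA0 : μ A ≠ 0) (hB0 : μ B ≠ 0) {κ η r r' : ℝ} (hκ : 0 < κ) (hη : 0 < η) (hr : r < r')
    (hAu : ∀ x ∈ A, η ≤ ‖u x‖ ∧ inner ℝ (q x) (dir (u x)) ≤ r)
    (hBq : ∀ x ∈ B, r' ≤ ‖q x‖)
    (H : ∀ ψ : α → V, AEStronglyMeasurable ψ μ → (∀ x, ‖ψ x‖ ≤ κ) → (∀ x ∉ E, ψ x = 0) →
      ∫ x, ‖u x + ψ x‖ ∂μ ≤ δ → ∫ x, inner ℝ (q x) (ψ x) ∂μ ≤ 0) : False := by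
  set a := μ.real A with ha
  set b := μ.real B with hb
  have ha0 : 0 < a := ENNReal.toReal_pos hA0 (measure_ne_top _ _)
  have hb0 : 0 < b := ENNReal.toReal_pos hB0 (measure_ne_top _ _)
  set c := min (a * η) (κ / (a⁻¹ + b⁻¹)) with hc
  have hc0 : 0 < c := by positivity
  have hca : c / a ≤ η := by
    rw [div_le_iff₀ ha0, mul_comm]; exact min_le_left _ _
  have hcκ : c / a + c / b ≤ κ := by
    have h1 : c * (a⁻¹ + b⁻¹) ≤ κ := by
      rw [← le_div_iff₀ (by positivity)]; exact min_le_right _ _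
    rw [div_eq_mul_inv, div_eq_mul_inv, ← mul_add]; exact h1
  set ψ₁ : α → V := A.indicator fun x => (c / a) • dir (u x) with hψ₁
  set ψ₂ : α → V := B.indicator fun x => (c / b) • dir (q x) with hψ₂
  have hm₁ : AEStronglyMeasurable ψ₁ μ := ((aesm_dir hu.1).const_smul _).indicator₀ hA
  have hm₂ : AEStronglyMeasurable ψ₂ μ := ((aesm_dir hq).const_smul _).indicator₀ hB
  have hn₁ : ∀ x, ‖ψ₁ x‖ ≤ c / a := fun x => by
    refine (norm_indicator_le_norm_self _ _).trans ?_
    rw [norm_smul, Real.norm_of_nonneg (by positivity)]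
    exact mul_le_of_le_one_right (by positivity) (norm_dir_le _)
  have hn₂' : ∀ x, ‖ψ₂ x‖ ≤ B.indicator (fun _ => c / b) x := fun x => by
    rw [hψ₂, norm_indicator_eq_indicator_norm]
    refine Set.indicator_le_indicator ?_
    rw [norm_smul, Real.norm_of_nonneg (by positivity)]
    exact mul_le_of_le_one_right (by positivity) (norm_dir_le _)
  have hn₂ : ∀ x, ‖ψ₂ x‖ ≤ c / b := fun x => (hn₂' x).trans
    (Set.indicator_le_self' (fun _ _ => by positivity) x)
  have hψE : ∀ x ∉ E, ψ₂ x - ψ₁ x = 0 := fun x hx => by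
    rw [hψ₁, hψ₂, Set.indicator_of_notMem (fun h => hx (hBE h)),
      Set.indicator_of_notMem (fun h => hx (hAE h)), sub_zero]
  have hψκ : ∀ x, ‖ψ₂ x - ψ₁ x‖ ≤ κ := fun x =>
    (norm_sub_le _ _).trans (by linarith [hn₁ x, hn₂ x])
  have hIA : ∀ y : ℝ, ∫ x, A.indicator (fun _ => y) x ∂μ = a * y := fun y => by
    rw [integral_indicator₀ hA, setIntegral_const, smul_eq_mul]
  have hIB : ∀ y : ℝ, ∫ x, B.indicator (fun _ => y) x ∂μ = b * y := fun y => by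
    rw [integral_indicator₀ hB, setIntegral_const, smul_eq_mul]
  have hiA : ∀ y : ℝ, Integrable (A.indicator fun _ => y) μ := fun y =>
    (integrable_const y).indicator₀ hA
  have hiB : ∀ y : ℝ, Integrable (B.indicator fun _ => y) μ := fun y =>
    (integrable_const y).indicator₀ hB
  -- The total variation does not increase: mass `c` is removed on `A`, at most `c` added on `B`.
  have hfeas : ∫ x, ‖u x + (ψ₂ x - ψ₁ x)‖ ∂μ ≤ δ := by
    have h1 : ∫ x, ‖u x + (ψ₂ x - ψ₁ x)‖ ∂μ
        ≤ ∫ x, (‖u x‖ - A.indicator (fun _ => c / a) x + B.indicator (fun _ => c / b) x) ∂μ := by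
      refine integral_mono_of_nonneg (Eventually.of_forall fun _ => norm_nonneg _)
        ((hu.norm.sub (hiA _)).add (hiB _)) (Eventually.of_forall fun x => ?_)
      have h2 : ‖u x - ψ₁ x‖ = ‖u x‖ - A.indicator (fun _ => c / a) x := by
        by_cases hx : x ∈ A
        · have h3 := (hAu x hx).1
          rw [hψ₁, Set.indicator_of_mem hx, Set.indicator_of_mem hx]
          exact norm_sub_smul_dir (norm_pos_iff.1 (by linarith)) (hca.trans h3)
        · rw [hψ₁, Set.indicator_of_notMem hx, Set.indicator_of_notMem hx, sub_zero, sub_zero]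
      have h4 : u x + (ψ₂ x - ψ₁ x) = (u x - ψ₁ x) + ψ₂ x := by abel
      simp only
      rw [h4, ← h2]
      exact (norm_add_le _ _).trans (by gcongr; exact hn₂' x)
    refine h1.trans ?_
    have h5 : Integrable (fun x => ‖u x‖ - A.indicator (fun _ => c / a) x) μ :=
      hu.norm.sub (hiA _)
    rw [integral_add h5 (hiB _), integral_sub hu.norm (hiA _), hIA, hIB,
      mul_div_cancel₀ _ ha0.ne', mul_div_cancel₀ _ hb0.ne']
    linarith
  have hψm := hm₂.sub hm₁
  have hneg := H _ hψm hψκ hψE hfeas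
  have hpos : c * (r' - r) ≤ ∫ x, inner ℝ (q x) (ψ₂ x - ψ₁ x) ∂μ := by
    have h1 : c * (r' - r) = ∫ x, (B.indicator (fun _ => c / b * r') x
        - A.indicator (fun _ => c / a * r) x) ∂μ := by
      rw [integral_sub (hiB _) (hiA _), hIA, hIB]
      field_simp
    rw [h1]
    refine integral_mono ((hiB _).sub (hiA _))
      (integrable_inner_of_support hq hE hint hψm hψκ hψE) fun x => ?_
    simp only
    rw [inner_sub_right]
    refine sub_le_sub ?_ ?_
    · by_cases hx : x ∈ B
      · rw [hψ₂, Set.indicator_of_mem hx, Set.indicator_of_mem hx, inner_smul_right,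
          inner_dir_self]
        gcongr
        exact hBq x hx
      · rw [hψ₂, Set.indicator_of_notMem hx, Set.indicator_of_notMem hx, inner_zero_right]
    · by_cases hx : x ∈ A
      · rw [hψ₁, Set.indicator_of_mem hx, Set.indicator_of_mem hx, inner_smul_right]
        gcongr
        exact (hAu x hx).2
      · rw [hψ₁, Set.indicator_of_notMem hx, Set.indicator_of_notMem hx, inner_zero_right]
  have : 0 < c * (r' - r) := mul_pos hc0 (by linarith)
  exact absurd (hpos.trans hneg) (not_le.2 this)

/-- Normal vectors to an `L₁` ball. If `u` maximizes the functional `∫ ⟪q, ·⟫` over the ball of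
radius `δ`, at least among small bounded perturbations with support in the sets of an exhausting
sequence, then `q = β γ` with a constant `β ≥ 0` and a unimodular extension `γ` of the direction
of `u`, and `u` lies on the sphere unless `β = 0`. -/
theorem exists_multiplier_of_maximal (hu : Integrable u μ) (hq : AEStronglyMeasurable q μ)
    (hδ : 0 < δ) (hle : ∫ x, ‖u x‖ ∂μ ≤ δ) (hS : ∀ n, NullMeasurableSet (S n) μ)
    (hmono : Monotone S) (hcov : ∀ᵐ x ∂μ, ∃ n, x ∈ S n) (hint : ∀ n, IntegrableOn q (S n) μ)
    (H : ∀ n, ∃ κ : ℝ, 0 < κ ∧ ∀ ψ : α → V, AEStronglyMeasurable ψ μ → (∀ x, ‖ψ x‖ ≤ κ) →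
      (∀ x ∉ S n, ψ x = 0) → ∫ x, ‖u x + ψ x‖ ∂μ ≤ δ → ∫ x, inner ℝ (q x) (ψ x) ∂μ ≤ 0) :
    ∃ (β : ℝ) (γ : α → V), 0 ≤ β ∧
      (∀ᵐ x ∂μ, ‖γ x‖ ≤ 1 ∧ (u x ≠ 0 → γ x = dir (u x)) ∧ q x = β • γ x) ∧
      (β ≠ 0 → ∫ x, ‖u x‖ ∂μ = δ) := by
  rcases hle.lt_or_eq with hlt | heq
  · -- Interior point: a small multiple of the direction of `q` is feasible, so `q` vanishes.
    have hz : ∀ n, ∀ᵐ x ∂μ, x ∈ S n → q x = 0 := by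
      intro n
      obtain ⟨κ, hκ, hH⟩ := H n
      set m := μ.real Set.univ with hm
      have hm0 : 0 ≤ m := measureReal_nonneg
      set c := min κ ((δ - ∫ x, ‖u x‖ ∂μ) / (m + 1)) with hc
      have hc0 : 0 < c := lt_min hκ (div_pos (by linarith) (by linarith))
      set ψ : α → V := (S n).indicator fun x => c • dir (q x) with hψ
      have hψm : AEStronglyMeasurable ψ μ := ((aesm_dir hq).const_smul _).indicator₀ (hS n)
      have hn : ∀ x, ‖ψ x‖ ≤ c := fun x => by
        refine (norm_indicator_le_norm_self _ _).trans ?_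
        rw [norm_smul, Real.norm_of_nonneg hc0.le]
        exact mul_le_of_le_one_right hc0.le (norm_dir_le _)
      have hfeas : ∫ x, ‖u x + ψ x‖ ∂μ ≤ δ := by
        have h1 : ∫ x, ‖u x + ψ x‖ ∂μ ≤ ∫ x, (‖u x‖ + c) ∂μ :=
          integral_mono_of_nonneg (Eventually.of_forall fun _ => norm_nonneg _)
            (hu.norm.add (integrable_const c))
            (Eventually.of_forall fun x => (norm_add_le _ _).trans (add_le_add_right (hn x) _))
        rw [integral_add hu.norm (integrable_const c), integral_const, smul_eq_mul] at h1
        have h2 : c * (m + 1) ≤ δ - ∫ x, ‖u x‖ ∂μ := by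
          rw [← le_div_iff₀ (by linarith)]; exact min_le_right _ _
        nlinarith
      have h := hH ψ hψm (fun x => (hn x).trans (min_le_left _ _))
        (fun x hx => Set.indicator_of_notMem hx _) hfeas
      have h3 : (fun x => inner ℝ (q x) (ψ x))
          = (S n).indicator fun x => c * ‖q x‖ := by
        funext x
        by_cases hx : x ∈ S n
        · rw [hψ, Set.indicator_of_mem hx, Set.indicator_of_mem hx, inner_smul_right,
            inner_dir_self]
        · rw [hψ, Set.indicator_of_notMem hx, Set.indicator_of_notMem hx, inner_zero_right]
      rw [h3, integral_indicator₀ (hS n), integral_const_mul] at h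
      have h4 : ∫ x in S n, ‖q x‖ ∂μ = 0 :=
        le_antisymm (by by_contra hcon; push Not at hcon; have := mul_pos hc0 hcon; linarith)
          (integral_nonneg fun _ => norm_nonneg _)
      rw [integral_eq_zero_iff_of_nonneg (fun _ => norm_nonneg _) (hint n).norm] at h4
      filter_upwards [(ae_restrict_iff'₀ (hS n)).1 h4] with x hx hxS using by simpa using hx hxS
    refine ⟨0, fun x => dir (u x), le_rfl, ?_, fun h => absurd rfl h⟩
    filter_upwards [ae_all_iff.2 hz, hcov] with x hx hxS
    obtain ⟨n, hn⟩ := hxS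
    exact ⟨norm_dir_le _, fun _ => rfl, by rw [hx n hn, zero_smul]⟩
  · set p : α → ℝ := fun x => inner ℝ (q x) (dir (u x)) with hp
    have hpm : AEStronglyMeasurable p μ := hq.inner (aesm_dir hu.1)
    have hA : ∀ r : ℚ, NullMeasurableSet {x | 0 < ‖u x‖ ∧ p x ≤ r} μ := fun r =>
      (nullMeasurableSet_lt aemeasurable_const hu.1.norm.aemeasurable).inter
        (nullMeasurableSet_le hpm.aemeasurable aemeasurable_const)
    have hB : ∀ r : ℚ, NullMeasurableSet {x | (r : ℝ) ≤ ‖q x‖} μ := fun r =>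
      nullMeasurableSet_le aemeasurable_const hq.norm.aemeasurable
    have hdich : ∀ r r' : ℚ, r < r' →
        μ {x | 0 < ‖u x‖ ∧ p x ≤ r} = 0 ∨ μ {x | (r' : ℝ) ≤ ‖q x‖} = 0 := by
      intro r r' hr
      by_contra! hc
      obtain ⟨hA0, hB0⟩ := hc
      obtain ⟨n, hn⟩ := exists_measure_inter_pos
        (S := fun n => S n ∩ {x | 1 / ((n : ℝ) + 1) ≤ ‖u x‖}) (by
          filter_upwards [hcov] with x hx hxA
          obtain ⟨n, hn⟩ := hx
          obtain ⟨m, hm⟩ := exists_nat_one_div_lt hxA.1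
          refine ⟨max n m, hmono (le_max_left _ _) hn, hm.le.trans' ?_⟩
          refine one_div_le_one_div_of_le (by positivity) ?_
          have : (m : ℝ) ≤ (max n m : ℕ) := by exact_mod_cast le_max_right n m
          linarith) hA0
      obtain ⟨m, hm⟩ := exists_measure_inter_pos (hcov.mono fun x hx _ => hx) hB0
      obtain ⟨κ, hκ, hH⟩ := H (max n m)
      refine transfer_contradiction (κ := κ) (η := 1 / ((n : ℝ) + 1)) (r := r) (r' := r') hu hq hle
        (hS _) (hint _) ((hA r).inter ((hS n).inter
          (nullMeasurableSet_le aemeasurable_const hu.1.norm.aemeasurable)))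
        ((hB r').inter (hS m))
        (fun x hx => hmono (le_max_left _ _) hx.2.1) (fun x hx => hmono (le_max_right _ _) hx.2)
        hn hm hκ (by positivity) (by exact_mod_cast hr)
        (fun x hx => ⟨hx.2.2, hx.1.2⟩) (fun x hx => hx.1) hH
    have hgood : ∀ᵐ x ∂μ, ∀ r r' : ℚ,
        (μ {x | 0 < ‖u x‖ ∧ p x ≤ r} = 0 → x ∉ {x | 0 < ‖u x‖ ∧ p x ≤ r}) ∧
        (μ {x | (r' : ℝ) ≤ ‖q x‖} = 0 → x ∉ {x | (r' : ℝ) ≤ ‖q x‖}) := by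
      refine ae_all_iff.2 fun r => ae_all_iff.2 fun r' => ?_
      by_cases h1 : μ {x | 0 < ‖u x‖ ∧ p x ≤ r} = 0 <;>
      by_cases h2 : μ {x | (r' : ℝ) ≤ ‖q x‖} = 0
      · filter_upwards [measure_eq_zero_iff_ae_notMem.1 h1, measure_eq_zero_iff_ae_notMem.1 h2]
          with x hx hx' using ⟨fun _ => hx, fun _ => hx'⟩
      · filter_upwards [measure_eq_zero_iff_ae_notMem.1 h1]
          with x hx using ⟨fun _ => hx, fun h => absurd h h2⟩
      · filter_upwards [measure_eq_zero_iff_ae_notMem.1 h2]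
          with x hx using ⟨fun h => absurd h h1, fun _ => hx⟩
      · exact Eventually.of_forall fun x => ⟨fun h => absurd h h1, fun h => absurd h h2⟩
    set G := {x | ∀ r r' : ℚ,
        (μ {x | 0 < ‖u x‖ ∧ p x ≤ r} = 0 → x ∉ {x | 0 < ‖u x‖ ∧ p x ≤ r}) ∧
        (μ {x | (r' : ℝ) ≤ ‖q x‖} = 0 → x ∉ {x | (r' : ℝ) ≤ ‖q x‖})} with hG
    have hcmp : ∀ x ∈ G, ∀ y ∈ G, u y ≠ 0 → ‖q x‖ ≤ p y := by
      intro x hx y hy huy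
      by_contra! hc
      obtain ⟨r, hr1, hr2⟩ := exists_rat_btwn hc
      obtain ⟨r', hr1', hr2'⟩ := exists_rat_btwn hr2
      rcases hdich r r' (by exact_mod_cast hr1') with h | h
      · exact (hy r r').1 h ⟨norm_pos_iff.2 huy, hr1.le⟩
      · exact (hx r r').2 h hr2'.le
    obtain ⟨y, hyG, hy⟩ : ∃ y ∈ G, u y ≠ 0 := by
      by_contra! hc
      have : ∫ x, ‖u x‖ ∂μ = 0 := by
        rw [integral_eq_zero_iff_of_nonneg (fun _ => norm_nonneg _) hu.norm]
        filter_upwards [hgood] with x hx using by simpa using hc x hx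
      linarith
    have hpq : ∀ x, p x ≤ ‖q x‖ := fun x => (real_inner_le_norm _ _).trans
      (mul_le_of_le_one_right (norm_nonneg _) (norm_dir_le _))
    have hβ0 : 0 ≤ p y := (norm_nonneg _).trans (hcmp y hyG y hyG hy)
    have hdirq : ∀ x ∈ G, u x ≠ 0 → q x = p y • dir (u x) := by
      intro x hx hux
      have h1 := hcmp x hx y hyG hy
      have h2 := hcmp y hyG x hx hux
      have h3 := hpq x
      have h4 := hpq y
      have h5 : ‖q x‖ = p y := by linarith
      have h6 : p x = p y := by linarith
      have h7 : ‖q x - p y • dir (u x)‖ ^ 2 = 0 := by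
        rw [norm_sub_sq_real, inner_smul_right, norm_smul, norm_dir hux, h5]
        change p y ^ 2 - 2 * (p y * p x) + _ = 0
        rw [h6, Real.norm_of_nonneg hβ0]; ring
      exact sub_eq_zero.1 (norm_eq_zero.1 (pow_eq_zero_iff two_ne_zero |>.1 h7))
    classical
    refine ⟨p y, fun x => if u x = 0 then (p y)⁻¹ • q x else dir (u x), hβ0, ?_, fun _ => heq⟩
    filter_upwards [hgood] with x hx
    by_cases hux : u x = 0
    · have h1 := hcmp x hx y hyG hy
      simp only [if_pos hux]
      refine ⟨?_, fun h => absurd hux h, ?_⟩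
      · rw [norm_smul, norm_inv, Real.norm_of_nonneg hβ0]
        exact inv_mul_le_one_of_le₀ h1 hβ0
      · by_cases h0 : p y = 0
        · rw [h0] at h1 ⊢
          rw [zero_smul]; exact norm_le_zero_iff.1 h1
        · rw [smul_smul, mul_inv_cancel₀ h0, one_smul]
    · simp only [if_neg hux]
      exact ⟨norm_dir_le _, fun _ => trivial, hdirq x hx hux⟩

end NormalCone

/-! ### Neighbourhoods given by linear functionals -/

section Family

variable {T r : ℕ} {g : GMIndex r} {f f₀ f₁ : ℝ → Matrix (Fin T) (Fin T) ℂ} {K : Type*}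
  {Λ : K → Matrix (Fin T) (Fin T) ℂ →ₗ[ℝ] ℂ} {δ : K → ℝ} {b : ℕ → Fin T → ℂ}

/-- The spectral densities `f` for which the weighted `L₁` norms of `Λ k (f - f₁)` are at most
`δ k`. Each of the four kinds of neighbourhoods is of this form. -/
def nbhdOf (g : GMIndex r) (f₁ : ℝ → Matrix (Fin T) (Fin T) ℂ)
    (Λ : K → Matrix (Fin T) (Fin T) ℂ →ₗ[ℝ] ℂ) (δ : K → ℝ) :
    Set (ℝ → Matrix (Fin T) (Fin T) ℂ) :=
  {f | IsSpectralDensity f ∧ ∀ k, wL1 g (fun x => Λ k (f x - f₁ x)) ≤ δ k}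

lemma integrable_linearMap (hf : ∀ i j, Integrable (fun x => f x i j) circ)
    (L : Matrix (Fin T) (Fin T) ℂ →ₗ[ℝ] ℂ) : Integrable (fun x => L (f x)) circ := by
  have h : ∀ x, L (f x) = ∑ i, ∑ j,
      LinearMap.toContinuousLinearMap (L ∘ₗ Matrix.singleLinearMap ℝ i j) (f x i j) := by
    intro x
    conv_lhs => rw [Matrix.matrix_eq_sum_single (f x)]
    simp [map_sum]
  simp_rw [h]
  exact integrable_finsetSum _ fun i _ => integrable_finsetSum _ fun j _ =>
    ContinuousLinearMap.integrable_comp _ (hf i j)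

lemma integrable_linearMap_sub (hf : IsSpectralDensity f) (hf₁ : IsSpectralDensity f₁)
    (L : Matrix (Fin T) (Fin T) ℂ →ₗ[ℝ] ℂ) : Integrable (fun x => L (f x - f₁ x)) circ :=
  integrable_linearMap (f := fun x => f x - f₁ x) (fun i j => (hf.1 i j).sub (hf₁.1 i j)) L

lemma integrable_weight_mul (hg : g.Positive) {V : Type*} [NormedAddCommGroup V]
    [NormedSpace ℝ V] {u : ℝ → V} (hu : Integrable u circ) :
    Integrable (fun x => weight g x • u x) circ := by
  obtain ⟨K, hK⟩ := exists_weight_le g hg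
  refine hu.bdd_smul K (measurable_weight g).aestronglyMeasurable
    (Eventually.of_forall fun x => ?_)
  rw [Real.norm_of_nonneg (weight_nonneg g x)]
  exact hK x

lemma mix_mem_nbhdOf (hg : g.Positive) (hf₁ : IsSpectralDensity f₁) (hf₀ : f₀ ∈ nbhdOf g f₁ Λ δ)
    (hf : f ∈ nbhdOf g f₁ Λ δ) {ε : ℝ} (h0 : 0 ≤ ε) (h1 : ε ≤ 1) :
    mix ε f₀ f ∈ nbhdOf g f₁ Λ δ := by
  refine ⟨isSpectralDensity_mix hf₀.1 hf.1 h0 h1, fun k => ?_⟩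
  have hi₀ := integrable_weight_mul hg (integrable_linearMap_sub hf₀.1 hf₁ (Λ k)).norm
  have hi := integrable_weight_mul hg (integrable_linearMap_sub hf.1 hf₁ (Λ k)).norm
  have h2 : wL1 g (fun x => Λ k (mix ε f₀ f x - f₁ x))
      ≤ ∫ x, ((1 - ε) * (weight g x • ‖Λ k (f₀ x - f₁ x)‖)
        + ε * (weight g x • ‖Λ k (f x - f₁ x)‖)) ∂circ := by
    refine integral_mono_of_nonneg
      (Eventually.of_forall fun x => mul_nonneg (weight_nonneg g x) (norm_nonneg _))
      ((hi₀.const_mul _).add (hi.const_mul _)) (Eventually.of_forall fun x => ?_)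
    have h3 : mix ε f₀ f x - f₁ x = (1 - ε) • (f₀ x - f₁ x) + ε • (f x - f₁ x) := by
      ext i j
      simp only [mix, Matrix.sub_apply, Matrix.add_apply, Matrix.smul_apply, smul_eq_mul,
        Complex.real_smul]
      push_cast; ring
    simp only
    rw [h3, map_add, map_smul, map_smul]
    have h4 : ‖(1 - ε) • Λ k (f₀ x - f₁ x) + ε • Λ k (f x - f₁ x)‖
        ≤ (1 - ε) * ‖Λ k (f₀ x - f₁ x)‖ + ε * ‖Λ k (f x - f₁ x)‖ := by
      refine (norm_add_le _ _).trans_eq ?_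
      rw [norm_smul, norm_smul, Real.norm_of_nonneg h0, Real.norm_of_nonneg (by linarith)]
    have h5 := mul_le_mul_of_nonneg_left h4 (weight_nonneg g x)
    simp only [smul_eq_mul]
    linarith
  refine h2.trans ?_
  rw [integral_add (hi₀.const_mul _) (hi.const_mul _), integral_const_mul, integral_const_mul]
  have h3 : ∫ x, weight g x • ‖Λ k (f₀ x - f₁ x)‖ ∂circ ≤ δ k := hf₀.2 k
  have h4 : ∫ x, weight g x • ‖Λ k (f x - f₁ x)‖ ∂circ ≤ δ k := hf.2 k
  nlinarith

lemma wdens_mix (ε : ℝ) : wdens g (mix ε f₀ f) = mix ε (wdens g f₀) (wdens g f) := by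
  funext x
  simp only [wdens, mix, smul_add, smul_smul, mul_comm]

/-- The projection error of a least favourable density maximizes the linear functional
`f ↦ ∫ uᵀ (w f) ū` over the neighbourhood. -/
lemma IsLeastFavourable.exists_isProj (hg : g.Positive) (hb : Summable fun k => ‖b k‖)
    (hf₁ : IsSpectralDensity f₁) (hm : Minimality g f₀)
    (h : IsLeastFavourable g b (nbhdOf g f₁ Λ δ) f₀) :
    ∃ v, IsProj (wdens g f₀) (bSeries b) v ∧ ∀ f ∈ nbhdOf g f₁ Λ δ,
      normSq (wdens g f) (fun x => bSeries b x - v x)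
        ≤ normSq (wdens g f₀) (fun x => bSeries b x - v x) := by
  obtain ⟨hf₀, h₀, hh₀, hle⟩ := h
  refine ⟨_, isProj_of_isSpectralCharacteristic hg hh₀, fun f hf => ?_⟩
  refine normSq_le_of_mix_le (isSpectralDensity_wdens hg hf₀.1) (hm.exists_isCoercive hg)
    (isSpectralDensity_wdens hg hf.1) (fun G hG => memL2_bSeries hb hG)
    (isProj_of_isSpectralCharacteristic hg hh₀) fun ε h0 h1 w hw => ?_
  rw [← wdens_mix] at hw ⊢
  rw [← mse_rho_smul, ← mse_eq hg]
  exact hle _ (mix_mem_nbhdOf hg hf₁ hf₀ hf h0.le h1.le) _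
    (isSpectralCharacteristic_of_isProj hg hw)

lemma abs_quad_le (A : Matrix (Fin T) (Fin T) ℂ) (w : Fin T → ℂ) :
    |quad A w| ≤ ‖w‖ ^ 2 * ∑ i, ∑ j, ‖A i j‖ := by
  have h1 := quad_le_of_norm_le (A := A) (w := w) le_rfl
  have h2 := quad_le_of_norm_le (A := -A) (w := w) le_rfl
  have h3 : quad (-A) w = -quad A w := by
    simpa using quad_smul_mat A (-1) w
  simp only [Matrix.neg_apply, norm_neg, h3] at h2
  simp_rw [← Finset.mul_sum] at h1 h2
  exact abs_le.2 ⟨by linarith, h1⟩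

lemma posSemidef_of_quad_nonneg {A : Matrix (Fin T) (Fin T) ℂ} (hA : A.IsHermitian)
    (h : ∀ w, 0 ≤ quad A w) : A.PosSemidef := by
  refine Matrix.PosSemidef.of_dotProduct_mulVec_nonneg hA fun x => ?_
  have h1 := form_self hA (star x)
  rw [form, star_star] at h1
  rw [h1]
  exact_mod_cast h _

variable {V : Type*} [NormedAddCommGroup V] [InnerProductSpace ℝ V] [FiniteDimensional ℝ V]

lemma exists_entry_bound (A : V →ₗ[ℝ] Matrix (Fin T) (Fin T) ℂ) :
    ∃ C : ℝ, 0 < C ∧ ∀ ψ, ∑ i, ∑ j, ‖A ψ i j‖ ≤ C * ‖ψ‖ := by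
  set L : Fin T → Fin T → V →L[ℝ] ℂ := fun i j =>
    LinearMap.toContinuousLinearMap (Matrix.entryLinearMap ℝ ℂ i j ∘ₗ A) with hL
  refine ⟨∑ i, ∑ j, ‖L i j‖ + 1, by positivity, fun ψ => ?_⟩
  have h : ∑ i, ∑ j, ‖A ψ i j‖ ≤ (∑ i, ∑ j, ‖L i j‖) * ‖ψ‖ := by
    simp_rw [Finset.sum_mul]
    exact Finset.sum_le_sum fun i _ => Finset.sum_le_sum fun j _ => (L i j).le_opNorm ψ
  nlinarith [norm_nonneg ψ]

lemma aesm_entry (A : V →ₗ[ℝ] Matrix (Fin T) (Fin T) ℂ) {ψ : ℝ → V}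
    (hψ : AEStronglyMeasurable ψ circ) (i j : Fin T) :
    AEStronglyMeasurable (fun x => A (ψ x) i j) circ :=
  (LinearMap.continuous_of_finiteDimensional
    (Matrix.entryLinearMap ℝ ℂ i j ∘ₗ A)).comp_aestronglyMeasurable hψ

/-- The first order condition along a space of Hermitian directions `A ψ`. Each constraint either
does not see these directions, or measures them by their norm relative to `U`. Small perturbations
`w⁻¹ A ψ` supported where `w⁻¹` and `τ` are bounded keep the density nonnegative definite. -/
theorem exists_multiplier_of_direction (hg : g.Positive) (hf₀ : f₀ ∈ nbhdOf g f₁ Λ δ) {τ : ℝ → ℝ}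
    (hτ : IsCoercive (wdens g f₀) τ) {G : ℝ → Fin T → ℂ} (hG : MemL2 (wdens g f₀) G)
    (hmax : ∀ f ∈ nbhdOf g f₁ Λ δ, normSq (wdens g f) G ≤ normSq (wdens g f₀) G)
    (A : V →ₗ[ℝ] Matrix (Fin T) (Fin T) ℂ) (hA : ∀ ψ, (A ψ).IsHermitian) {U : ℝ → V}
    (hU : Integrable U circ) {δ' : ℝ} (hδ' : 0 < δ') (hUle : ∫ x, ‖U x‖ ∂circ ≤ δ')
    (hΛ : ∀ k, (∀ ψ, Λ k (A ψ) = 0) ∨ (δ k = δ' ∧ ∀ᵐ x ∂circ, ∀ ψ,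
      ‖weight g x • Λ k (f₀ x - f₁ x) + Λ k (A ψ)‖ = ‖U x + ψ‖))
    {q : ℝ → V} (hq : AEStronglyMeasurable q circ)
    (hqA : ∀ x ψ, quad (A ψ) (G x) = inner ℝ (q x) ψ) :
    ∃ (β : ℝ) (γ : ℝ → V), 0 ≤ β ∧
      (∀ᵐ x ∂circ, ‖γ x‖ ≤ 1 ∧ (U x ≠ 0 → γ x = dir (U x)) ∧ q x = β • γ x) ∧
      (β ≠ 0 → ∫ x, ‖U x‖ ∂circ = δ') := by
  have hF₀ := isSpectralDensity_wdens hg hf₀.1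
  obtain ⟨C, hC0, hC⟩ := exists_entry_bound A
  have hquad : ∀ ψ w, |quad (A ψ) w| ≤ ‖w‖ ^ 2 * (C * ‖ψ‖) := fun ψ w =>
    (abs_quad_le _ _).trans (mul_le_mul_of_nonneg_left (hC ψ) (sq_nonneg _))
  have hqle : ∀ x, ‖q x‖ ≤ C * ‖G x‖ ^ 2 := by
    intro x
    have h1 := (le_abs_self _).trans (hquad (q x) (G x))
    rw [hqA, real_inner_self_eq_norm_sq] at h1
    by_cases h0 : ‖q x‖ = 0
    · rw [h0]; positivity
    · have : 0 < ‖q x‖ := lt_of_le_of_ne (norm_nonneg _) (Ne.symm h0)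
      nlinarith
  set S : ℕ → Set ℝ := fun n => {x | τ x ≤ n} ∩ {x | 1 ≤ (n : ℝ) * weight g x} with hSdef
  have hS : ∀ n, NullMeasurableSet (S n) circ := fun n =>
    (nullMeasurableSet_le hτ.integrable.1.aemeasurable aemeasurable_const).inter
      (nullMeasurableSet_le aemeasurable_const ((measurable_weight g).const_mul _).aemeasurable)
  have hmono : Monotone S := by
    intro n m hnm x hx
    have h : (n : ℝ) ≤ m := by exact_mod_cast hnm
    exact ⟨hx.1.trans h, le_trans hx.2 (mul_le_mul_of_nonneg_right h (weight_nonneg g x))⟩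
  have hcov : ∀ᵐ x ∂circ, ∃ n, x ∈ S n := by
    filter_upwards [ae_weight_pos g hg] with x hx
    obtain ⟨n, hn⟩ := exists_nat_ge (max (τ x) (weight g x)⁻¹)
    refine ⟨n, (le_max_left _ _).trans hn, ?_⟩
    have := (le_max_right _ _).trans hn
    rwa [inv_le_iff_one_le_mul₀ hx] at this
  have hint : ∀ n, IntegrableOn q (S n) circ := by
    intro n
    have h1 : IntegrableOn (fun x => C * ((n : ℝ) * quad (wdens g f₀ x) (G x))) (S n) circ :=
      (((hG.integrable_quad hF₀).const_mul _).const_mul _).integrableOn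
    refine h1.mono' hq.restrict ((ae_restrict_iff'₀ (hS n)).2 ?_)
    filter_upwards [hτ.le, hF₀.2] with x h2 h3 hx
    refine (hqle x).trans (mul_le_mul_of_nonneg_left ((h2 _).trans ?_) hC0.le)
    exact mul_le_mul_of_nonneg_right hx.1 (quad_nonneg h3 _)
  refine exists_multiplier_of_maximal hU hq hδ' hUle hS hmono hcov hint fun n => ?_
  refine ⟨1 / (((n : ℝ) + 1) * C), by positivity, fun ψ hψm hψκ hψS hψle => ?_⟩
  set f' : ℝ → Matrix (Fin T) (Fin T) ℂ := fun x => f₀ x + (weight g x)⁻¹ • A (ψ x) with hf'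
  have hwd : ∀ᵐ x ∂circ, wdens g f' x = wdens g f₀ x + A (ψ x) := by
    filter_upwards [ae_weight_pos g hg] with x hx
    have h1 : ∀ M : Matrix (Fin T) (Fin T) ℂ, (weight g x : ℂ) • M = weight g x • M := fun M => by
      ext i j; simp
    rw [wdens, wdens, hf', smul_add, h1 ((weight g x)⁻¹ • _), smul_smul, mul_inv_cancel₀ hx.ne',
      one_smul]
  have hpsd : ∀ᵐ x ∂circ, (wdens g f₀ x + A (ψ x)).PosSemidef := by
    filter_upwards [hF₀.2, hτ.le] with x h1 h2
    by_cases hx : x ∈ S n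
    · refine posSemidef_of_quad_nonneg (h1.1.add (hA _)) fun w => ?_
      rw [quad_add_mat]
      have h3 := quad_nonneg h1 w
      have h4 := (h2 w).trans (mul_le_mul_of_nonneg_right hx.1 h3)
      have h5 := neg_le_of_abs_le (hquad (ψ x) w)
      have h6 : C * ‖ψ x‖ ≤ 1 / ((n : ℝ) + 1) := by
        calc C * ‖ψ x‖ ≤ C * (1 / (((n : ℝ) + 1) * C)) := by gcongr; exact hψκ x
          _ = _ := by field_simp
      have h7 : ‖w‖ ^ 2 * (C * ‖ψ x‖) ≤ ‖w‖ ^ 2 * (1 / ((n : ℝ) + 1)) := by gcongr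
      have h8 : ‖w‖ ^ 2 * (1 / ((n : ℝ) + 1)) ≤ quad (wdens g f₀ x) w := by
        rw [mul_one_div, div_le_iff₀ (by positivity)]
        linarith
      linarith
    · rw [hψS x hx, map_zero, add_zero]; exact h1
  have hf'sd : IsSpectralDensity f' := by
    refine ⟨fun i j => ?_, ?_⟩
    · suffices h : Integrable (fun x => (weight g x)⁻¹ • A (ψ x) i j) circ from
        (hf₀.1.1 i j).add h
      refine Integrable.of_bound (C := n * (C * (1 / (((n : ℝ) + 1) * C))))
        ((measurable_weight g).inv.aestronglyMeasurable.smul (aesm_entry A hψm i j)) ?_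
      filter_upwards [ae_weight_pos g hg] with x hw
      by_cases hx : x ∈ S n
      · have h1 : ‖A (ψ x) i j‖ ≤ C * (1 / (((n : ℝ) + 1) * C)) := by
          refine le_trans ?_ ((hC (ψ x)).trans (by gcongr; exact hψκ x))
          refine le_trans (Finset.single_le_sum (f := fun j => ‖A (ψ x) i j‖)
            (fun _ _ => norm_nonneg _) (Finset.mem_univ j)) ?_
          exact Finset.single_le_sum (f := fun i => ∑ j, ‖A (ψ x) i j‖)
            (fun _ _ => Finset.sum_nonneg fun _ _ => norm_nonneg _) (Finset.mem_univ i)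
        have h2 : (weight g x)⁻¹ ≤ n := (inv_le_iff_one_le_mul₀ hw).2 hx.2
        rw [norm_smul, norm_inv, Real.norm_of_nonneg hw.le]
        gcongr
      · have h3 : A (ψ x) i j = 0 := by rw [hψS x hx, map_zero]; rfl
        rw [h3, smul_zero, norm_zero]
        positivity
    · filter_upwards [hpsd, hwd, ae_weight_pos g hg] with x h1 h2 hw
      rw [← h2] at h1
      have h3 : f' x = ((weight g x)⁻¹ : ℂ) • wdens g f' x := by
        rw [wdens, smul_smul, inv_mul_cancel₀ (by exact_mod_cast hw.ne'), one_smul]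
      rw [h3]
      refine h1.smul ?_
      rw [← Complex.ofReal_inv]
      exact_mod_cast (inv_nonneg.2 hw.le)
  have hf'mem : f' ∈ nbhdOf g f₁ Λ δ := by
    refine ⟨hf'sd, fun k => ?_⟩
    have h1 : ∀ᵐ x ∂circ, weight g x * ‖Λ k (f' x - f₁ x)‖
        = ‖weight g x • Λ k (f₀ x - f₁ x) + Λ k (A (ψ x))‖ := by
      filter_upwards [ae_weight_pos g hg] with x hw
      have h2 : f' x - f₁ x = (f₀ x - f₁ x) + (weight g x)⁻¹ • A (ψ x) := by
        simp only [hf']; abel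
      have h3 : weight g x • Λ k (f' x - f₁ x)
          = weight g x • Λ k (f₀ x - f₁ x) + Λ k (A (ψ x)) := by
        rw [h2, map_add, map_smul, smul_add, smul_smul, mul_inv_cancel₀ hw.ne', one_smul]
      rw [← h3, norm_smul, Real.norm_of_nonneg hw.le]
    rw [wL1, integral_congr_ae h1]
    rcases hΛ k with h | ⟨h, h'⟩
    · refine le_of_eq_of_le (integral_congr_ae (Eventually.of_forall fun x => ?_)) (hf₀.2 k)
      simp only
      rw [h, add_zero, norm_smul, Real.norm_of_nonneg (weight_nonneg g x)]
    · rw [h]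
      refine le_of_eq_of_le (integral_congr_ae ?_) hψle
      filter_upwards [h'] with x hx using hx _
  have hF' := isSpectralDensity_wdens hg hf'sd
  have hle := hmax f' hf'mem
  have hG' : MemL2 (wdens g f') G := ⟨hG.1, hle.trans_lt hG.2⟩
  rw [normSq_eq_ofReal hF' hG', normSq_eq_ofReal hF₀ hG,
    ENNReal.ofReal_le_ofReal_iff (nsq_nonneg hF₀ _)] at hle
  have h1 : ∫ x, inner ℝ (q x) (ψ x) ∂circ = nsq (wdens g f') G - nsq (wdens g f₀) G := by
    rw [nsq, nsq, ← integral_sub (hG'.integrable_quad hF') (hG.integrable_quad hF₀)]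
    refine integral_congr_ae ?_
    filter_upwards [hwd] with x hx
    rw [hx, quad_add_mat, hqA]; ring
  rw [h1]; linarith

/-- Along directions which no constraint sees, the functional has to vanish. -/
lemma eq_zero_of_free_direction (hg : g.Positive) (hf₀ : f₀ ∈ nbhdOf g f₁ Λ δ) {τ : ℝ → ℝ}
    (hτ : IsCoercive (wdens g f₀) τ) {G : ℝ → Fin T → ℂ} (hG : MemL2 (wdens g f₀) G)
    (hmax : ∀ f ∈ nbhdOf g f₁ Λ δ, normSq (wdens g f) G ≤ normSq (wdens g f₀) G)
    (A : V →ₗ[ℝ] Matrix (Fin T) (Fin T) ℂ) (hA : ∀ ψ, (A ψ).IsHermitian)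
    (hΛ : ∀ k ψ, Λ k (A ψ) = 0) {q : ℝ → V} (hq : AEStronglyMeasurable q circ)
    (hqA : ∀ x ψ, quad (A ψ) (G x) = inner ℝ (q x) ψ) : ∀ᵐ x ∂circ, q x = 0 := by
  obtain ⟨β, γ, -, h1, h2⟩ := exists_multiplier_of_direction hg hf₀ hτ hG hmax A hA
    (U := fun _ => 0) (integrable_zero _ _ _) one_pos (by simp) (fun k => Or.inl (hΛ k)) hq hqA
  have hβ : β = 0 := by
    by_contra h
    simpa using h2 h
  filter_upwards [h1] with x hx
  rw [hx.2.2, hβ, zero_smul]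

end Family

/-! ### Multipliers of the four neighbourhoods -/

section Classes

variable {T r : ℕ} {g : GMIndex r} {f f₀ f₁ M : ℝ → Matrix (Fin T) (Fin T) ℂ}

lemma quad_eq_re_sum (A : Matrix (Fin T) (Fin T) ℂ) (w : Fin T → ℂ) :
    quad A w = (∑ i, ∑ j, A i j * Matrix.vecMulVec w (star w) i j).re := by
  rw [quad, form_eq_sum]
  congr 1
  refine Finset.sum_congr rfl fun i _ => Finset.sum_congr rfl fun j _ => ?_
  rw [Matrix.vecMulVec_apply, Pi.star_apply]; ring

lemma matInner_eq_sum (B A : Matrix (Fin T) (Fin T) ℂ) :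
    matInner B A = ∑ i, ∑ j, B i j * star (A i j) := by
  simp [matInner, Matrix.trace, Matrix.mul_apply]

/-- `⟨B, ·⟩` as a real linear map (it is conjugate linear over `ℂ`). -/
noncomputable def matInnerMap (B : Matrix (Fin T) (Fin T) ℂ) :
    Matrix (Fin T) (Fin T) ℂ →ₗ[ℝ] ℂ where
  toFun := matInner B
  map_add' A A' := by simp [matInner, Matrix.mul_add]
  map_smul' t A := by
    simp only [matInner_eq_sum, Matrix.smul_apply, Finset.smul_sum]
    refine Finset.sum_congr rfl fun i _ => Finset.sum_congr rfl fun j _ => ?_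
    simp
    ring

lemma matInnerMap_apply (B A : Matrix (Fin T) (Fin T) ℂ) : matInnerMap B A = matInner B A := rfl

lemma matInner_im {B A : Matrix (Fin T) (Fin T) ℂ} (hB : B.IsHermitian) (hA : A.IsHermitian) :
    (matInner B A).im = 0 := by
  refine Complex.conj_eq_iff_im.1 ?_
  change star (matInner B A) = matInner B A
  rw [matInner, ← Matrix.trace_conjTranspose, Matrix.conjTranspose_mul,
    Matrix.conjTranspose_conjTranspose, hB.eq, hA.eq, Matrix.trace_mul_comm]

lemma densities_weighted (B : Matrix (Fin T) (Fin T) ℂ) (δ : ℝ) :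
    (Nbhd.weighted B δ).densities g f₁
      = nbhdOf g f₁ (fun _ : Unit => matInnerMap B) (fun _ => δ) := by
  ext f; simp [Nbhd.densities, nbhdOf, matInnerMap_apply]

lemma densities_diagonal (δ : Fin T → ℝ) :
    (Nbhd.diagonal δ).densities g f₁
      = nbhdOf g f₁ (fun k => Matrix.entryLinearMap ℝ ℂ k k) δ := by
  ext f; simp [Nbhd.densities, nbhdOf]

lemma densities_entrywise (δ : Fin T → Fin T → ℝ) :
    (Nbhd.entrywise δ).densities g f₁
      = nbhdOf g f₁ (fun k : Fin T × Fin T => Matrix.entryLinearMap ℝ ℂ k.1 k.2)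
        (fun k => δ k.1 k.2) := by
  ext f; simp [Nbhd.densities, nbhdOf]

lemma matInner_one (A : Matrix (Fin T) (Fin T) ℂ) : matInner 1 A = star A.trace := by
  rw [matInner, Matrix.one_mul, Matrix.trace_conjTranspose]

/-- The trace neighbourhood is the weighted one with the identity matrix as weight. -/
lemma densities_trace (δ : ℝ) :
    (Nbhd.trace δ).densities g f₁ = (Nbhd.weighted 1 δ).densities g f₁ := by
  ext f; simp only [Nbhd.densities, wL1, matInner_one, norm_star]

lemma isMultiplier_trace_iff (δ : ℝ) :
    (Nbhd.trace δ).IsMultiplier g f₁ f₀ M ↔ (Nbhd.weighted 1 δ).IsMultiplier g f₁ f₀ M := by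
  simp only [Nbhd.IsMultiplier, IsSignOf, wL1, matInner_one, norm_star, Matrix.transpose_one, ne_eq,
    star_eq_zero]
  rfl

/-- All four neighbourhoods are given by linear functionals. -/
lemma exists_densities_eq (g : GMIndex r) (f₁ : ℝ → Matrix (Fin T) (Fin T) ℂ) (N : Nbhd T) :
    ∃ (K : Type) (Λ : K → Matrix (Fin T) (Fin T) ℂ →ₗ[ℝ] ℂ) (δ : K → ℝ),
      N.densities g f₁ = nbhdOf g f₁ Λ δ := by
  cases N with
  | trace δ => exact ⟨_, _, _, (densities_trace δ).trans (densities_weighted 1 δ)⟩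
  | diagonal δ => exact ⟨_, _, _, densities_diagonal δ⟩
  | weighted B δ => exact ⟨_, _, _, densities_weighted B δ⟩
  | entrywise δ => exact ⟨_, _, _, densities_entrywise δ⟩

lemma isSpectralDensity_of_mem {N : Nbhd T} (h : f ∈ N.densities g f₁) : IsSpectralDensity f := by
  cases N <;> exact h.1

/-! ### Necessity of the multiplier form -/

/-- The Hermitian matrix with entries `ψ` at `(i, j)` and `ψ̄` at `(j, i)` (their sum when
`i = j`). -/
noncomputable def hermSingle (i j : Fin T) : ℂ →ₗ[ℝ] Matrix (Fin T) (Fin T) ℂ where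
  toFun ψ := Matrix.single i j ψ + Matrix.single j i (star ψ)
  map_add' ψ ψ' := by rw [star_add, Matrix.single_add, Matrix.single_add]; abel
  map_smul' t ψ := by
    rw [star_smul, smul_add, Matrix.smul_single, Matrix.smul_single]; simp

lemma hermSingle_apply (i j : Fin T) (ψ : ℂ) :
    hermSingle i j ψ = Matrix.single i j ψ + Matrix.single j i (star ψ) := rfl

lemma isHermitian_hermSingle (i j : Fin T) (ψ : ℂ) : (hermSingle i j ψ).IsHermitian := by
  rw [hermSingle_apply, Matrix.IsHermitian, Matrix.conjTranspose_add, Matrix.conjTranspose_single,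
    Matrix.conjTranspose_single, star_star, add_comm]

lemma form_single_mat (i j : Fin T) (ψ : ℂ) (w : Fin T → ℂ) :
    form (Matrix.single i j ψ) w w = ψ * (w i * star (w j)) := by
  rw [form_eq_sum, Finset.sum_eq_single i, Finset.sum_eq_single j]
  · simp; ring
  · intro b _ hb; simp [hb.symm]
  · simp
  · intro b _ hb
    exact Finset.sum_eq_zero fun c _ => by simp [hb.symm]
  · simp

lemma quad_hermSingle (i j : Fin T) (ψ : ℂ) (w : Fin T → ℂ) :
    quad (hermSingle i j ψ) w = 2 * (ψ * (w i * star (w j))).re := by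
  rw [quad, hermSingle_apply, form_add_mat, form_single_mat, form_single_mat, Complex.add_re]
  have : star ψ * (w j * star (w i)) = star (ψ * (w i * star (w j))) := by
    simp only [star_mul', star_star]; ring
  rw [this, two_mul]
  rfl

lemma inner_two_star (z ψ : ℂ) : inner ℝ (2 * star z) ψ = 2 * (ψ * z).re := by
  rw [Complex.inner]; simp; ring

lemma quad_hermSingle_eq_inner (i j : Fin T) (ψ : ℂ) (w : Fin T → ℂ) :
    quad (hermSingle i j ψ) w = inner ℝ (2 * star (w i * star (w j))) ψ := by
  rw [quad_hermSingle, inner_two_star]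

lemma quad_one (w : Fin T → ℂ) : quad 1 w = ∑ p, ‖w p‖ ^ 2 := by
  rw [quad, form, Matrix.one_mulVec, dotProduct, Complex.re_sum]
  refine Finset.sum_congr rfl fun p _ => ?_
  have h : w p * star (w p) = ((‖w p‖ ^ 2 : ℝ) : ℂ) := by push_cast; exact Complex.mul_conj' _
  rw [Pi.star_apply, h, Complex.ofReal_re]

lemma matInner_hermSingle {B : Matrix (Fin T) (Fin T) ℂ} (hB : B.IsHermitian) (i j : Fin T)
    (ψ : ℂ) : matInner B (hermSingle i j ψ) = ((2 * (ψ * B j i).re : ℝ) : ℂ) := by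
  rw [matInner, (isHermitian_hermSingle i j ψ).eq, hermSingle_apply, Matrix.mul_add,
    Matrix.trace_add, Matrix.trace_mul_single, Matrix.trace_mul_single, ← hB.apply i j]
  have := Complex.add_conj (ψ * B j i)
  rw [← this, map_mul]
  simp only [MulOpposite.smul_eq_mul_unop, MulOpposite.unop_op]
  rw [mul_comm (B j i), mul_comm (star (B j i))]
  rfl

lemma aesm_mul_star {G : ℝ → Fin T → ℂ} (hG : ∀ p, AEStronglyMeasurable (fun x => G x p) circ)
    (i j : Fin T) : AEStronglyMeasurable (fun x => G x i * star (G x j)) circ :=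
  (hG i).mul (continuous_star.comp_aestronglyMeasurable (hG j))

lemma dir_eq_sign (y : ℝ) : dir y = Real.sign y := by
  rcases lt_trichotomy y 0 with h | h | h
  · rw [Real.sign_of_neg h, dir, Real.norm_of_nonpos h.le, smul_eq_mul]
    have := h.ne; field_simp
  · simp [h, dir]
  · rw [Real.sign_of_pos h, dir, Real.norm_of_nonneg h.le, smul_eq_mul, inv_mul_cancel₀ h.ne']

lemma dir_pos_smul {V : Type*} [NormedAddCommGroup V] [InnerProductSpace ℝ V] {c : ℝ} (hc : 0 < c)
    (z : V) : dir (c • z) = dir z := by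
  rw [dir, dir, norm_smul, Real.norm_of_nonneg hc.le, smul_smul, mul_inv, mul_right_comm,
    inv_mul_cancel₀ hc.ne', one_mul]

lemma isSignOf_of_dir (hg : g.Positive) {γ : ℝ → ℝ} {u : ℝ → ℂ}
    (hu : ∀ᵐ x ∂circ, (u x).im = 0)
    (h : ∀ᵐ x ∂circ, ‖γ x‖ ≤ 1 ∧ (weight g x • (u x).re ≠ 0 →
      γ x = dir (weight g x • (u x).re))) : IsSignOf γ u := by
  filter_upwards [hu, h, ae_weight_pos g hg] with x h1 h2 h3
  refine ⟨h2.1, fun h4 => ?_⟩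
  have h5 : (u x).re ≠ 0 := fun h6 => h4 (Complex.ext h6 h1)
  rw [h2.2 (smul_ne_zero h3.ne' h5), dir_pos_smul h3, dir_eq_sign]

lemma wL1_eq_of_im {u : ℝ → ℂ} (hu : ∀ᵐ x ∂circ, (u x).im = 0) :
    ∫ x, ‖weight g x • (u x).re‖ ∂circ = wL1 g u := by
  refine integral_congr_ae ?_
  filter_upwards [hu] with x hx
  have : u x = ((u x).re : ℂ) := Complex.ext rfl (by simpa using hx)
  rw [norm_smul, Real.norm_of_nonneg (weight_nonneg g x), this, Complex.norm_real,
    Complex.ofReal_re]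

lemma norm_smul_add_of_im {z : ℂ} (hz : z.im = 0) (c ψ : ℝ) :
    ‖c • z + (ψ : ℂ)‖ = ‖c • z.re + ψ‖ := by
  have : c • z + (ψ : ℂ) = ((c • z.re + ψ : ℝ) : ℂ) :=
    Complex.ext (by simp) (by simp [hz])
  rw [this, Complex.norm_real]

lemma isHermitian_sub (hf₀ : IsSpectralDensity f₀) (hf₁ : IsSpectralDensity f₁) :
    ∀ᵐ x ∂circ, (f₀ x - f₁ x).IsHermitian := by
  filter_upwards [hf₀.2, hf₁.2] with x h h' using h.1.sub h'.1

variable {τ : ℝ → ℝ} {G : ℝ → Fin T → ℂ}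

/-- For the weighted neighbourhood, the directions orthogonal to the weight matrix are free, which
makes `G G*` proportional to `Bᵀ`; the factor is found from the direction of the identity. -/
lemma exists_multiplier_weighted (hg : g.Positive) (hf₁ : IsSpectralDensity f₁)
    {B : Matrix (Fin T) (Fin T) ℂ} (hB : B.PosDef) {δ : ℝ} (hδ : 0 < δ)
    (hf₀ : f₀ ∈ (Nbhd.weighted B δ).densities g f₁) (hτ : IsCoercive (wdens g f₀) τ)
    (hG : MemL2 (wdens g f₀) G)
    (hmax : ∀ f ∈ (Nbhd.weighted B δ).densities g f₁,
      normSq (wdens g f) G ≤ normSq (wdens g f₀) G)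
    (hG0 : ¬ ∀ᵐ x ∂circ, G x = 0) :
    ∃ M, (Nbhd.weighted B δ).IsMultiplier g f₁ f₀ M ∧
      ∀ᵐ x ∂circ, Matrix.vecMulVec (G x) (star (G x)) = M x := by
  rw [densities_weighted] at hf₀ hmax
  have hT : Nonempty (Fin T) := by
    by_contra h
    rw [not_nonempty_iff] at h
    exact hG0 (Eventually.of_forall fun x => Subsingleton.elim _ _)
  have htr : 0 < B.trace.re := (Complex.lt_def.1 hB.trace_pos).1
  have htr' : B.trace = (B.trace.re : ℂ) :=
    Complex.ext rfl (by simpa using ((Complex.lt_def.1 hB.trace_pos).2).symm)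
  set L : ℝ → ℝ := fun x => (∑ p, ‖G x p‖ ^ 2) / B.trace.re with hL
  have hLm : AEStronglyMeasurable L circ := by
    simp_rw [hL, div_eq_mul_inv]
    refine AEStronglyMeasurable.mul_const ?_ _
    exact Finset.aestronglyMeasurable_fun_sum _ fun p _ => (hG.1 p).norm.pow 2
  have hB1 : matInner B 1 = (B.trace.re : ℂ) := by
    rw [matInner, Matrix.conjTranspose_one, Matrix.mul_one, ← htr']
  have hfree : ∀ i j, ∀ᵐ x ∂circ, G x i * star (G x j) = L x * B j i := by
    intro i j
    set A : ℂ →ₗ[ℝ] Matrix (Fin T) (Fin T) ℂ := hermSingle i j -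
      ((2 / B.trace.re) • (Complex.reLm ∘ₗ LinearMap.mulRight ℝ (B j i))).smulRight 1 with hA
    have hAapp : ∀ ψ, A ψ = hermSingle i j ψ - (2 / B.trace.re * (ψ * B j i).re) • 1 := fun ψ => by
      simp [hA]
    have h := eq_zero_of_free_direction hg hf₀ hτ hG hmax A (fun ψ => ?_) (fun _ ψ => ?_)
      (q := fun x => 2 * star (G x i * star (G x j) - L x * B j i)) ?_ (fun x ψ => ?_)
    · filter_upwards [h] with x hx
      have h1 := (mul_eq_zero.1 hx).resolve_left two_ne_zero
      exact sub_eq_zero.1 (star_eq_zero.1 h1)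
    · rw [hAapp]
      refine (isHermitian_hermSingle i j ψ).sub ?_
      rw [Matrix.IsHermitian, Matrix.conjTranspose_smul]; simp
    · rw [hAapp, map_sub, map_smul, matInnerMap_apply, matInnerMap_apply,
        matInner_hermSingle hB.1, hB1, Complex.real_smul, ← Complex.ofReal_mul,
        ← Complex.ofReal_sub]
      norm_cast
      field_simp
      ring
    · refine AEStronglyMeasurable.const_mul (continuous_star.comp_aestronglyMeasurable ?_) _
      exact (aesm_mul_star hG.1 i j).sub
        ((Complex.continuous_ofReal.comp_aestronglyMeasurable hLm).mul_const _)
    · have h1 : A ψ = hermSingle i j ψ + ((-(2 / B.trace.re * (ψ * B j i).re) : ℝ) : ℂ) • 1 := by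
        rw [hAapp, sub_eq_add_neg, ← neg_smul]
        congr 1
      rw [h1, quad_add_mat, quad_smul_mat, quad_hermSingle, quad_one, inner_two_star]
      have h2 : ψ * (G x i * star (G x j) - L x * B j i)
          = ψ * (G x i * star (G x j)) - (L x : ℂ) * (ψ * B j i) := by ring
      rw [h2, Complex.sub_re, Complex.re_ofReal_mul, hL]
      ring
  have hprop : ∀ᵐ x ∂circ, Matrix.vecMulVec (G x) (star (G x)) = (L x : ℂ) • Bᵀ := by
    filter_upwards [ae_all_iff.2 fun i => ae_all_iff.2 (hfree i)] with x hx
    ext i j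
    simpa [Matrix.vecMulVec_apply] using hx i j
  have him : ∀ᵐ x ∂circ, (matInner B (f₀ x - f₁ x)).im = 0 := by
    filter_upwards [isHermitian_sub hf₀.1 hf₁] with x hx using matInner_im hB.1 hx
  have hsat : ∫ x, ‖weight g x • (matInner B (f₀ x - f₁ x)).re‖ ∂circ
      = wL1 g (fun x => matInner B (f₀ x - f₁ x)) := wL1_eq_of_im him
  obtain ⟨β, γ, hβ, h1, h2⟩ := exists_multiplier_of_direction (V := ℝ) hg hf₀ hτ hG hmax
    (LinearMap.toSpanSingleton ℝ _ ((B.trace.re)⁻¹ • 1))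
    (fun ψ => by
      rw [LinearMap.toSpanSingleton_apply, Matrix.IsHermitian, Matrix.conjTranspose_smul,
        Matrix.conjTranspose_smul]
      simp)
    (U := fun x => weight g x • (matInner B (f₀ x - f₁ x)).re)
    (integrable_weight_mul hg
      (integrable_linearMap_sub hf₀.1 hf₁ (matInnerMap B)).re) hδ
    (hsat.trans_le (hf₀.2 ()))
    (fun _ => Or.inr ⟨rfl, by
      filter_upwards [him] with x hx ψ
      have h3 : matInnerMap B (LinearMap.toSpanSingleton ℝ _ ((B.trace.re)⁻¹ • 1) ψ) = (ψ : ℂ) := by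
        rw [LinearMap.toSpanSingleton_apply, map_smul, map_smul, matInnerMap_apply, hB1,
          Complex.real_smul, Complex.real_smul, ← Complex.ofReal_mul, inv_mul_cancel₀ htr.ne']
        simp
      rw [h3]
      exact norm_smul_add_of_im hx _ _⟩)
    hLm (fun x ψ => by
      have h3 : LinearMap.toSpanSingleton ℝ (Matrix (Fin T) (Fin T) ℂ) ((B.trace.re)⁻¹ • 1) ψ
          = ((ψ * (B.trace.re)⁻¹ : ℝ) : ℂ) • 1 := by
        rw [LinearMap.toSpanSingleton_apply, smul_smul]
        ext a c
        simp
      rw [h3, quad_smul_mat, quad_one, real_inner_comm]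
      simp only [hL, inner, div_eq_mul_inv]
      simp
      ring)
  refine ⟨fun x => ((√β ^ 2 * γ x : ℝ) : ℂ) • Bᵀ, ⟨√β, γ, isSignOf_of_dir hg him
    (h1.mono fun x hx => ⟨hx.1, hx.2.1⟩), Eventually.of_forall fun _ => rfl, ?_⟩, ?_⟩
  · rw [← hsat]
    refine h2 fun h0 => hG0 ?_
    filter_upwards [h1] with x hx
    have h3 : L x = 0 := by rw [hx.2.2, h0, zero_smul]
    have h4 : ∑ p, ‖G x p‖ ^ 2 = 0 := by
      simpa [hL, htr.ne'] using h3
    rw [Finset.sum_eq_zero_iff_of_nonneg fun _ _ => by positivity] at h4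
    ext p
    simpa using h4 p (Finset.mem_univ p)
  · filter_upwards [hprop, h1] with x hx hx'
    rw [hx, hx'.2.2, Real.sq_sqrt hβ, smul_eq_mul]

lemma quad_single_self (k : Fin T) (ψ : ℝ) (w : Fin T → ℂ) :
    quad (Matrix.single k k (ψ : ℂ)) w = ψ * ‖w k‖ ^ 2 := by
  have h : w k * star (w k) = ((‖w k‖ ^ 2 : ℝ) : ℂ) := by push_cast; exact Complex.mul_conj' _
  rw [quad, form_single_mat, h, ← Complex.ofReal_mul, Complex.ofReal_re]

/-- The direction of a single diagonal entry. -/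
noncomputable def diagSingle (k : Fin T) : ℝ →ₗ[ℝ] Matrix (Fin T) (Fin T) ℂ :=
  LinearMap.toSpanSingleton ℝ _ (Matrix.single k k 1)

lemma diagSingle_apply (k : Fin T) (ψ : ℝ) : diagSingle k ψ = Matrix.single k k (ψ : ℂ) := by
  rw [diagSingle, LinearMap.toSpanSingleton_apply, Matrix.smul_single]; simp

lemma isHermitian_diagSingle (k : Fin T) (ψ : ℝ) : (diagSingle k ψ).IsHermitian := by
  rw [diagSingle_apply, Matrix.IsHermitian, Matrix.conjTranspose_single]
  congr 1
  exact Complex.conj_ofReal ψ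

lemma quad_diagSingle (k : Fin T) (x : ℝ) (ψ : ℝ) :
    quad (diagSingle k ψ) (G x) = inner ℝ (‖G x k‖ ^ 2) ψ := by
  rw [diagSingle_apply, quad_single_self]; simp [inner]

lemma entry_im (h : ∀ᵐ x ∂circ, (f₀ x - f₁ x).IsHermitian) (k : Fin T) :
    ∀ᵐ x ∂circ, ((f₀ x - f₁ x) k k).im = 0 := by
  filter_upwards [h] with x hx using Complex.conj_eq_iff_im.1 (hx.apply k k)

lemma exists_multiplier_diagonal (hg : g.Positive) (hf₁ : IsSpectralDensity f₁)
    {δ : Fin T → ℝ} (hδ : ∀ k, 0 < δ k)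
    (hf₀ : f₀ ∈ (Nbhd.diagonal δ).densities g f₁) (hτ : IsCoercive (wdens g f₀) τ)
    (hG : MemL2 (wdens g f₀) G)
    (hmax : ∀ f ∈ (Nbhd.diagonal δ).densities g f₁,
      normSq (wdens g f) G ≤ normSq (wdens g f₀) G) :
    ∃ M, (Nbhd.diagonal δ).IsMultiplier g f₁ f₀ M ∧
      ∀ᵐ x ∂circ, Matrix.vecMulVec (G x) (star (G x)) = M x := by
  rw [densities_diagonal] at hf₀ hmax
  have him := entry_im (isHermitian_sub hf₀.1 hf₁)
  have hoff : ∀ i j, i ≠ j → ∀ᵐ x ∂circ, G x i * star (G x j) = 0 := by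
    intro i j hij
    have h := eq_zero_of_free_direction hg hf₀ hτ hG hmax (hermSingle i j)
      (isHermitian_hermSingle i j) (fun k ψ => by
        rw [Matrix.entryLinearMap_apply, hermSingle_apply, Matrix.add_apply]
        simp only [Matrix.single_apply]
        rw [if_neg (fun h => hij (h.1.trans h.2.symm)),
          if_neg (fun h => hij (h.2.trans h.1.symm)), add_zero])
      (q := fun x => 2 * star (G x i * star (G x j)))
      ((continuous_star.comp_aestronglyMeasurable (aesm_mul_star hG.1 i j)).const_mul _)
      (fun x ψ => quad_hermSingle_eq_inner i j ψ (G x))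
    filter_upwards [h] with x hx
    exact star_eq_zero.1 ((mul_eq_zero.1 hx).resolve_left two_ne_zero)
  have hdiag := fun k => exists_multiplier_of_direction (V := ℝ) hg hf₀ hτ hG hmax (diagSingle k)
    (isHermitian_diagSingle k)
    (U := fun x => weight g x • ((f₀ x - f₁ x) k k).re)
    (integrable_weight_mul hg
      (integrable_linearMap_sub hf₀.1 hf₁ (Matrix.entryLinearMap ℝ ℂ k k)).re) (hδ k)
    ((wL1_eq_of_im (him k)).trans_le (hf₀.2 k))
    (fun l => by
      by_cases hl : l = k
      · subst hl
        refine Or.inr ⟨rfl, ?_⟩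
        filter_upwards [him l] with x hx ψ
        rw [Matrix.entryLinearMap_apply, Matrix.entryLinearMap_apply, diagSingle_apply,
          Matrix.single_apply_same]
        exact norm_smul_add_of_im hx _ _
      · refine Or.inl fun ψ => ?_
        rw [Matrix.entryLinearMap_apply, diagSingle_apply, Matrix.single_apply,
          if_neg (fun h => hl h.1.symm)])
    (q := fun x => ‖G x k‖ ^ 2) ((hG.1 k).norm.pow 2) (fun x ψ => quad_diagSingle k x ψ)
  choose β γ hβ h1 h2 using hdiag
  refine ⟨fun x => Matrix.diagonal fun k => ((√(β k) ^ 2 * γ k x : ℝ) : ℂ),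
    ⟨fun k => √(β k), γ, fun k => isSignOf_of_dir hg (him k)
      ((h1 k).mono fun x hx => ⟨hx.1, hx.2.1⟩), Eventually.of_forall fun _ => rfl, ?_⟩, ?_⟩
  · intro k hk
    rw [← wL1_eq_of_im (him k)]
    exact h2 k fun h0 => hk (by simp [h0])
  · filter_upwards [ae_all_iff.2 fun i => ae_all_iff.2 fun j =>
      (eventually_imp_distrib_left.2 (hoff i j)), ae_all_iff.2 h1] with x hx hx'
    ext i j
    rw [Matrix.vecMulVec_apply, Pi.star_apply]
    by_cases hij : i = j
    · subst hij
      have h : G x i * star (G x i) = ((‖G x i‖ ^ 2 : ℝ) : ℂ) := by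
        push_cast; exact Complex.mul_conj' _
      rw [h, Matrix.diagonal_apply_eq, (hx' i).2.2, Real.sq_sqrt (hβ i), smul_eq_mul]
    · rw [hx i j hij, Matrix.diagonal_apply_ne _ hij]

lemma dir_complex (z : ℂ) : dir z = z / (‖z‖ : ℂ) := by
  rw [dir, Complex.real_smul, Complex.ofReal_inv, div_eq_inv_mul]

lemma exists_multiplier_entrywise (hg : g.Positive) (hf₁ : IsSpectralDensity f₁)
    {δ : Fin T → Fin T → ℝ} (hδ : ∀ i j, 0 < δ i j ∧ δ i j = δ j i)
    (hf₀ : f₀ ∈ (Nbhd.entrywise δ).densities g f₁) (hτ : IsCoercive (wdens g f₀) τ)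
    (hG : MemL2 (wdens g f₀) G)
    (hmax : ∀ f ∈ (Nbhd.entrywise δ).densities g f₁,
      normSq (wdens g f) G ≤ normSq (wdens g f₀) G) :
    ∃ M, (Nbhd.entrywise δ).IsMultiplier g f₁ f₀ M ∧
      ∀ᵐ x ∂circ, Matrix.vecMulVec (G x) (star (G x)) = M x := by
  rw [densities_entrywise] at hf₀ hmax
  have hherm := isHermitian_sub hf₀.1 hf₁
  have him := entry_im hherm
  have hentry : ∀ i j, ∃ (β : ℝ) (γ : ℝ → ℂ), 0 ≤ β ∧
      IsPhaseOf γ (fun x => (f₀ x - f₁ x) i j) ∧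
      (∀ᵐ x ∂circ, G x j * star (G x i) = β * γ x) ∧
      (β ≠ 0 → wL1 g (fun x => (f₀ x - f₁ x) i j) = δ i j) := by
    intro i j
    by_cases hij : i = j
    · -- On the diagonal only real perturbations are available.
      subst hij
      obtain ⟨β, γ, hβ, h1, h2⟩ := exists_multiplier_of_direction (V := ℝ) hg hf₀ hτ hG hmax
        (diagSingle i) (isHermitian_diagSingle i)
        (U := fun x => weight g x • ((f₀ x - f₁ x) i i).re)
        (integrable_weight_mul hg
          (integrable_linearMap_sub hf₀.1 hf₁ (Matrix.entryLinearMap ℝ ℂ i i)).re) (hδ i i).1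
        ((wL1_eq_of_im (him i)).trans_le (hf₀.2 (i, i)))
        (fun l => by
          by_cases hl : l = (i, i)
          · subst hl
            refine Or.inr ⟨rfl, ?_⟩
            filter_upwards [him i] with x hx ψ
            rw [Matrix.entryLinearMap_apply, Matrix.entryLinearMap_apply, diagSingle_apply,
              Matrix.single_apply_same]
            exact norm_smul_add_of_im hx _ _
          · refine Or.inl fun ψ => ?_
            rw [Matrix.entryLinearMap_apply, diagSingle_apply, Matrix.single_apply,
              if_neg (fun h => hl (Prod.ext h.1.symm h.2.symm))])
        (q := fun x => ‖G x i‖ ^ 2) ((hG.1 i).norm.pow 2) (fun x ψ => quad_diagSingle i x ψ)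
      refine ⟨β, fun x => (γ x : ℂ), hβ, ?_, ?_, fun h => ?_⟩
      · filter_upwards [h1, him i, ae_weight_pos g hg] with x hx hx' hw
        refine ⟨by rw [Complex.norm_real]; exact hx.1, fun h4 => ?_⟩
        have h5 : ((f₀ x - f₁ x) i i).re ≠ 0 := fun h6 => h4 (Complex.ext h6 hx')
        have h6 : (f₀ x - f₁ x) i i = (((f₀ x - f₁ x) i i).re : ℂ) :=
          Complex.ext rfl (by simpa using hx')
        rw [hx.2.1 (smul_ne_zero hw.ne' h5), dir_pos_smul hw, h6, Complex.norm_real,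
          Complex.ofReal_re, dir, smul_eq_mul]
        push_cast
        rw [div_eq_inv_mul]
      · filter_upwards [h1] with x hx
        have h : G x i * star (G x i) = ((‖G x i‖ ^ 2 : ℝ) : ℂ) := by
          push_cast; exact Complex.mul_conj' _
        rw [h, hx.2.2, smul_eq_mul, Complex.ofReal_mul]
      · rw [← wL1_eq_of_im (him i)]; exact h2 h
    · have hUeq : ∫ x, ‖weight g x • (f₀ x - f₁ x) i j‖ ∂circ
          = wL1 g (fun x => (f₀ x - f₁ x) i j) := by
        refine integral_congr_ae (Eventually.of_forall fun x => ?_)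
        simp only
        rw [norm_smul, Real.norm_of_nonneg (weight_nonneg g x)]
      obtain ⟨β, γ, hβ, h1, h2⟩ := exists_multiplier_of_direction (V := ℂ) hg hf₀ hτ hG hmax
        (hermSingle i j) (isHermitian_hermSingle i j)
        (U := fun x => weight g x • (f₀ x - f₁ x) i j)
        (integrable_weight_mul hg
          (integrable_linearMap_sub hf₀.1 hf₁ (Matrix.entryLinearMap ℝ ℂ i j))) (hδ i j).1
        (hUeq.trans_le (hf₀.2 (i, j)))
        (fun l => by
          by_cases hl : l = (i, j)
          · subst hl
            refine Or.inr ⟨rfl, Eventually.of_forall fun x ψ => ?_⟩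
            rw [Matrix.entryLinearMap_apply, Matrix.entryLinearMap_apply, hermSingle_apply,
              Matrix.add_apply, Matrix.single_apply_same, Matrix.single_apply,
              if_neg (fun h => hij h.2), add_zero]
          by_cases hl' : l = (j, i)
          · subst hl'
            refine Or.inr ⟨(hδ j i).2, ?_⟩
            filter_upwards [hherm] with x hx ψ
            rw [Matrix.entryLinearMap_apply, Matrix.entryLinearMap_apply, hermSingle_apply,
              Matrix.add_apply, Matrix.single_apply_same, Matrix.single_apply,
              if_neg (fun h => hij h.1), zero_add, ← hx.apply j i, ← norm_star]
            congr 1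
            simp
          · refine Or.inl fun ψ => ?_
            rw [Matrix.entryLinearMap_apply, hermSingle_apply, Matrix.add_apply,
              Matrix.single_apply, if_neg (fun h => hl (Prod.ext h.1.symm h.2.symm)),
              Matrix.single_apply, if_neg (fun h => hl' (Prod.ext h.1.symm h.2.symm)), add_zero])
        (q := fun x => 2 * star (G x i * star (G x j)))
        ((continuous_star.comp_aestronglyMeasurable (aesm_mul_star hG.1 i j)).const_mul _)
        (fun x ψ => quad_hermSingle_eq_inner i j ψ (G x))
      refine ⟨β / 2, γ, by positivity, ?_, ?_, fun h => ?_⟩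
      · filter_upwards [h1, ae_weight_pos g hg] with x hx hw
        refine ⟨hx.1, fun h4 => ?_⟩
        rw [hx.2.1 (smul_ne_zero hw.ne' h4), dir_pos_smul hw, dir_complex]
      · filter_upwards [h1] with x hx
        have h3 : 2 * star (G x i * star (G x j)) = β * γ x := by
          rw [← Complex.real_smul]; exact hx.2.2
        rw [star_mul', star_star] at h3
        push_cast
        linear_combination h3 / 2
      · rw [← hUeq]; exact h2 fun h0 => h (by rw [h0, zero_div])
  choose β γ hβ h1 h2 h3 using hentry
  refine ⟨fun x => (Matrix.of fun i j => (β i j : ℂ) * γ i j x)ᵀ,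
    ⟨β, γ, hβ, h1, Eventually.of_forall fun _ => rfl, h3⟩, ?_⟩
  filter_upwards [ae_all_iff.2 fun i => ae_all_iff.2 fun j => h2 i j] with x hx
  ext i j
  rw [Matrix.vecMulVec_apply, Matrix.transpose_apply, Matrix.of_apply]
  exact hx j i

/-- If the functional `f ↦ ∫ Gᵀ (w f) Ḡ` attains its maximum over the neighbourhood at `f₀`, then
`G G*` is a multiplier matrix. -/
theorem Nbhd.exists_multiplier (hg : g.Positive) (hf₁ : IsSpectralDensity f₁) (N : Nbhd T)
    (hN : N.Admissible) (hnd : N.NonDegenerate) (hf₀ : f₀ ∈ N.densities g f₁)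
    (hτ : IsCoercive (wdens g f₀) τ) (hG : MemL2 (wdens g f₀) G)
    (hmax : ∀ f ∈ N.densities g f₁, normSq (wdens g f) G ≤ normSq (wdens g f₀) G)
    (hG0 : ¬ ∀ᵐ x ∂circ, G x = 0) :
    ∃ M, N.IsMultiplier g f₁ f₀ M ∧
      ∀ᵐ x ∂circ, Matrix.vecMulVec (G x) (star (G x)) = M x := by
  cases N with
  | trace δ =>
    simp_rw [isMultiplier_trace_iff]
    rw [densities_trace] at hf₀ hmax
    exact exists_multiplier_weighted hg hf₁ Matrix.PosDef.one hnd hf₀ hτ hG hmax hG0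
  | diagonal δ => exact exists_multiplier_diagonal hg hf₁ hnd hf₀ hτ hG hmax
  | weighted B δ => exact exists_multiplier_weighted hg hf₁ hN hnd hf₀ hτ hG hmax hG0
  | entrywise δ => exact exists_multiplier_entrywise hg hf₁ hnd hf₀ hτ hG hmax

end Classes

/-! ### Sufficiency of the multiplier form -/

section Sufficiency

variable {T r : ℕ} {g : GMIndex r} {f f₀ f₁ M : ℝ → Matrix (Fin T) (Fin T) ℂ}
  {G : ℝ → Fin T → ℂ}

/-- Multiplier matrices are bounded, since their phases are. -/
lemma Nbhd.IsMultiplier.exists_bound {N : Nbhd T} (h : N.IsMultiplier g f₁ f₀ M) :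
    ∃ C : ℝ, 0 ≤ C ∧ ∀ᵐ x ∂circ, ∀ i, ‖M x i i‖ ≤ C := by
  have key : ∀ (B : Matrix (Fin T) (Fin T) ℂ) (δ : ℝ),
      (Nbhd.weighted B δ).IsMultiplier g f₁ f₀ M →
      ∃ C : ℝ, 0 ≤ C ∧ ∀ᵐ x ∂circ, ∀ i, ‖M x i i‖ ≤ C := by
    rintro B δ ⟨β, γ, h1, h2, -⟩
    refine ⟨∑ i, β ^ 2 * ‖B i i‖, by positivity, ?_⟩
    filter_upwards [h1, h2] with x hx hx' i
    refine le_trans ?_ (Finset.single_le_sum (f := fun i => β ^ 2 * ‖B i i‖)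
      (fun _ _ => by positivity) (Finset.mem_univ i))
    rw [hx', Matrix.smul_apply, Matrix.transpose_apply, norm_smul, Complex.norm_real, norm_mul,
      Real.norm_of_nonneg (sq_nonneg β), Real.norm_eq_abs]
    have := mul_le_of_le_one_right (sq_nonneg β) hx.1
    gcongr
  cases N with
  | trace δ => exact key 1 δ ((isMultiplier_trace_iff δ).1 h)
  | weighted B δ => exact key B δ h
  | diagonal δ =>
    obtain ⟨β, γ, h1, h2, -⟩ := h
    refine ⟨∑ i, β i ^ 2, by positivity, ?_⟩
    filter_upwards [ae_all_iff.2 h1, h2] with x hx hx' i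
    refine le_trans ?_ (Finset.single_le_sum (f := fun i => β i ^ 2)
      (fun _ _ => by positivity) (Finset.mem_univ i))
    rw [hx', Matrix.diagonal_apply_eq, Complex.norm_real, norm_mul,
      Real.norm_of_nonneg (sq_nonneg (β i)), Real.norm_eq_abs]
    exact mul_le_of_le_one_right (sq_nonneg (β i)) (hx i).1
  | entrywise δ =>
    obtain ⟨β, γ, h0, h1, h2, -⟩ := h
    refine ⟨∑ i, β i i, Finset.sum_nonneg fun i _ => h0 i i, ?_⟩
    filter_upwards [ae_all_iff.2 fun i => h1 i i, h2] with x hx hx' i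
    refine le_trans ?_ (Finset.single_le_sum (f := fun i => β i i)
      (fun i _ => h0 i i) (Finset.mem_univ i))
    rw [hx', Matrix.transpose_apply, Matrix.of_apply, norm_mul, Complex.norm_real,
      Real.norm_of_nonneg (h0 i i)]
    exact mul_le_of_le_one_right (h0 i i) (hx i).1

lemma norm_le_sqrt_of_vecMulVec {x : ℝ} {C : ℝ} (h : ∀ i, ‖M x i i‖ ≤ C)
    (hM : Matrix.vecMulVec (G x) (star (G x)) = M x) : ‖G x‖ ≤ √C := by
  refine (pi_norm_le_iff_of_nonneg (Real.sqrt_nonneg _)).2 fun i => Real.le_sqrt_of_sq_le ?_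
  have h1 := h i
  rwa [← hM, Matrix.vecMulVec_apply, Pi.star_apply, norm_mul, norm_star, ← sq] at h1

/-- A pointwise comparison by saturated constraints integrates to an inequality of errors. -/
lemma normSq_le_of_pointwise (hg : g.Positive) (hf₁ : IsSpectralDensity f₁) {K : Type*} [Fintype K]
    {Λ : K → Matrix (Fin T) (Fin T) ℂ →ₗ[ℝ] ℂ} {δ : K → ℝ} (hf₀ : f₀ ∈ nbhdOf g f₁ Λ δ)
    (hf : f ∈ nbhdOf g f₁ Λ δ) (hG : ∀ F, IsSpectralDensity F → MemL2 F G) {c : K → ℝ}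
    (hc : ∀ k, 0 ≤ c k) (hsat : ∀ k, c k ≠ 0 → wL1 g (fun x => Λ k (f₀ x - f₁ x)) = δ k)
    (hpt : ∀ᵐ x ∂circ, quad (f x - f₀ x) (G x)
      ≤ ∑ k, c k * (‖Λ k (f x - f₁ x)‖ - ‖Λ k (f₀ x - f₁ x)‖)) :
    normSq (wdens g f) G ≤ normSq (wdens g f₀) G := by
  have hF := isSpectralDensity_wdens hg hf.1
  have hF₀ := isSpectralDensity_wdens hg hf₀.1
  rw [normSq_eq_ofReal hF (hG _ hF), normSq_eq_ofReal hF₀ (hG _ hF₀)]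
  refine ENNReal.ofReal_le_ofReal (sub_nonpos.1 ?_)
  have hi : ∀ k, Integrable (fun x => weight g x • ‖Λ k (f x - f₁ x)‖) circ := fun k =>
    integrable_weight_mul hg (integrable_linearMap_sub hf.1 hf₁ (Λ k)).norm
  have hi₀ : ∀ k, Integrable (fun x => weight g x • ‖Λ k (f₀ x - f₁ x)‖) circ := fun k =>
    integrable_weight_mul hg (integrable_linearMap_sub hf₀.1 hf₁ (Λ k)).norm
  have hik : ∀ k, Integrable (fun x => c k *
      (weight g x • ‖Λ k (f x - f₁ x)‖ - weight g x • ‖Λ k (f₀ x - f₁ x)‖)) circ := fun k =>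
    ((hi k).sub (hi₀ k)).const_mul _
  calc nsq (wdens g f) G - nsq (wdens g f₀) G
      = ∫ x, (quad (wdens g f x) (G x) - quad (wdens g f₀ x) (G x)) ∂circ :=
        (integral_sub ((hG _ hF).integrable_quad hF) ((hG _ hF₀).integrable_quad hF₀)).symm
    _ ≤ ∫ x, ∑ k, c k *
          (weight g x • ‖Λ k (f x - f₁ x)‖ - weight g x • ‖Λ k (f₀ x - f₁ x)‖) ∂circ := by
        refine integral_mono_ae
          (((hG _ hF).integrable_quad hF).sub ((hG _ hF₀).integrable_quad hF₀))
          (integrable_finsetSum _ fun k _ => hik k) ?_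
        filter_upwards [hpt] with x hx
        have h1 : quad (f x) (G x) = quad (f x - f₀ x) (G x) + quad (f₀ x) (G x) := by
          rw [← quad_add_mat, sub_add_cancel]
        simp only [quad_wdens, h1, smul_eq_mul, ← mul_sub]
        rw [add_sub_cancel_right]
        refine (mul_le_mul_of_nonneg_left hx (weight_nonneg g x)).trans_eq ?_
        rw [Finset.mul_sum]
        exact Finset.sum_congr rfl fun k _ => by ring
    _ = ∑ k, c k * (wL1 g (fun x => Λ k (f x - f₁ x)) - wL1 g (fun x => Λ k (f₀ x - f₁ x))) := by
        rw [integral_finsetSum _ fun k _ => hik k]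
        refine Finset.sum_congr rfl fun k _ => ?_
        rw [integral_const_mul, integral_sub (hi k) (hi₀ k)]
        rfl
    _ ≤ 0 := by
        refine Finset.sum_nonpos fun k _ => ?_
        by_cases h : c k = 0
        · rw [h, zero_mul]
        · rw [hsat k h]
          exact mul_nonpos_of_nonneg_of_nonpos (hc k) (by linarith [hf.2 k])

/-- The subgradient inequality of the absolute value. -/
lemma sign_mul_sub_le {γ : ℝ} {a u : ℂ} (hu : u.im = 0)
    (hγ : |γ| ≤ 1) (h : u ≠ 0 → γ = Real.sign u.re) :
    γ * (a.re - u.re) ≤ ‖a‖ - ‖u‖ := by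
  have h1 : γ * a.re ≤ ‖a‖ := by
    refine (le_abs_self _).trans ?_
    rw [abs_mul]
    exact (mul_le_of_le_one_left (abs_nonneg _) hγ).trans (Complex.abs_re_le_norm a)
  have h2 : γ * u.re = ‖u‖ := by
    have h3 : ‖u‖ = |u.re| := (Complex.abs_re_eq_norm.2 hu).symm
    by_cases h0 : u = 0
    · simp [h0]
    · rw [h h0, h3]
      rcases lt_trichotomy u.re 0 with h4 | h4 | h4
      · rw [Real.sign_of_neg h4, abs_of_neg h4, neg_one_mul]
      · simp [h4]
      · rw [Real.sign_of_pos h4, abs_of_pos h4, one_mul]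
  linarith

lemma phase_mul_sub_le {γ a u : ℂ} (hγ : ‖γ‖ ≤ 1) (h : u ≠ 0 → γ = u / (‖u‖ : ℂ)) :
    (star (a - u) * γ).re ≤ ‖a‖ - ‖u‖ := by
  have h1 : (star a * γ).re ≤ ‖a‖ := by
    refine (Complex.re_le_norm _).trans ?_
    rw [norm_mul, norm_star]
    exact mul_le_of_le_one_right (norm_nonneg _) hγ
  have h2 : (star u * γ).re = ‖u‖ := by
    by_cases h0 : u = 0
    · simp [h0]
    · have h3 : (‖u‖ : ℂ) ≠ 0 := by simpa using h0
      have h4 : star u * u = (‖u‖ : ℂ) ^ 2 := Complex.conj_mul' u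
      rw [h h0, ← mul_div_assoc, h4, sq, mul_div_assoc, div_self h3, mul_one, Complex.ofReal_re]
  rw [star_sub, sub_mul, Complex.sub_re]
  linarith

lemma normSq_le_weighted (hg : g.Positive) (hf₁ : IsSpectralDensity f₁)
    {B : Matrix (Fin T) (Fin T) ℂ} (hB : B.IsHermitian) {δ : ℝ}
    (hf₀ : f₀ ∈ (Nbhd.weighted B δ).densities g f₁) (hf : f ∈ (Nbhd.weighted B δ).densities g f₁)
    (hG : ∀ F, IsSpectralDensity F → MemL2 F G)
    (hmul : (Nbhd.weighted B δ).IsMultiplier g f₁ f₀ M)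
    (hM : ∀ᵐ x ∂circ, Matrix.vecMulVec (G x) (star (G x)) = M x) :
    normSq (wdens g f) G ≤ normSq (wdens g f₀) G := by
  obtain ⟨β, γ, hγ, hMx, hsat⟩ := hmul
  rw [densities_weighted] at hf₀ hf
  refine normSq_le_of_pointwise hg hf₁ hf₀ hf hG (c := fun _ => β ^ 2) (fun _ => sq_nonneg β)
    (fun _ _ => hsat) ?_
  filter_upwards [hγ, hMx, hM, isHermitian_sub hf.1 hf₁, isHermitian_sub hf₀.1 hf₁]
    with x h1 h2 h3 h4 h5
  have hX : (f x - f₀ x).IsHermitian := by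
    have := h4.sub h5
    rwa [sub_sub_sub_cancel_right] at this
  have h6 : quad (f x - f₀ x) (G x) = β ^ 2 * (γ x * (matInner B (f x - f₀ x)).re) := by
    rw [quad_eq_re_sum, h3, h2, matInner, hX.eq, Matrix.trace_mul_comm, Matrix.trace,
      ← mul_assoc, ← Complex.re_ofReal_mul, Finset.mul_sum]
    congr 1
    refine Finset.sum_congr rfl fun i _ => ?_
    rw [Matrix.diag_apply, Matrix.mul_apply, Finset.mul_sum]
    refine Finset.sum_congr rfl fun j _ => ?_
    rw [Matrix.smul_apply, Matrix.transpose_apply, smul_eq_mul]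
    ring
  have h7 : matInner B (f x - f₀ x) = matInner B (f x - f₁ x) - matInner B (f₀ x - f₁ x) := by
    rw [← matInnerMap_apply, ← matInnerMap_apply, ← matInnerMap_apply, ← map_sub,
      sub_sub_sub_cancel_right]
  simp only [Finset.univ_unique, Finset.sum_singleton, matInnerMap_apply]
  rw [h6, h7, Complex.sub_re]
  exact mul_le_mul_of_nonneg_left
    (sign_mul_sub_le (matInner_im hB h5) h1.1 h1.2) (sq_nonneg β)

/-- If `G G*` is a multiplier matrix, then `f₀` maximizes the functional
`f ↦ ∫ Gᵀ (w f) Ḡ` over the neighbourhood. -/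
theorem Nbhd.IsMultiplier.normSq_le (hg : g.Positive) (hf₁ : IsSpectralDensity f₁) {N : Nbhd T}
    (hN : N.Admissible) (hf₀ : f₀ ∈ N.densities g f₁) (hf : f ∈ N.densities g f₁)
    (hG : ∀ F, IsSpectralDensity F → MemL2 F G) (hmul : N.IsMultiplier g f₁ f₀ M)
    (hM : ∀ᵐ x ∂circ, Matrix.vecMulVec (G x) (star (G x)) = M x) :
    normSq (wdens g f) G ≤ normSq (wdens g f₀) G := by
  cases N with
  | trace δ =>
    rw [densities_trace] at hf₀ hf
    exact normSq_le_weighted hg hf₁ Matrix.isHermitian_one hf₀ hf hG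
      ((isMultiplier_trace_iff δ).1 hmul) hM
  | weighted B δ => exact normSq_le_weighted hg hf₁ hN.1 hf₀ hf hG hmul hM
  | diagonal δ =>
    obtain ⟨β, γ, hγ, hMx, hsat⟩ := hmul
    rw [densities_diagonal] at hf₀ hf
    refine normSq_le_of_pointwise hg hf₁ hf₀ hf hG (c := fun k => β k ^ 2)
      (fun k => sq_nonneg (β k)) (fun k hk => hsat k fun h => hk (by simp [h])) ?_
    filter_upwards [ae_all_iff.2 hγ, hMx, hM,
      ae_all_iff.2 (entry_im (isHermitian_sub hf₀.1 hf₁))] with x h1 h2 h3 h4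
    have h5 : quad (f x - f₀ x) (G x) = ∑ k, β k ^ 2 * (γ k x * ((f x - f₀ x) k k).re) := by
      rw [quad_eq_re_sum, h3, h2, Complex.re_sum]
      refine Finset.sum_congr rfl fun k _ => ?_
      rw [Finset.sum_eq_single k]
      · rw [Matrix.diagonal_apply_eq, mul_comm, Complex.re_ofReal_mul, mul_assoc]
      · intro j _ hj
        rw [Matrix.diagonal_apply_ne _ hj.symm, mul_zero]
      · simp
    rw [h5]
    refine Finset.sum_le_sum fun k _ => mul_le_mul_of_nonneg_left ?_ (sq_nonneg (β k))
    have h6 : ((f x - f₀ x) k k).re = ((f x - f₁ x) k k).re - ((f₀ x - f₁ x) k k).re := by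
      simp only [Matrix.sub_apply, Complex.sub_re]; ring
    rw [h6, Matrix.entryLinearMap_apply, Matrix.entryLinearMap_apply]
    exact sign_mul_sub_le (h4 k) (h1 k).1 (h1 k).2
  | entrywise δ =>
    obtain ⟨β, γ, hβ, hγ, hMx, hsat⟩ := hmul
    rw [densities_entrywise] at hf₀ hf
    refine normSq_le_of_pointwise hg hf₁ hf₀ hf hG (c := fun k => β k.1 k.2)
      (fun k => hβ k.1 k.2) (fun k hk => hsat k.1 k.2 hk) ?_
    filter_upwards [ae_all_iff.2 fun i => ae_all_iff.2 fun j => hγ i j, hMx, hM,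
      isHermitian_sub hf.1 hf₁, isHermitian_sub hf₀.1 hf₁] with x h1 h2 h3 h4 h5
    have hX : (f x - f₀ x).IsHermitian := by
      have := h4.sub h5
      rwa [sub_sub_sub_cancel_right] at this
    have h6 : quad (f x - f₀ x) (G x)
        = ∑ k : Fin T × Fin T, β k.1 k.2 * (star ((f x - f₀ x) k.1 k.2) * γ k.1 k.2 x).re := by
      rw [quad_eq_re_sum, h3, h2, Finset.sum_comm, ← Fintype.sum_prod_type', Complex.re_sum]
      refine Finset.sum_congr rfl fun k _ => ?_
      rw [Matrix.transpose_apply, Matrix.of_apply, hX.apply, ← Complex.re_ofReal_mul]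
      congr 1
      ring
    rw [h6]
    refine Finset.sum_le_sum fun k _ => mul_le_mul_of_nonneg_left ?_ (hβ k.1 k.2)
    have h7 : (f x - f₀ x) k.1 k.2 = (f x - f₁ x) k.1 k.2 - (f₀ x - f₁ x) k.1 k.2 := by
      simp only [Matrix.sub_apply]; ring
    rw [h7, Matrix.entryLinearMap_apply, Matrix.entryLinearMap_apply]
    exact phase_mul_sub_le (h1 k.1 k.2).1 (h1 k.1 k.2).2

end Sufficiency

/-! ### Fejér means -/

section Fejer

lemma measurePreserving_circ [Fact (0 < 2 * Real.pi)] :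
    MeasurePreserving (fun x : ℝ => (x : AddCircle (2 * Real.pi))) circ
      AddCircle.haarAddCircle := by
  have h := (AddCircle.measurePreserving_mk (2 * Real.pi) (-Real.pi)).smul_measure
    (ENNReal.ofReal (2 * Real.pi))⁻¹
  have h1 : -Real.pi + 2 * Real.pi = Real.pi := by ring
  have h0 : ENNReal.ofReal (2 * Real.pi) ≠ 0 := by simp [Real.pi_pos]
  rw [h1, AddCircle.volume_eq_smul_haarAddCircle, smul_smul,
    ENNReal.inv_mul_cancel h0 ENNReal.ofReal_ne_top, one_smul] at h
  exact h

lemma fourier_coe_eq_cis (n : ℤ) (x : ℝ) :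
    fourier n (x : AddCircle (2 * Real.pi)) = cis n x := by
  rw [fourier_coe_apply, cis]
  congr 1
  have : (Real.pi : ℂ) ≠ 0 := by exact_mod_cast Real.pi_ne_zero
  push_cast
  field_simp

/-- Trigonometric polynomials are dense in `L₁`. -/
lemma exists_trigPoly_near {u : ℝ → ℂ} (hu : Integrable u circ) {ε : ℝ} (hε : 0 < ε) :
    ∃ p ∈ Submodule.span ℂ (Set.range cis), ∫ x, ‖u x - p x‖ ∂circ ≤ ε := by
  have hT : Fact (0 < 2 * Real.pi) := ⟨Real.two_pi_pos⟩
  have hmp := measurePreserving_circ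
  have h1 : -Real.pi + 2 * Real.pi = Real.pi := by ring
  have h0 : ENNReal.ofReal (2 * Real.pi) ≠ 0 := by simp [Real.pi_pos]
  have hres : volume.restrict (Set.Ioc (-Real.pi) (-Real.pi + 2 * Real.pi))
      = ENNReal.ofReal (2 * Real.pi) • circ := by
    rw [circ, smul_smul, ENNReal.mul_inv_cancel h0 ENNReal.ofReal_ne_top, one_smul, h1]
  have hu1 : MemLp u 1 (volume.restrict (Set.Ioc (-Real.pi) (-Real.pi + 2 * Real.pi))) := by
    rw [hres]
    exact (memLp_one_iff_integrable.2 hu).smul_measure ENNReal.ofReal_ne_top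
  have hU := hu1.memLp_liftIoc.haarAddCircle
  have hcl : hU.toLp ∈ closure
      (Submodule.span ℂ (Set.range (@fourierLp (2 * Real.pi) _ 1 _)) : Set _) := by
    rw [← Submodule.topologicalClosure_coe, span_fourierLp_closure_eq_top ENNReal.one_ne_top]
    trivial
  obtain ⟨q, hq, hd⟩ := Metric.mem_closure_iff.1 hcl ε hε
  have hspan : ∃ q' : AddCircle (2 * Real.pi) → ℂ, q =ᵐ[AddCircle.haarAddCircle] q' ∧
      (fun x : ℝ => q' x) ∈ Submodule.span ℂ (Set.range cis) := by
    refine Submodule.span_induction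
      (p := fun (q : Lp ℂ 1 (@AddCircle.haarAddCircle (2 * Real.pi) _)) _ =>
      ∃ q' : AddCircle (2 * Real.pi) → ℂ, q =ᵐ[AddCircle.haarAddCircle] q' ∧
      (fun x : ℝ => q' x) ∈ Submodule.span ℂ (Set.range cis)) ?_ ?_ ?_ ?_ hq
    · rintro _ ⟨n, rfl⟩
      refine ⟨fourier n, coeFn_fourierLp 1 n, Submodule.subset_span ⟨n, ?_⟩⟩
      exact funext fun x => (fourier_coe_eq_cis n x).symm
    · exact ⟨fun _ => 0, Lp.coeFn_zero _ _ _, Submodule.zero_mem _⟩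
    · rintro a b _ _ ⟨a', ha, ha'⟩ ⟨b', hb, hb'⟩
      exact ⟨fun x => a' x + b' x, (Lp.coeFn_add a b).trans (ha.add hb),
        Submodule.add_mem _ ha' hb'⟩
    · rintro z a _ ⟨a', ha, ha'⟩
      exact ⟨fun x => z • a' x, (Lp.coeFn_smul z a).trans (ha.const_smul z),
        Submodule.smul_mem _ z ha'⟩
  obtain ⟨q', hqq', hq'⟩ := hspan
  refine ⟨_, hq', ?_⟩
  have h2 : (fun x : ℝ => ‖u x - q' x‖) =ᵐ[circ]
      fun x : ℝ => ‖(hU.toLp - q : Lp ℂ 1 AddCircle.haarAddCircle)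
        (x : AddCircle (2 * Real.pi))‖ := by
    have h3 := hmp.quasiMeasurePreserving.ae
      ((Lp.coeFn_sub hU.toLp q).and (hU.coeFn_toLp.and hqq'))
    filter_upwards [h3, ae_circ_mem] with x hx hmem
    rw [hx.1, Pi.sub_apply, hx.2.1, hx.2.2, AddCircle.liftIoc_coe_apply (by rwa [h1])]
  rw [integral_congr_ae h2]
  have h4 : ∫ x : ℝ, ‖(hU.toLp - q : Lp ℂ 1 AddCircle.haarAddCircle)
      (x : AddCircle (2 * Real.pi))‖ ∂circ
      = ∫ y, ‖(hU.toLp - q : Lp ℂ 1 AddCircle.haarAddCircle) y‖ ∂AddCircle.haarAddCircle := by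
    have hmap : ∀ v : AddCircle (2 * Real.pi) → ℝ,
        AEStronglyMeasurable v AddCircle.haarAddCircle →
        ∫ x : ℝ, v x ∂circ = ∫ y, v y ∂AddCircle.haarAddCircle := by
      intro v hv
      rw [← hmp.map_eq] at hv ⊢
      exact (integral_map hmp.aemeasurable hv).symm
    exact hmap _ (Lp.aestronglyMeasurable _).norm
  rw [h4, ← L1.norm_eq_integral_norm, ← dist_eq_norm]
  exact hd.le

/-- The `N`-th Fejér mean of the Fourier series of `u`. -/
noncomputable def fejer (u : ℝ → ℂ) (N : ℕ) (x : ℝ) : ℂ :=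
  ((N : ℂ) + 1)⁻¹ * ∑ j ∈ Finset.range (N + 1), ∑ k ∈ Finset.range (N + 1),
    cis ((j : ℤ) - k) x * ∫ t, cis ((k : ℤ) - j) t * u t ∂circ

/-- The Fejér kernel. -/
noncomputable def fejerKernel (N : ℕ) (x t : ℝ) : ℝ :=
  ((N : ℝ) + 1)⁻¹ * ‖∑ k ∈ Finset.range (N + 1), cis k x * cis (-k) t‖ ^ 2

lemma fejerKernel_nonneg (N : ℕ) (x t : ℝ) : 0 ≤ fejerKernel N x t := by
  unfold fejerKernel; positivity

lemma fejerKernel_eq (N : ℕ) (x t : ℝ) : (fejerKernel N x t : ℂ) =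
    ((N : ℂ) + 1)⁻¹ * ∑ j ∈ Finset.range (N + 1), ∑ k ∈ Finset.range (N + 1),
      cis ((j : ℤ) - k) x * cis ((k : ℤ) - j) t := by
  rw [fejerKernel]
  push_cast
  rw [← Complex.mul_conj', map_sum, Finset.sum_mul_sum]
  congr 1
  refine Finset.sum_congr rfl fun j _ => Finset.sum_congr rfl fun k _ => ?_
  have h1 : (starRingEnd ℂ) (cis k x * cis (-k) t) = cis (-k) x * cis k t := by
    rw [map_mul]
    change star (cis k x) * star (cis (-k) t) = _
    rw [star_cis, star_cis, neg_neg]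
  rw [h1, sub_eq_add_neg, sub_eq_add_neg, cis_add, cis_add]
  ring

lemma fejer_eq_integral {u : ℝ → ℂ} (hu : Integrable u circ) (N : ℕ) (x : ℝ) :
    fejer u N x = ∫ t, (fejerKernel N x t : ℂ) * u t ∂circ := by
  simp_rw [fejerKernel_eq, mul_assoc, Finset.sum_mul]
  rw [integral_const_mul, integral_finsetSum _ fun j _ => integrable_finsetSum _ fun k _ => by
    simp_rw [mul_assoc]; exact (integrable_cis_mul hu _).const_mul _]
  rw [fejer]
  congr 1
  refine Finset.sum_congr rfl fun j _ => ?_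
  rw [integral_finsetSum _ fun k _ => by
    simp_rw [mul_assoc]; exact (integrable_cis_mul hu _).const_mul _]
  refine Finset.sum_congr rfl fun k _ => ?_
  simp_rw [mul_assoc]
  rw [integral_const_mul]

lemma continuous_fejerKernel (N : ℕ) (x : ℝ) : Continuous fun t => fejerKernel N x t := by
  unfold fejerKernel
  have := continuous_cis
  fun_prop

lemma continuous_fejer (u : ℝ → ℂ) (N : ℕ) : Continuous (fejer u N) := by
  unfold fejer
  have := continuous_cis
  fun_prop

lemma exists_fejer_bound (u : ℝ → ℂ) (N : ℕ) : ∃ K, ∀ x, ‖fejer u N x‖ ≤ K := by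
  refine ⟨‖((N : ℂ) + 1)⁻¹‖ * ∑ j ∈ Finset.range (N + 1), ∑ k ∈ Finset.range (N + 1),
    ‖∫ t, cis ((k : ℤ) - j) t * u t ∂circ‖, fun x => ?_⟩
  rw [fejer, norm_mul]
  refine mul_le_mul_of_nonneg_left ((norm_sum_le _ _).trans (Finset.sum_le_sum fun j _ =>
    (norm_sum_le _ _).trans (Finset.sum_le_sum fun k _ => ?_))) (norm_nonneg _)
  rw [norm_mul, norm_cis, one_mul]

lemma integrable_fejer (u : ℝ → ℂ) (N : ℕ) : Integrable (fejer u N) circ := by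
  obtain ⟨K, hK⟩ := exists_fejer_bound u N
  exact Integrable.of_bound (continuous_fejer u N).aestronglyMeasurable K (Eventually.of_forall hK)

lemma integral_fejer (u : ℝ → ℂ) (N : ℕ) : ∫ x, fejer u N x ∂circ = ∫ x, u x ∂circ := by
  simp_rw [fejer]
  rw [integral_const_mul, integral_finsetSum _ fun j _ => integrable_finsetSum _ fun k _ =>
    (integrable_cis _).mul_const _]
  have h : ∀ j ∈ Finset.range (N + 1), ∫ x, ∑ k ∈ Finset.range (N + 1),
      cis ((j : ℤ) - k) x * ∫ t, cis ((k : ℤ) - j) t * u t ∂circ ∂circ = ∫ x, u x ∂circ := by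
    intro j hj
    rw [integral_finsetSum _ fun k _ => (integrable_cis _).mul_const _,
      Finset.sum_eq_single_of_mem j hj]
    · rw [integral_mul_const, integral_cis, if_pos (sub_self _), one_mul, sub_self]
      simp [cis_zero]
    · intro k _ hk
      rw [integral_mul_const, integral_cis, if_neg (by omega), zero_mul]
  rw [Finset.sum_congr rfl h, Finset.sum_const, Finset.card_range, nsmul_eq_mul, ← mul_assoc]
  have : ((N : ℂ) + 1) ≠ 0 := by exact_mod_cast Nat.succ_ne_zero N
  push_cast
  rw [inv_mul_cancel₀ this, one_mul]

lemma integral_fejerKernel (N : ℕ) (x : ℝ) : ∫ t, fejerKernel N x t ∂circ = 1 := by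
  have hsymm : ∀ t, (fejerKernel N x t : ℂ) = fejerKernel N t x := by
    intro t
    rw [fejerKernel_eq, fejerKernel_eq, Finset.sum_comm]
    simp_rw [mul_comm]
  have h := fejer_eq_integral (integrable_const (μ := circ) (1 : ℂ)) N x
  have h1 : fejer (fun _ => (1 : ℂ)) N x = 1 := by
    have h2 : ∀ j ∈ Finset.range (N + 1), ∑ k ∈ Finset.range (N + 1),
        cis ((j : ℤ) - k) x * ∫ t, cis ((k : ℤ) - j) t * 1 ∂circ = 1 := by
      intro j hj
      rw [Finset.sum_eq_single_of_mem j hj]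
      · simp_rw [mul_one]
        rw [integral_cis, if_pos (sub_self _), sub_self, cis_zero, one_mul]
      · intro k _ hk
        simp_rw [mul_one]
        rw [integral_cis, if_neg (by omega), mul_zero]
    have : ((N : ℂ) + 1) ≠ 0 := by exact_mod_cast Nat.succ_ne_zero N
    rw [fejer, Finset.sum_congr rfl h2, Finset.sum_const, Finset.card_range, nsmul_eq_mul, mul_one]
    push_cast
    exact inv_mul_cancel₀ this
  simp_rw [mul_one] at h
  rw [h1, integral_complex_ofReal] at h
  exact_mod_cast h.symm

lemma integrable_fejerKernel_mul {u : ℝ → ℂ} (hu : Integrable u circ) (N : ℕ) (x : ℝ) :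
    Integrable (fun t => fejerKernel N x t * ‖u t‖) circ := by
  refine hu.norm.bdd_mul (c := ((N : ℝ) + 1)⁻¹ * ((N : ℝ) + 1) ^ 2)
    (continuous_fejerKernel N x).aestronglyMeasurable (Eventually.of_forall fun t => ?_)
  rw [Real.norm_of_nonneg (fejerKernel_nonneg _ _ _), fejerKernel]
  gcongr
  refine (norm_sum_le _ _).trans_eq ?_
  simp [norm_cis]

lemma norm_fejer_le {u : ℝ → ℂ} (hu : Integrable u circ) (N : ℕ) (x : ℝ) :
    ‖fejer u N x‖ ≤ ∫ t, fejerKernel N x t * ‖u t‖ ∂circ := by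
  rw [fejer_eq_integral hu]
  refine (norm_integral_le_integral_norm _).trans_eq (integral_congr_ae (Eventually.of_forall ?_))
  intro t
  simp only [norm_mul, Complex.norm_real, Real.norm_of_nonneg (fejerKernel_nonneg _ _ _)]

lemma norm_fejer_le_of_bounded {u : ℝ → ℂ} (hu : Integrable u circ) {K : ℝ}
    (hK : ∀ᵐ x ∂circ, ‖u x‖ ≤ K) (N : ℕ) (x : ℝ) : ‖fejer u N x‖ ≤ K := by
  have hint : Integrable (fun t => fejerKernel N x t) circ := by
    by_contra h
    simpa [integral_undef h] using integral_fejerKernel N x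
  refine (norm_fejer_le hu N x).trans ?_
  calc _ ≤ ∫ t, fejerKernel N x t * K ∂circ := by
        refine integral_mono_ae (integrable_fejerKernel_mul hu N x) (hint.mul_const _) ?_
        filter_upwards [hK] with t ht using mul_le_mul_of_nonneg_left ht (fejerKernel_nonneg _ _ _)
    _ = K := by rw [integral_mul_const, integral_fejerKernel, one_mul]

/-- Fejér means are contractions of `L₁`: `|σ u| ≤ σ |u|`, and `σ` preserves the mean. -/
lemma integral_norm_fejer_le {u : ℝ → ℂ} (hu : Integrable u circ) (N : ℕ) :
    ∫ x, ‖fejer u N x‖ ∂circ ≤ ∫ x, ‖u x‖ ∂circ := by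
  have hn : Integrable (fun x => (‖u x‖ : ℂ)) circ := hu.norm.ofReal
  have h1 : ∀ x, ((∫ t, fejerKernel N x t * ‖u t‖ ∂circ : ℝ) : ℂ)
      = fejer (fun t => (‖u t‖ : ℂ)) N x := by
    intro x
    rw [fejer_eq_integral hn, ← integral_complex_ofReal]
    push_cast
    rfl
  have h2 : ∀ x, ‖fejer u N x‖ ≤ (fejer (fun t => (‖u t‖ : ℂ)) N x).re := by
    intro x
    rw [← h1, Complex.ofReal_re]
    exact norm_fejer_le hu N x
  refine (integral_mono (integrable_fejer u N).norm (integrable_fejer _ N).re h2).trans_eq ?_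
  have h3 := integral_fejer (fun t => (‖u t‖ : ℂ)) N
  rw [integral_complex_ofReal] at h3
  have h4 := integral_re (integrable_fejer (fun t => (‖u t‖ : ℂ)) N)
  exact h4.trans (by rw [h3]; exact Complex.ofReal_re _)

lemma fejer_add {u v : ℝ → ℂ} (hu : Integrable u circ) (hv : Integrable v circ) (N : ℕ) (x : ℝ) :
    fejer (fun t => u t + v t) N x = fejer u N x + fejer v N x := by
  simp_rw [fejer, mul_add]
  rw [← mul_add, ← Finset.sum_add_distrib]
  congr 1
  refine Finset.sum_congr rfl fun j _ => ?_
  rw [← Finset.sum_add_distrib]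
  refine Finset.sum_congr rfl fun k _ => ?_
  rw [integral_add (integrable_cis_mul hu _) (integrable_cis_mul hv _), mul_add]

lemma fejer_smul (z : ℂ) (u : ℝ → ℂ) (N : ℕ) (x : ℝ) :
    fejer (fun t => z * u t) N x = z * fejer u N x := by
  simp_rw [fejer, mul_left_comm _ z, integral_const_mul, mul_left_comm _ z, ← Finset.mul_sum]
  ring

/-- Among the `N + 1` partial sums averaged by the Fejér mean, only a number bounded independently
of `N` omit the frequency `m`. -/
lemma tendsto_fejer_cis (m : ℤ) :
    Tendsto (fun N => ∫ x, ‖fejer (cis m) N x - cis m x‖ ∂circ) atTop (𝓝 0) := by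
  have hle : ∀ N x, ‖fejer (cis m) N x - cis m x‖ ≤ 2 * m.natAbs * ((N : ℝ) + 1)⁻¹ := by
    intro N x
    have hN : ((N : ℂ) + 1) ≠ 0 := by exact_mod_cast Nat.succ_ne_zero N
    set S := (Finset.range (N + 1)).filter fun k : ℕ => ¬ (0 ≤ (k : ℤ) + m ∧ (k : ℤ) + m ≤ N)
      with hS
    have h1 : fejer (cis m) N x = ((N : ℂ) + 1)⁻¹ * ∑ k ∈ Finset.range (N + 1),
        if 0 ≤ (k : ℤ) + m ∧ (k : ℤ) + m ≤ N then cis m x else 0 := by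
      rw [fejer, Finset.sum_comm]
      congr 1
      refine Finset.sum_congr rfl fun k _ => ?_
      simp_rw [← cis_add, integral_cis]
      split_ifs with h
      · rw [Finset.sum_eq_single_of_mem ((k : ℤ) + m).toNat
          (by rw [Finset.mem_range]; omega)]
        · rw [if_pos (by omega), mul_one]
          congr 1
          omega
        · intro j _ hj
          rw [if_neg (by omega), mul_zero]
      · refine Finset.sum_eq_zero fun j hj => ?_
        rw [Finset.mem_range] at hj
        rw [if_neg (by omega), mul_zero]
    have h2 : fejer (cis m) N x - cis m x = ((N : ℂ) + 1)⁻¹ * ∑ k ∈ S, -cis m x := by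
      have h3 : cis m x = ((N : ℂ) + 1)⁻¹ * ∑ k ∈ Finset.range (N + 1), cis m x := by
        rw [Finset.sum_const, Finset.card_range, nsmul_eq_mul]
        push_cast
        rw [inv_mul_cancel_left₀ hN]
      rw [h1]
      nth_rewrite 2 [h3]
      rw [← mul_sub, ← Finset.sum_sub_distrib, hS, Finset.sum_filter]
      congr 1
      refine Finset.sum_congr rfl fun k _ => ?_
      split_ifs with h4
      · rw [sub_self]
      · rw [zero_sub]
    have hcard : S.card ≤ 2 * m.natAbs := by
      have hsub : S ⊆ Finset.range m.natAbs ∪ Finset.Ioc (N - m.natAbs) N := by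
        intro k hk
        simp only [hS, Finset.mem_filter, Finset.mem_range, Finset.mem_union, Finset.mem_Ioc]
          at hk ⊢
        omega
      refine (Finset.card_le_card hsub).trans ((Finset.card_union_le _ _).trans ?_)
      rw [Finset.card_range, Nat.card_Ioc]
      omega
    rw [h2, norm_mul, mul_comm, norm_inv]
    have h5 : ‖(N : ℂ) + 1‖ = (N : ℝ) + 1 := by
      rw [← Nat.cast_succ, Complex.norm_natCast]; push_cast; ring
    rw [h5]
    refine mul_le_mul_of_nonneg_right ((norm_sum_le _ _).trans ?_) (by positivity)
    simp only [norm_neg, norm_cis, Finset.sum_const, nsmul_eq_mul, mul_one]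
    exact_mod_cast hcard
  have hlim : Tendsto (fun N : ℕ => 2 * m.natAbs * ((N : ℝ) + 1)⁻¹) atTop (𝓝 0) := by
    simpa using (tendsto_one_div_add_atTop_nhds_zero_nat (𝕜 := ℝ)).const_mul (2 * m.natAbs : ℝ)
  refine squeeze_zero (fun N => integral_nonneg fun x => norm_nonneg _) (fun N => ?_) hlim
  calc _ ≤ ∫ _x, 2 * m.natAbs * ((N : ℝ) + 1)⁻¹ ∂circ :=
        integral_mono ((integrable_fejer _ N).sub (integrable_cis m)).norm (integrable_const _)
          (hle N)
    _ = _ := by simp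

lemma tendsto_fejer_trigPoly {p : ℝ → ℂ} (hp : p ∈ Submodule.span ℂ (Set.range cis)) :
    Integrable p circ ∧ Tendsto (fun N => ∫ x, ‖fejer p N x - p x‖ ∂circ) atTop (𝓝 0) := by
  refine Submodule.span_induction (p := fun p _ => Integrable p circ ∧
    Tendsto (fun N => ∫ x, ‖fejer p N x - p x‖ ∂circ) atTop (𝓝 0)) ?_ ?_ ?_ ?_ hp
  · rintro _ ⟨m, rfl⟩
    exact ⟨integrable_cis m, tendsto_fejer_cis m⟩
  · refine ⟨integrable_zero _ _ _, ?_⟩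
    simp [fejer]
  · rintro u v _ _ ⟨hu, hu'⟩ ⟨hv, hv'⟩
    refine ⟨hu.add hv, squeeze_zero (fun N => integral_nonneg fun x => norm_nonneg _) (fun N => ?_)
      (by simpa using hu'.add hv')⟩
    have h1 := ((integrable_fejer u N).sub hu).norm
    have h2 := ((integrable_fejer v N).sub hv).norm
    refine (integral_mono ((integrable_fejer _ N).sub (hu.add hv)).norm (h1.add h2)
      fun x => ?_).trans_eq (integral_add h1 h2)
    have h3 := fejer_add hu hv N x
    change ‖fejer (fun t => u t + v t) N x - (u x + v x)‖
      ≤ ‖fejer u N x - u x‖ + ‖fejer v N x - v x‖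
    rw [h3, add_sub_add_comm]
    exact norm_add_le _ _
  · rintro z u _ ⟨hu, hu'⟩
    refine ⟨hu.smul z, ?_⟩
    have h1 : ∀ N, ∫ x, ‖fejer (z • u) N x - (z • u) x‖ ∂circ
        = ‖z‖ * ∫ x, ‖fejer u N x - u x‖ ∂circ := by
      intro N
      rw [← integral_const_mul]
      refine integral_congr_ae (Eventually.of_forall fun x => ?_)
      have h3 := fejer_smul z u N x
      change ‖fejer (fun t => z * u t) N x - z * u x‖ = _
      rw [h3, ← mul_sub, norm_mul]
    simp_rw [h1]
    simpa using hu'.const_mul ‖z‖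

/-- Fejér's theorem in `L₁`. -/
lemma tendsto_fejer {u : ℝ → ℂ} (hu : Integrable u circ) :
    Tendsto (fun N => ∫ x, ‖fejer u N x - u x‖ ∂circ) atTop (𝓝 0) := by
  rw [Metric.tendsto_atTop]
  intro ε hε
  obtain ⟨p, hp, hpu⟩ := exists_trigPoly_near hu (ε := ε / 4) (by positivity)
  obtain ⟨hpi, hlim⟩ := tendsto_fejer_trigPoly hp
  obtain ⟨N₀, hN₀⟩ := (Metric.tendsto_atTop.1 hlim) (ε / 4) (by positivity)
  refine ⟨N₀, fun N hN => ?_⟩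
  have h1 := hN₀ N hN
  rw [Real.dist_eq, sub_zero, abs_of_nonneg (integral_nonneg fun x => norm_nonneg _)] at h1 ⊢
  have hd : Integrable (fun x => u x - p x) circ := hu.sub hpi
  have h2 := integral_norm_fejer_le hd N
  have h3 : ∀ x, fejer u N x = fejer (fun x => u x - p x) N x + fejer p N x := by
    intro x
    rw [← fejer_add hd hpi]
    simp
  have i1 := (integrable_fejer (fun x => u x - p x) N).norm
  have i2 : Integrable (fun x => ‖fejer p N x - p x‖) circ :=
    ((integrable_fejer p N).sub hpi).norm
  have i3 := hd.norm
  have h4 : ∫ x, ‖fejer u N x - u x‖ ∂circ ≤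
      ∫ x, (‖fejer (fun x => u x - p x) N x‖ + ‖fejer p N x - p x‖ + ‖u x - p x‖) ∂circ := by
    refine integral_mono ((integrable_fejer u N).sub hu).norm ((i1.add i2).add i3) fun x => ?_
    have h5 : fejer u N x - u x = fejer (fun x => u x - p x) N x + (fejer p N x - p x)
        - (u x - p x) := by rw [h3]; ring
    change ‖fejer u N x - u x‖ ≤ _
    rw [h5]
    exact (norm_sub_le _ _).trans (add_le_add_left (norm_add_le _ _) _)
  have h6 : ∫ x, (‖fejer (fun x => u x - p x) N x‖ + ‖fejer p N x - p x‖ + ‖u x - p x‖) ∂circ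
      = ∫ x, ‖fejer (fun x => u x - p x) N x‖ ∂circ + ∫ x, ‖fejer p N x - p x‖ ∂circ
        + ∫ x, ‖u x - p x‖ ∂circ := by
    rw [integral_add (f := fun x => ‖fejer (fun x => u x - p x) N x‖ + ‖fejer p N x - p x‖)
      (i1.add i2) i3, integral_add i1 i2]
  linarith

/-- An integrable function is determined by its Fourier coefficients. -/
lemma ae_eq_zero_of_coeff {u : ℝ → ℂ} (hu : Integrable u circ)
    (h : ∀ k : ℤ, ∫ x, cis k x * u x ∂circ = 0) : ∀ᵐ x ∂circ, u x = 0 := by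
  have h1 := tendsto_fejer hu
  have h2 : ∀ N x, fejer u N x = 0 := fun N x => by simp [fejer, h]
  simp_rw [h2, zero_sub, norm_neg] at h1
  have h3 := tendsto_nhds_unique h1 tendsto_const_nhds
  rw [eq_comm, integral_eq_zero_iff_of_nonneg (fun _ => norm_nonneg _) hu.norm] at h3
  filter_upwards [h3] with x hx using norm_eq_zero.1 hx

/-- A bounded function without nonnegative Fourier coefficients belongs to the past of every
spectral density: its Fejér means are bounded and converge almost everywhere along a subsequence. -/
lemma mem_negPast_of_bounded {T : ℕ} {F : ℝ → Matrix (Fin T) (Fin T) ℂ} (hF : IsSpectralDensity F)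
    {u : ℝ → Fin T → ℂ} (hu : ∀ p, AEStronglyMeasurable (fun x => u x p) circ) {K : ℝ}
    (hK : ∀ᵐ x ∂circ, ‖u x‖ ≤ K)
    (h : ∀ (k : ℕ) p, ∫ x, cis (-(k : ℤ)) x * u x p ∂circ = 0) : u ∈ NegPast F := by
  have hKp : ∀ p, ∀ᵐ x ∂circ, ‖u x p‖ ≤ K := fun p =>
    hK.mono fun x hx => (norm_le_pi_norm (u x) p).trans hx
  have hup : ∀ p, Integrable (fun x => u x p) circ := fun p => Integrable.of_bound (hu p) K (hKp p)
  set w : ℕ → ℝ → Fin T → ℂ := fun N x p => fejer (fun t => u t p) N x with hw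
  have hwneg : ∀ N, IsNegPoly (w N) := by
    intro N
    have h1 : w N = fun x => ((N : ℂ) + 1)⁻¹ • ∑ j ∈ Finset.range (N + 1),
        ∑ k ∈ Finset.range (N + 1), cis ((j : ℤ) - k) x •
          fun p => ∫ t, cis ((k : ℤ) - j) t * u t p ∂circ := by
      funext x p
      simp [hw, fejer, Finset.sum_apply]
    rw [h1]
    refine IsNegPoly.smul (IsNegPoly.sum _ fun j _ => IsNegPoly.sum _ fun k _ => ?_) _
    by_cases hjk : j < k
    · have := isNegPoly_cis (k - j - 1) fun p => ∫ t, cis ((k : ℤ) - j) t * u t p ∂circ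
      have h2 : -(((k - j - 1 : ℕ) : ℤ) + 1) = (j : ℤ) - k := by omega
      rwa [h2] at this
    · have h2 : (k : ℤ) - j = -((j - k : ℕ) : ℤ) := by omega
      have h3 : (fun p => ∫ t, cis ((k : ℤ) - j) t * u t p ∂circ) = 0 := by
        funext p
        rw [h2, h]
        rfl
      rw [h3]
      simpa using isNegPoly_zero
  have hum := memL2_of_bounded hF hu hK
  refine ⟨hum, fun ε hε => ?_⟩
  have hsum : Tendsto (fun N => ∑ p, ∫ x, ‖w N x p - u x p‖ ∂circ) atTop (𝓝 0) := by
    simpa using tendsto_finsetSum Finset.univ fun p _ => tendsto_fejer (hup p)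
  have hmeas : TendstoInMeasure circ w atTop u := by
    refine tendstoInMeasure_of_tendsto_eLpNorm one_ne_zero
      (fun n => aesm_pi (hwneg n).aesm) (aesm_pi hu) ?_
    refine tendsto_of_tendsto_of_tendsto_of_le_of_le tendsto_const_nhds
      (by simpa using ENNReal.tendsto_ofReal hsum) (fun _ => zero_le) fun N => ?_
    rw [eLpNorm_one_eq_lintegral_enorm]
    have hi : ∀ p, Integrable (fun x => ‖w N x p - u x p‖) circ := fun p =>
      ((integrable_fejer _ N).sub (hup p)).norm
    change _ ≤ ENNReal.ofReal (∑ p, ∫ x, ‖w N x p - u x p‖ ∂circ)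
    rw [← integral_finsetSum _ fun p _ => hi p,
      ofReal_integral_eq_lintegral_ofReal (integrable_finsetSum _ fun p _ => hi p)
        (Eventually.of_forall fun x => Finset.sum_nonneg fun p _ => norm_nonneg _)]
    refine lintegral_mono fun x => ?_
    rw [← ofReal_norm]
    refine ENNReal.ofReal_le_ofReal ((pi_norm_le_iff_of_nonneg
      (Finset.sum_nonneg fun p _ => norm_nonneg _)).2 fun p => ?_)
    exact Finset.single_le_sum (f := fun p => ‖w N x p - u x p‖) (fun p _ => norm_nonneg _)
      (Finset.mem_univ p)
  obtain ⟨ns, _, hns⟩ := hmeas.exists_seq_tendsto_ae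
  have hlim := tendsto_normSq_of_bounded hF (w := fun n x => u x - w (ns n) x) (K := K + K)
    (fun n p => (hu p).sub ((hwneg _).aesm p))
    (hns.mono fun x hx => by simpa using (tendsto_const_nhds (x := u x)).sub hx)
    (fun n => by
      filter_upwards [hK] with x hx
      refine (norm_sub_le _ _).trans (add_le_add hx ?_)
      have hK0 : 0 ≤ K := (norm_nonneg _).trans hx
      exact (pi_norm_le_iff_of_nonneg hK0).2 fun p => norm_fejer_le_of_bounded (hup p) (hKp p) _ x)
  obtain ⟨n, hn⟩ := (hlim.eventually_lt_const hε).exists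
  exact ⟨w (ns n), hwneg _, hn.le⟩

end Fejer

/-! ### Inverting the summation operator -/

section DTransform

variable {T r : ℕ} {g : GMIndex r} {a b : ℕ → Fin T → ℂ}

lemma one_sub_X_pow_mul_mk {p : ℕ} (hp : 0 < p) :
    ((1 : PowerSeries ℂ) - PowerSeries.X ^ p) *
      (PowerSeries.mk fun n => if p ∣ n then (1 : ℂ) else 0) = 1 := by
  ext n
  rw [sub_mul, one_mul, map_sub, PowerSeries.coeff_X_pow_mul', PowerSeries.coeff_mk,
    PowerSeries.coeff_one]
  by_cases hn : p ≤ n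
  · have h1 : p ∣ n - p ↔ p ∣ n := by
      refine ⟨fun h => ?_, fun h => Nat.dvd_sub h dvd_rfl⟩
      rw [← Nat.sub_add_cancel hn]
      exact Nat.dvd_add h dvd_rfl
    rw [if_pos hn, PowerSeries.coeff_mk, if_neg (show n ≠ 0 by omega)]
    simp only [h1, sub_self]
  · rw [if_neg hn, sub_zero]
    by_cases h0 : n = 0
    · simp [h0]
    · rw [if_neg h0, if_neg fun h => hn (Nat.le_of_dvd (Nat.pos_of_ne_zero h0) h)]

/-- The series `∑ d(k) X^k` is the inverse of the increment polynomial. -/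
lemma sum_incPoly_mul_dCoeff (hg : g.Positive) (n : ℕ) :
    ∑ k ∈ Finset.range (n + 1), (incPoly g).coeff k * dCoeff g (n - k)
      = if n = 0 then 1 else 0 := by
  have h : (incPoly g : PowerSeries ℂ) * (∏ i, (PowerSeries.mk fun n =>
      if g.step i * g.season i ∣ n then (1 : ℂ) else 0) ^ g.order i) = 1 := by
    have h1 : (incPoly g : PowerSeries ℂ)
        = ∏ i, (1 - PowerSeries.X ^ (g.step i * g.season i)) ^ g.order i := by
      rw [incPoly, ← Polynomial.coeToPowerSeries.ringHom_apply, map_prod]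
      simp
    rw [h1, ← Finset.prod_mul_distrib]
    refine Finset.prod_eq_one fun i _ => ?_
    rw [← mul_pow, one_sub_X_pow_mul_mk (Nat.mul_pos (hg i).1 (hg i).2.1), one_pow]
  have h2 := congrArg (PowerSeries.coeff n) h
  rw [PowerSeries.coeff_mul, PowerSeries.coeff_one,
    Finset.Nat.sum_antidiagonal_eq_sum_range_succ_mk] at h2
  rw [← h2]
  refine Finset.sum_congr rfl fun k _ => ?_
  rw [Polynomial.coeff_coe]
  rfl

/-- The summation operator `D` is injective: `∑_k e(k) b(n + k) = a(n)`. -/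
lemma IsDTransform.eq_zero (hg : g.Positive) (h : IsDTransform g a b) (hb : b = 0) : a = 0 := by
  funext n
  set K := (incPoly g).natDegree + 1 with hK
  have h1 : Tendsto (fun N => ∑ k ∈ Finset.range K, (incPoly g).coeff k •
      ∑ m ∈ Finset.range (N - k), dCoeff g m • a (n + k + m)) atTop (𝓝 0) := by
    have h2 : Tendsto (fun N => ∑ k ∈ Finset.range K, (incPoly g).coeff k •
        ∑ m ∈ Finset.range (N - k), dCoeff g m • a (n + k + m)) atTop
        (𝓝 (∑ k ∈ Finset.range K, (incPoly g).coeff k • b (n + k))) :=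
      tendsto_finsetSum _ fun k _ =>
        ((h (n + k)).comp (tendsto_sub_atTop_nat k)).const_smul _
    simpa [hb] using h2
  refine tendsto_nhds_unique (tendsto_const_nhds.congr' ?_) h1
  filter_upwards [eventually_ge_atTop K] with N hN
  have h3 : ∑ k ∈ Finset.range K, (incPoly g).coeff k •
      ∑ m ∈ Finset.range (N - k), dCoeff g m • a (n + k + m)
      = ∑ k ∈ Finset.range N, ∑ m ∈ Finset.range (N - k),
        ((incPoly g).coeff k * dCoeff g m) • a (n + (k + m)) := by
    refine (Finset.sum_subset (Finset.range_subset_range.2 hN) fun k _ hk => ?_).trans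
      (Finset.sum_congr rfl fun k _ => ?_)
    · rw [Polynomial.coeff_eq_zero_of_natDegree_lt, zero_smul]
      simp only [Finset.mem_range, not_lt] at hk
      omega
    · rw [Finset.smul_sum]
      exact Finset.sum_congr rfl fun m _ => by rw [smul_smul, add_assoc]
  rw [h3, ← Finset.sum_range_diag_flip N fun k m =>
    ((incPoly g).coeff k * dCoeff g m) • a (n + (k + m))]
  have h4 : ∀ l ∈ Finset.range N, ∑ k ∈ Finset.range (l + 1),
      ((incPoly g).coeff k * dCoeff g (l - k)) • a (n + (k + (l - k)))
      = (if l = 0 then (1 : ℂ) else 0) • a (n + l) := by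
    intro l _
    rw [← sum_incPoly_mul_dCoeff hg, Finset.sum_smul]
    refine Finset.sum_congr rfl fun k hk => ?_
    rw [Finset.mem_range] at hk
    rw [show k + (l - k) = l by omega]
  rw [Finset.sum_congr rfl h4, Finset.sum_eq_single_of_mem 0 (Finset.mem_range.2 (by omega))]
  · simp
  · intro l _ hl
    simp [hl]

end DTransform

/-! ### Least favourable densities and minimax-robust characteristics -/

section LeastFavourable

variable {T r : ℕ} {g : GMIndex r} {a b c : ℕ → Fin T → ℂ}
  {f₀ f₁ M : ℝ → Matrix (Fin T) (Fin T) ℂ} {C G : ℝ → Fin T → ℂ} {N : Nbhd T}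

lemma vecMulVec_mulVec_star {m n : Type*} [Fintype n] (A : Matrix m n ℂ) (u : n → ℂ) :
    Matrix.vecMulVec (A *ᵥ u) (star (A *ᵥ u)) = A * Matrix.vecMulVec u (star u) * Aᴴ := by
  rw [Matrix.mul_vecMulVec, Matrix.vecMulVec_mul, Matrix.star_mulVec]

lemma conjTranspose_transpose_wdens {x : ℝ} (hf : (f₀ x).PosSemidef) :
    ((wdens g f₀ x)ᵀ)ᴴ = (wdens g f₀ x)ᵀ := by
  have h : (wdens g f₀ x).IsHermitian := by
    rw [wdens, Matrix.IsHermitian, Matrix.conjTranspose_smul, hf.1.eq]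
    congr 1
    exact Complex.conj_ofReal _
  exact h.transpose.eq

lemma densityEquation_of_vecMulVec (hf₀ : IsSpectralDensity f₀)
    (h : ∀ᵐ x ∂circ, Matrix.vecMulVec (G x) (star (G x)) = M x) :
    DensityEquation g f₀ M (fun x => (wdens g f₀ x)ᵀ *ᵥ G x) := by
  filter_upwards [h, hf₀.2] with x h1 h2
  rw [vecMulVec_mulVec_star, h1, conjTranspose_transpose_wdens h2]
  rfl

lemma vecMulVec_of_densityEquation (hg : g.Positive) (hm : Minimality g f₀)
    (h : DensityEquation g f₀ M C) :
    ∀ᵐ x ∂circ, Matrix.vecMulVec (symbolF g f₀ x *ᵥ C x) (star (symbolF g f₀ x *ᵥ C x)) = M x := by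
  filter_upwards [h, hm.1, ae_weight_pos g hg] with x h1 h2 h3
  have hA : IsUnit ((wdens g f₀ x)ᵀ).det := by
    rw [Matrix.det_transpose, wdens, Matrix.det_smul]
    refine IsUnit.mul (IsUnit.pow _ (isUnit_iff_ne_zero.2 (by exact_mod_cast h3.ne')))
      ((Matrix.isUnit_iff_isUnit_det _).1 h2.isUnit)
  have h4 : Matrix.vecMulVec (C x) (star (C x)) = (wdens g f₀ x)ᵀ * M x * (wdens g f₀ x)ᵀ := h1
  rw [← mulVec_symbolF h2 h3 (C x), vecMulVec_mulVec_star,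
    conjTranspose_transpose_wdens h2.posSemidef] at h4
  exact ((Matrix.isUnit_iff_isUnit_det _).2 hA).mul_left_cancel
    (((Matrix.isUnit_iff_isUnit_det _).2 hA).mul_right_cancel h4)

/-- A least favourable density has a prediction error `G = B - v` whose outer square is a
multiplier matrix. -/
theorem IsLeastFavourable.exists_multiplier (hg : g.Positive) (ha : a ≠ 0)
    (hb : IsDTransform g a b) (hb₁ : Summable fun k => ‖b k‖) (hf₁ : IsSpectralDensity f₁)
    (hN : N.Admissible) (hnd : N.NonDegenerate) (hm : Minimality g f₀)
    (h : IsLeastFavourable g b (N.densities g f₁) f₀) :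
    ∃ v M, IsProj (wdens g f₀) (bSeries b) v ∧ N.IsMultiplier g f₁ f₀ M ∧
      ∀ᵐ x ∂circ, Matrix.vecMulVec (bSeries b x - v x) (star (bSeries b x - v x)) = M x := by
  have hf₀ := isSpectralDensity_of_mem h.1
  have hF := isSpectralDensity_wdens hg hf₀
  have hτ := hm.exists_isCoercive hg
  obtain ⟨K, Λ, δ, hD⟩ := exists_densities_eq g f₁ N
  obtain ⟨v, hv, hle⟩ := (hD ▸ h).exists_isProj hg hb₁ hf₁ hm
  rw [← hD] at hle
  have hG := (memL2_bSeries hb₁ hF).sub hF hv.1.1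
  -- A vanishing error would force all coefficients of the target to vanish.
  have hG0 : ¬ ∀ᵐ x ∂circ, bSeries b x - v x = 0 := fun h0 => by
    refine ha (hb.eq_zero hg ?_)
    funext j p
    rw [← integral_cis_mul_bSeries hb₁ j p]
    refine Eq.trans (integral_congr_ae ?_) (NegPast.integral_cis_mul hF hτ hv.1 j p)
    filter_upwards [h0] with x hx
    rw [sub_eq_zero.1 hx]
  obtain ⟨M, hM, hGM⟩ := N.exists_multiplier hg hf₁ hN hnd h.1 hτ hG hle hG0
  exact ⟨v, M, hv, hM, hGM⟩

/-- A solution of the equation is a saddle point: the error `G = Fᵀ⁻¹ C` is bounded, so that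
`B - G` belongs to the past of every spectral density, and the saturated multiplier makes `f₀`
maximize the error of the fixed estimate `B - G` over the class. -/
theorem isLeastFavourable_of_densityEquation (hg : g.Positive) (hb₁ : Summable fun k => ‖b k‖)
    (hf₁ : IsSpectralDensity f₁) (hN : N.Admissible) (hm : Minimality g f₀)
    (hf₀ : f₀ ∈ N.densities g f₁) (hC : IsInverseImage g f₀ b c C)
    (hmul : N.IsMultiplier g f₁ f₀ M) (hE : DensityEquation g f₀ M C) :
    IsLeastFavourable g b (N.densities g f₁) f₀ ∧
    mse g b (charFormula g b f₀ C) f₀ = ENNReal.ofReal (∑' k, b k ⬝ᵥ star (c k)).re ∧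
    IsSpectralCharacteristic g b f₀ (charFormula g b f₀ C) ∧
    IsMinimaxRobust g b (N.densities g f₁) (charFormula g b f₀ C) := by
  set G : ℝ → Fin T → ℂ := fun x => symbolF g f₀ x *ᵥ C x with hGdef
  have hF₀ := isSpectralDensity_wdens hg (isSpectralDensity_of_mem hf₀)
  have hGM := vecMulVec_of_densityEquation hg hm hE
  have hCG : ∀ᵐ x ∂circ, (wdens g f₀ x)ᵀ *ᵥ G x = C x := by
    filter_upwards [hm.1, ae_weight_pos g hg] with x h1 h2 using mulVec_symbolF h1 h2 _
  obtain ⟨K, -, hK⟩ := hmul.exists_bound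
  have hGb : ∀ᵐ x ∂circ, ‖G x‖ ≤ √K := by
    filter_upwards [hK, hGM] with x h1 h2 using norm_le_sqrt_of_vecMulVec h1 h2
  have hGm : ∀ p, AEStronglyMeasurable (fun x => G x p) circ := fun p => (hC.integrable p).1
  have hGL : ∀ F, IsSpectralDensity F → MemL2 F G := fun F hF => memL2_of_bounded hF hGm hGb
  have hpast : ∀ F, IsSpectralDensity F → (fun x => bSeries b x - G x) ∈ NegPast F := by
    intro F hF
    refine mem_negPast_of_bounded hF (fun p => (aesm_bSeries hb₁ p).sub (hGm p))
      (K := ∑' k, ‖b k‖ + √K) ?_ fun k p => ?_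
    · filter_upwards [hGb] with x hx
      exact (norm_sub_le _ _).trans (add_le_add (norm_bSeries_le hb₁ x) hx)
    · have hBi : Integrable (fun x => bSeries b x p) circ :=
        Integrable.of_bound (aesm_bSeries hb₁ p) _ (Eventually.of_forall fun x =>
          (norm_le_pi_norm _ p).trans (norm_bSeries_le hb₁ x))
      simp only [Pi.sub_apply, mul_sub]
      rw [integral_sub (integrable_cis_mul hBi _) (integrable_cis_mul (hC.integrable p) _),
        integral_cis_mul_bSeries hb₁, hC.eq, sub_self]
  have hproj := isProj_of_analytic hF₀ hC.series (hGL _ hF₀) hCG (hpast _ hF₀)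
  have hchar := charFormula_ae_eq (g := g) (b := b) (f := f₀) hg C
  have hmse : ∀ f, mse g b (charFormula g b f₀ C) f = normSq (wdens g f) G := by
    intro f
    rw [mse_congr_ae hchar, mse_rho_smul]
    simp_rw [sub_sub_cancel]
    rfl
  have hsc : IsSpectralCharacteristic g b f₀ (charFormula g b f₀ C) :=
    isSpectralCharacteristic_congr_ae (isSpectralCharacteristic_of_isProj hg hproj) hchar.symm
  have hle : ∀ f ∈ N.densities g f₁, normSq (wdens g f) G ≤ normSq (wdens g f₀) G :=
    fun f hf => hmul.normSq_le hg hf₁ hN hf₀ hf hGL hGM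
  refine ⟨⟨hf₀, _, hsc, fun f hf h hh => ?_⟩, ?_, hsc, fun f hf => ?_, fun h hh => ?_⟩
  · have hF := isSpectralDensity_wdens hg (isSpectralDensity_of_mem hf)
    have h1 := (isProj_of_isSpectralCharacteristic hg hh).normSq_le hF (memL2_bSeries hb₁ hF)
      (hpast _ hF)
    simp_rw [sub_sub_cancel] at h1
    rw [mse_eq hg, hmse]
    exact h1.trans (hle f hf)
  · rw [hmse, normSq_eq_ofReal hF₀ (hGL _ hF₀),
      nsq_eq_tsum hF₀ hb₁ hC.series (hGL _ hF₀) hCG (hpast _ hF₀)]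
  · exact mem_L2Past_congr_ae (rho_smul_mem_L2Past (hpast _ (isSpectralDensity_wdens hg
      (isSpectralDensity_of_mem hf)))) hchar.symm
  · refine (iSup₂_le fun f hf => ?_).trans (le_iSup₂ (f := fun f _ => mse g b h f) f₀ hf₀)
    rw [hmse, mse_eq hg]
    refine (hle f hf).trans ?_
    have h1 := hproj.normSq_le hF₀ (memL2_bSeries hb₁ hF₀) (inv_rho_smul_mem_negPast hg (hh f₀ hf₀))
    simp_rw [sub_sub_cancel] at h1
    exact h1

end LeastFavourable

/-! ### Canonical factorizations -/

section Factorization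

variable {T r q : ℕ} {g : GMIndex r} {a b : ℕ → Fin T → ℂ}
  {f₀ f₁ M : ℝ → Matrix (Fin T) (Fin T) ℂ} {u v G : ℝ → Fin T → ℂ}
  {φ : ℕ → Matrix (Fin T) (Fin q) ℂ} {Φ : ℝ → Matrix (Fin T) (Fin q) ℂ} {R : ℝ → Fin q → ℂ}

lemma form_mul_conjTranspose (A : Matrix (Fin T) (Fin q) ℂ) (u v : Fin T → ℂ) :
    form (A * Aᴴ) u v = (Aᵀ *ᵥ u) ⬝ᵥ star (Aᵀ *ᵥ v) := by
  rw [form, ← Matrix.mulVec_mulVec, Matrix.dotProduct_mulVec, Matrix.star_mulVec,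
    Matrix.mulVec_transpose, ← Matrix.mulVec_transpose]
  congr 2
  exact (Matrix.vecMul_transpose _ _).symm

lemma quad_mul_conjTranspose (A : Matrix (Fin T) (Fin q) ℂ) (u : Fin T → ℂ) :
    quad (A * Aᴴ) u = ∑ j, ‖(Aᵀ *ᵥ u) j‖ ^ 2 := by
  rw [quad, form_mul_conjTranspose, dotProduct, Complex.re_sum]
  refine Finset.sum_congr rfl fun j _ => ?_
  have h := Complex.mul_conj' ((Aᵀ *ᵥ u) j)
  change ((Aᵀ *ᵥ u) j * (starRingEnd ℂ) ((Aᵀ *ᵥ u) j)).re = _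
  rw [h, ← Complex.ofReal_pow, Complex.ofReal_re]

lemma norm_sq_le_quad (A : Matrix (Fin T) (Fin q) ℂ) (u : Fin T → ℂ) (j : Fin q) :
    ‖(Aᵀ *ᵥ u) j‖ ^ 2 ≤ quad (A * Aᴴ) u := by
  rw [quad_mul_conjTranspose]
  exact Finset.single_le_sum (f := fun j => ‖(Aᵀ *ᵥ u) j‖ ^ 2) (fun _ _ => by positivity)
    (Finset.mem_univ j)

lemma eq_zero_of_norm_le_mul {z : ℂ} {K : ℝ} (h : ∀ t : ℝ, 0 < t → ‖z‖ ≤ t * K) : z = 0 := by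
  have h1 : Tendsto (fun t : ℝ => t * K) (𝓝[>] 0) (𝓝 0) := by
    have : Tendsto (fun t : ℝ => t * K) (𝓝 0) (𝓝 (0 * K)) := tendsto_id.mul_const K
    rw [zero_mul] at this
    exact this.mono_left nhdsWithin_le_nhds
  have h2 : ‖z‖ ≤ 0 := ge_of_tendsto h1 (by
    filter_upwards [self_mem_nhdsWithin] with t ht using h t ht)
  exact norm_le_zero_iff.1 h2

namespace IsCanonicalFactorization

lemma aesm_mulVec (h : IsCanonicalFactorization g f₀ φ Φ)
    (hu : ∀ p, AEStronglyMeasurable (fun x => u x p) circ) (j : Fin q) :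
    AEStronglyMeasurable (fun x => ((Φ x)ᵀ *ᵥ u x) j) circ := by
  simp only [Matrix.mulVec, dotProduct, Matrix.transpose_apply]
  exact Finset.aestronglyMeasurable_fun_sum _ fun i _ => (h.integrable i j).1.mul (hu i)

/-- `Φᵀ` maps `L₂(F)` isometrically into the square integrable functions, `F = Φ Φ*`. -/
lemma integral_norm_mulVec_le (h : IsCanonicalFactorization g f₀ φ Φ)
    (hF : IsSpectralDensity (wdens g f₀)) (hu : MemL2 (wdens g f₀) u) (j : Fin q) {t : ℝ}
    (ht : 0 < t) : Integrable (fun x => ((Φ x)ᵀ *ᵥ u x) j) circ ∧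
      ∫ x, ‖((Φ x)ᵀ *ᵥ u x) j‖ ∂circ ≤ (t + nsq (wdens g f₀) u / t) / 2 := by
  have hq := hu.integrable_quad hF
  have hint : Integrable (fun x => (t * 1 + quad (wdens g f₀ x) (u x) / t) / 2) circ :=
    ((integrable_const _).add (hq.div_const _)).div_const _
  have hle : ∀ᵐ x ∂circ, ‖((Φ x)ᵀ *ᵥ u x) j‖ ≤ (t * 1 + quad (wdens g f₀ x) (u x) / t) / 2 := by
    filter_upwards [h.fact] with x hx
    have h1 : wdens g f₀ x = Φ x * (Φ x)ᴴ := hx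
    rw [h1]
    have h2 := norm_sq_le_quad (Φ x) (u x) j
    exact norm_le_of_sq_le (by rwa [one_mul]) zero_le_one ((sq_nonneg _).trans h2) ht
  have hi : Integrable (fun x => ((Φ x)ᵀ *ᵥ u x) j) circ := hint.mono' (h.aesm_mulVec hu.1 j) hle
  refine ⟨hi, (integral_mono_ae hi.norm hint hle).trans_eq ?_⟩
  rw [integral_div, integral_add (integrable_const _) (hq.div_const _), integral_div]
  simp [nsq]

/-- The innovation property: the transform of an element orthogonal to the past has no Fourier
coefficients of negative index. -/
lemma integral_cis_mul_eq_zero (h : IsCanonicalFactorization g f₀ φ Φ)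
    (hF : IsSpectralDensity (wdens g f₀)) (hG : MemL2 (wdens g f₀) G)
    (horth : ∀ w ∈ NegPast (wdens g f₀), ∫ x, form (wdens g f₀ x) (G x) (w x) ∂circ = 0)
    (k : ℕ) (j : Fin q) : ∫ x, cis ((k : ℤ) + 1) x * ((Φ x)ᵀ *ᵥ G x) j ∂circ = 0 := by
  set I := ∫ x, cis ((k : ℤ) + 1) x * ((Φ x)ᵀ *ᵥ G x) j ∂circ with hI
  have hI1 := (h.integral_norm_mulVec_le hF hG j one_pos).1
  have key : ∀ t : ℝ, 0 < t → ‖I‖ ≤ t * ((nsq (wdens g f₀) G + q) / 2) := by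
    intro t ht
    obtain ⟨n, s, hns⟩ := h.innovation j (ENNReal.ofReal (t ^ 2))
      (ENNReal.ofReal_pos.2 (by positivity))
    set p : ℝ → Fin T → ℂ := fun x => ∑ k ∈ Finset.range n, cis (-(k : ℤ)) x • s k with hp
    set d : ℝ → Fin q → ℂ := fun x => (Φ x)ᵀ *ᵥ p x - Pi.single j 1 with hd
    have hneg : IsNegPoly (fun x => cis (-((k : ℤ) + 1)) x • p x) := by
      have h1 : (fun x => cis (-((k : ℤ) + 1)) x • p x) = fun x => ∑ m ∈ Finset.range n,
          cis (-(((k + m : ℕ) : ℤ) + 1)) x • s m := by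
        funext x
        rw [hp, Finset.smul_sum]
        refine Finset.sum_congr rfl fun m _ => ?_
        rw [smul_smul, ← cis_add]
        congr 2
        push_cast
        ring
      rw [h1]
      exact IsNegPoly.sum _ fun m _ => isNegPoly_cis _ _
    have hpm : ∀ i, AEStronglyMeasurable (fun x => p x i) circ := by
      intro i
      refine Continuous.aestronglyMeasurable ?_
      simp only [hp, Finset.sum_apply, Pi.smul_apply]
      exact continuous_finsetSum _ fun k _ => (continuous_cis _).smul continuous_const
    have hdm : ∀ l, AEStronglyMeasurable (fun x => d x l) circ := fun l =>
      (h.aesm_mulVec hpm l).sub aestronglyMeasurable_const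
    have hdint : Integrable (fun x => ‖d x‖ ^ 2) circ := by
      refine ⟨(aesm_pi hdm).norm.pow 2, ?_⟩
      rw [hasFiniteIntegral_iff_enorm]
      refine lt_of_le_of_lt (lintegral_mono fun x => ?_) (hns.trans_lt ENNReal.ofReal_lt_top)
      rw [enorm_pow, enorm_norm]
    have hdle : ∫ x, ‖d x‖ ^ 2 ∂circ ≤ t ^ 2 := by
      rw [← ENNReal.ofReal_le_ofReal_iff (by positivity),
        ofReal_integral_eq_lintegral_ofReal hdint (Eventually.of_forall fun x => by positivity)]
      refine le_trans (lintegral_mono fun x => ?_) hns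
      rw [ENNReal.ofReal_pow (norm_nonneg _), ofReal_norm]
    have hGp := horth _ (hneg.mem_negPast hF)
    have hform : ∀ᵐ x ∂circ, cis ((k : ℤ) + 1) x * ((Φ x)ᵀ *ᵥ G x) j
        = form (wdens g f₀ x) (G x) (cis (-((k : ℤ) + 1)) x • p x)
          - cis ((k : ℤ) + 1) x * (((Φ x)ᵀ *ᵥ G x) ⬝ᵥ star (d x)) := by
      filter_upwards [h.fact] with x hx
      have h1 : wdens g f₀ x = Φ x * (Φ x)ᴴ := hx
      have h2 : star (Pi.single j (1 : ℂ)) = (Pi.single j (1 : ℂ) : Fin q → ℂ) := by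
        rw [← Pi.single_star, star_one]
      rw [form_smul_right, star_cis, neg_neg, h1, form_mul_conjTranspose, ← mul_sub,
        ← dotProduct_sub, hd, star_sub, sub_sub_cancel, h2, dotProduct_single, mul_one]
    have hbound : ∀ᵐ x ∂circ, ‖cis ((k : ℤ) + 1) x * (((Φ x)ᵀ *ᵥ G x) ⬝ᵥ star (d x))‖
        ≤ (t * quad (wdens g f₀ x) (G x) + q * ‖d x‖ ^ 2 / t) / 2 := by
      filter_upwards [h.fact] with x hx
      have h1 : wdens g f₀ x = Φ x * (Φ x)ᴴ := hx
      rw [h1, quad_mul_conjTranspose, norm_mul, norm_cis, one_mul, dotProduct]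
      have h3 : (t * ∑ l, ‖((Φ x)ᵀ *ᵥ G x) l‖ ^ 2 + q * ‖d x‖ ^ 2 / t) / 2
          = ∑ l : Fin q, (t * ‖((Φ x)ᵀ *ᵥ G x) l‖ ^ 2 + ‖d x‖ ^ 2 / t) / 2 := by
        rw [← Finset.sum_div, Finset.sum_add_distrib, ← Finset.mul_sum, Finset.sum_const,
          Finset.card_univ, Fintype.card_fin, nsmul_eq_mul, mul_div_assoc]
      rw [h3]
      refine (norm_sum_le _ _).trans (Finset.sum_le_sum fun l _ => ?_)
      rw [Pi.star_apply, norm_mul, norm_star]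
      have h4 : ‖((Φ x)ᵀ *ᵥ G x) l‖ * ‖d x l‖ ≤ ‖((Φ x)ᵀ *ᵥ G x) l‖ * ‖d x‖ :=
        mul_le_mul_of_nonneg_left (norm_le_pi_norm _ l) (norm_nonneg _)
      exact h4.trans (norm_le_of_sq_le (by rw [mul_pow]) (by positivity) (by positivity) ht)
    have hqi := hG.integrable_quad hF
    have hbi : Integrable (fun x => (t * quad (wdens g f₀ x) (G x) + q * ‖d x‖ ^ 2 / t) / 2) circ :=
      ((hqi.const_mul _).add ((hdint.const_mul _).div_const _)).div_const _
    have hgm : AEStronglyMeasurable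
        (fun x => cis ((k : ℤ) + 1) x * (((Φ x)ᵀ *ᵥ G x) ⬝ᵥ star (d x))) circ := by
      simp only [dotProduct]
      exact (aesm_cis _).mul (Finset.aestronglyMeasurable_fun_sum _ fun l _ =>
        (h.aesm_mulVec hG.1 l).mul (continuous_star.comp_aestronglyMeasurable (hdm l)))
    have hgi := hbi.mono' hgm hbound
    rw [hI, integral_congr_ae hform, integral_sub
      (integrable_form hF hG (hneg.memL2 hF)) hgi, hGp, zero_sub, norm_neg]
    refine (norm_integral_le_of_norm_le hbi hbound).trans ?_
    rw [integral_div, integral_add (hqi.const_mul _) ((hdint.const_mul _).div_const _),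
      integral_const_mul, integral_div, integral_const_mul]
    have h5 : (q : ℝ) * (∫ x, ‖d x‖ ^ 2 ∂circ) / t ≤ q * t := by
      rw [div_le_iff₀ ht]
      have := mul_le_mul_of_nonneg_left hdle (Nat.cast_nonneg q)
      nlinarith
    change (t * nsq (wdens g f₀) G + _) / 2 ≤ _
    linarith
  exact eq_zero_of_norm_le_mul key

/-- The transform of an element of the past has Fourier coefficients of negative index only. -/
lemma integral_cis_mul_negPast (h : IsCanonicalFactorization g f₀ φ Φ)
    (hF : IsSpectralDensity (wdens g f₀)) (hv : v ∈ NegPast (wdens g f₀)) (k : ℕ) (j : Fin q) :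
    ∫ x, cis (-(k : ℤ)) x * ((Φ x)ᵀ *ᵥ v x) j ∂circ = 0 := by
  refine eq_zero_of_norm_le_mul (K := 1) fun t ht => ?_
  obtain ⟨p, hp, hle⟩ := NegPast.exists_nsq_le hF hv (ε := t ^ 2) (by positivity)
  have hpi := (h.integral_norm_mulVec_le hF (hp.memL2 hF) j one_pos).1
  have hvi := (h.integral_norm_mulVec_le hF hv.1 j one_pos).1
  have hd := (h.integral_norm_mulVec_le hF (hv.1.sub hF (hp.memL2 hF)) j ht).2
  have h0 : ∫ x, cis (-(k : ℤ)) x * ((Φ x)ᵀ *ᵥ p x) j ∂circ = 0 := by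
    obtain ⟨n, s, rfl⟩ := hp
    have h1 : ∀ x, cis (-(k : ℤ)) x * ((Φ x)ᵀ *ᵥ negPoly n s x) j
        = ∑ i, ∑ m ∈ Finset.range n, (cis (-(((k + m : ℕ) : ℤ) + 1)) x * Φ x i j) * s m i := by
      intro x
      simp only [Matrix.mulVec, dotProduct, Matrix.transpose_apply, negPoly, Finset.sum_apply,
        Pi.smul_apply, smul_eq_mul, Finset.mul_sum]
      refine Finset.sum_congr rfl fun i _ => Finset.sum_congr rfl fun m _ => ?_
      have h2 : -(((k + m : ℕ) : ℤ) + 1) = -(k : ℤ) + -((m : ℤ) + 1) := by push_cast; ring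
      rw [h2, cis_add]
      ring
    have hi : ∀ (m : ℕ) i, Integrable
        (fun x => (cis (-(((k + m : ℕ) : ℤ) + 1)) x * Φ x i j) * s m i) circ := fun m i =>
      (integrable_cis_mul (h.integrable i j) _).mul_const _
    simp_rw [h1]
    rw [integral_finsetSum _ fun i _ => integrable_finsetSum _ fun m _ => hi m i]
    refine Finset.sum_eq_zero fun i _ => ?_
    rw [integral_finsetSum _ fun m _ => hi m i]
    refine Finset.sum_eq_zero fun m _ => ?_
    rw [integral_mul_const, h.coeff_neg, zero_mul]
  have h3 : ∫ x, cis (-(k : ℤ)) x * ((Φ x)ᵀ *ᵥ v x) j ∂circ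
      = ∫ x, cis (-(k : ℤ)) x * ((Φ x)ᵀ *ᵥ (v x - p x)) j ∂circ := by
    simp_rw [Matrix.mulVec_sub, Pi.sub_apply, mul_sub]
    rw [integral_sub (integrable_cis_mul hvi _) (integrable_cis_mul hpi _), h0, sub_zero]
  rw [h3, mul_one]
  refine (norm_integral_le_integral_norm _).trans ?_
  simp_rw [norm_mul, norm_cis, one_mul]
  refine hd.trans ?_
  have h4 : nsq (wdens g f₀) (fun x => v x - p x) / t ≤ t := by
    rw [div_le_iff₀ ht]; linarith [sq t]
  linarith

/-- In the expansion of `B` only the terms of index at least `k` contribute, as `Φ` has no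
frequency of positive index. -/
lemma integral_cis_mul_target (h : IsCanonicalFactorization g f₀ φ Φ)
    (hb : Summable fun k => ‖b k‖) (k : ℕ) (j : Fin q) :
    ∫ x, cis (-(k : ℤ)) x * ((Φ x)ᵀ *ᵥ bSeries b x) j ∂circ = hankel φ b k j := by
  have hsum : ∀ (j : Fin q) (i : Fin T), HasSum (fun m => φ m i j * b (m + k) i)
      (∫ x, (cis (-(k : ℤ)) x * Φ x i j) * bSeries b x i ∂circ) := by
    intro j i
    have h1 := hasSum_integral_mul_bSeries hb (integrable_cis_mul (h.integrable i j) (-(k : ℤ))) i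
    rw [← hasSum_nat_add_iff' k] at h1
    have h2 : ∑ m ∈ Finset.range k,
        (∫ x, cis (m : ℤ) x * (cis (-(k : ℤ)) x * Φ x i j) ∂circ) * b m i = 0 := by
      refine Finset.sum_eq_zero fun m hm => ?_
      rw [Finset.mem_range] at hm
      have h3 : (m : ℤ) + -(k : ℤ) = -(((k - m - 1 : ℕ) : ℤ) + 1) := by omega
      simp_rw [← mul_assoc, ← cis_add, h3]
      rw [h.coeff_neg, zero_mul]
    rw [h2, sub_zero] at h1
    refine h1.congr_fun fun m => ?_
    have h3 : ((m + k : ℕ) : ℤ) + -(k : ℤ) = m := by push_cast; ring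
    simp_rw [← mul_assoc, ← cis_add, h3]
    rw [h.coeff]
  have hh : hankel φ b k = fun j =>
      ∑ i, ∫ x, (cis (-(k : ℤ)) x * Φ x i j) * bSeries b x i ∂circ := by
    refine HasSum.tsum_eq (Pi.hasSum.2 fun j => ?_)
    exact hasSum_sum fun i _ => hsum j i
  rw [hh]
  beta_reduce
  rw [← integral_finsetSum]
  · refine integral_congr_ae (Eventually.of_forall fun x => ?_)
    simp only [Matrix.mulVec, dotProduct, Matrix.transpose_apply, Finset.mul_sum, mul_assoc]
  · intro i _
    exact (integrable_cis_mul (h.integrable i j) _).mul_bdd (c := ∑' k, ‖b k‖) (aesm_bSeries hb i)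
      (Eventually.of_forall fun x => (norm_le_pi_norm _ i).trans (norm_bSeries_le hb x))

/-- The transform of the prediction error is the function `R`: both have the same Fourier
coefficients. -/
lemma mulVec_ae_eq (h : IsCanonicalFactorization g f₀ φ Φ)
    (hF : IsSpectralDensity (wdens g f₀)) (hb : Summable fun k => ‖b k‖)
    (hR : IsAnalyticSeries R (hankel φ b)) (hv : IsProj (wdens g f₀) (bSeries b) v) :
    ∀ᵐ x ∂circ, (Φ x)ᵀ *ᵥ (bSeries b x - v x) = R x := by
  have hB := memL2_bSeries hb hF
  have hG := hB.sub hF hv.1.1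
  have hcomp : ∀ j, ∀ᵐ x ∂circ, ((Φ x)ᵀ *ᵥ (bSeries b x - v x)) j - R x j = 0 := by
    intro j
    have hGi := (h.integral_norm_mulVec_le hF hG j one_pos).1
    refine ae_eq_zero_of_coeff (hGi.sub (hR j).1) fun k => ?_
    simp_rw [mul_sub]
    rw [integral_sub (integrable_cis_mul hGi _) (integrable_cis_mul (hR j).1 _), sub_eq_zero]
    rcases lt_or_ge 0 k with hk | hk
    · obtain ⟨m, rfl⟩ : ∃ m : ℕ, k = (m : ℤ) + 1 := ⟨(k - 1).toNat, by omega⟩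
      rw [(hR j).2.2, h.integral_cis_mul_eq_zero hF hG hv.2]
    · obtain ⟨m, rfl⟩ : ∃ m : ℕ, k = -(m : ℤ) := ⟨(-k).toNat, by omega⟩
      rw [(hR j).2.1, ← h.integral_cis_mul_target hb]
      simp_rw [Matrix.mulVec_sub, Pi.sub_apply, mul_sub]
      rw [integral_sub (integrable_cis_mul (h.integral_norm_mulVec_le hF hB j one_pos).1 _)
        (integrable_cis_mul (h.integral_norm_mulVec_le hF hv.1.1 j one_pos).1 _),
        h.integral_cis_mul_negPast hF hv.1, sub_zero]
  filter_upwards [ae_all_iff.2 hcomp] with x hx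
  exact funext fun j => sub_eq_zero.1 (hx j)

lemma factorEquation_of_vecMulVec (hR : ∀ᵐ x ∂circ, (Φ x)ᵀ *ᵥ G x = R x)
    (hM : ∀ᵐ x ∂circ, Matrix.vecMulVec (G x) (star (G x)) = M x) : FactorEquation Φ M R := by
  filter_upwards [hR, hM] with x h1 h2
  rw [← h1, vecMulVec_mulVec_star, h2]
  rfl

lemma densityEquation_of_factorEquation (h : IsCanonicalFactorization g f₀ φ Φ)
    (hR : ∀ᵐ x ∂circ, (Φ x)ᵀ *ᵥ G x = R x) (hE : FactorEquation Φ M R) :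
    DensityEquation g f₀ M (fun x => (wdens g f₀ x)ᵀ *ᵥ G x) := by
  filter_upwards [h.fact, hR, hE] with x h1 h2 h3
  have h4 : (wdens g f₀ x)ᵀ = (Φ x).map star * (Φ x)ᵀ := by
    have : wdens g f₀ x = Φ x * (Φ x)ᴴ := h1
    rw [this, Matrix.transpose_mul]
    rfl
  have h5 : ((Φ x).map star)ᴴ = (Φ x)ᵀ := by
    ext i j
    simp
  change _ = (wdens g f₀ x)ᵀ * M x * (wdens g f₀ x)ᵀ
  rw [h4, ← Matrix.mulVec_mulVec, h2, vecMulVec_mulVec_star, h3, h5]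
  simp only [Matrix.mul_assoc]

end IsCanonicalFactorization

end Factorization

/-! ### The prediction error of stochastic sequences -/

section Stochastic

lemma tendsto_of_abs_sub_le {a d : ℕ → ℝ} {A : ℝ} (hd : Tendsto d atTop (𝓝 0))
    (h : ∀ n t, 0 < t → |a n - A| ≤ t * A + (1 + 1 / t) * d n) : Tendsto a atTop (𝓝 A) := by
  rw [Metric.tendsto_atTop]
  intro ε hε
  set t := ε / (2 * (|A| + 1)) with ht
  have hA : 0 < |A| + 1 := by positivity
  have ht0 : 0 < t := by positivity
  have h1 : Tendsto (fun n => (1 + 1 / t) * d n) atTop (𝓝 0) := by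
    simpa using hd.const_mul (1 + 1 / t)
  obtain ⟨n₀, hn₀⟩ := eventually_atTop.1 (h1.eventually_lt_const (half_pos hε))
  refine ⟨n₀, fun n hn => ?_⟩
  rw [Real.dist_eq]
  have h2 : t * A ≤ ε / 2 := by
    have h3 : t * (|A| + 1) = ε / 2 := by rw [ht]; field_simp
    have h4 := mul_le_mul_of_nonneg_left (le_abs_self A) ht0.le
    linarith
  linarith [h n t ht0, hn₀ n hn]

variable {T r : ℕ} {g : GMIndex r} {f F : ℝ → Matrix (Fin T) (Fin T) ℂ} {b : ℕ → Fin T → ℂ}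

lemma tendsto_nsq (hF : IsSpectralDensity F) {u : ℝ → Fin T → ℂ} {w : ℕ → ℝ → Fin T → ℂ}
    (hu : MemL2 F u) (hw : ∀ n, MemL2 F (w n)) (h : Tendsto (fun n => nsq F (w n)) atTop (𝓝 0)) :
    Tendsto (fun n => nsq F (fun x => u x + w n x)) atTop (𝓝 (nsq F u)) := by
  refine tendsto_of_abs_sub_le h fun n t ht => ?_
  have h1 := norm_integral_form_le hF hu (hw n) ht
  have h2 := nsq_nonneg hF (w n)
  have h3 := Complex.abs_re_le_norm (∫ x, form (F x) (u x) (w n x) ∂circ)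
  rw [nsq_add hF hu (hw n), add_assoc, add_sub_cancel_left]
  refine (abs_add_le _ _).trans ?_
  rw [abs_of_nonneg h2, abs_mul, abs_two]
  have h4 : (1 + 1 / t) * nsq F (w n) = nsq F (w n) + nsq F (w n) / t := by ring
  rw [h4]
  linarith

variable {Ω : Type*} [MeasurableSpace Ω] {P : Measure Ω}

lemma lintegral_enorm_sq {U : Ω → ℂ} (hU : MemLp U 2 P) :
    ∫⁻ ω, ‖U ω‖ₑ ^ 2 ∂P = ENNReal.ofReal (∫ ω, ‖U ω‖ ^ 2 ∂P) := by
  rw [ofReal_integral_eq_lintegral_ofReal ((memLp_two_iff_integrable_sq_norm hU.1).1 hU)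
    (Eventually.of_forall fun ω => by positivity)]
  refine lintegral_congr fun ω => ?_
  rw [ENNReal.ofReal_pow (norm_nonneg _), ofReal_norm]

lemma tendsto_integral_norm_sq {U : Ω → ℂ} {W : ℕ → Ω → ℂ} (hU : MemLp U 2 P)
    (hW : ∀ n, MemLp (W n) 2 P) (h : Tendsto (fun n => ∫ ω, ‖W n ω‖ ^ 2 ∂P) atTop (𝓝 0)) :
    Tendsto (fun n => ∫ ω, ‖U ω + W n ω‖ ^ 2 ∂P) atTop (𝓝 (∫ ω, ‖U ω‖ ^ 2 ∂P)) := by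
  refine tendsto_of_abs_sub_le h fun n t ht => ?_
  have iU := (memLp_two_iff_integrable_sq_norm hU.1).1 hU
  have iW := (memLp_two_iff_integrable_sq_norm (hW n).1).1 (hW n)
  have iUW : Integrable (fun ω => ‖U ω + W n ω‖ ^ 2) P :=
    (memLp_two_iff_integrable_sq_norm (hU.add (hW n)).1).1 (hU.add (hW n))
  rw [← integral_sub iUW iU, ← integral_const_mul, ← integral_const_mul,
    ← integral_add (iU.const_mul _) (iW.const_mul _)]
  refine (abs_integral_le_integral_abs).trans (integral_mono (iUW.sub iU).abs
    ((iU.const_mul _).add (iW.const_mul _)) fun ω => ?_)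
  have h1 := norm_add_le (U ω) (W n ω)
  have h2 := norm_sub_le (U ω + W n ω) (W n ω)
  rw [add_sub_cancel_right] at h2
  have h3 := norm_le_of_sq_le (a := ‖U ω‖ ^ 2) (b := ‖W n ω‖ ^ 2) (y := ‖U ω‖ * ‖W n ω‖)
    (by rw [mul_pow]) (by positivity) (by positivity) ht
  have h5 : (1 + 1 / t) * ‖W n ω‖ ^ 2 = ‖W n ω‖ ^ 2 + ‖W n ω‖ ^ 2 / t := by ring
  change |‖U ω + W n ω‖ ^ 2 - ‖U ω‖ ^ 2| ≤ t * ‖U ω‖ ^ 2 + (1 + 1 / t) * ‖W n ω‖ ^ 2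
  rw [h5, abs_le]
  have n1 := norm_nonneg (U ω)
  have n2 := norm_nonneg (W n ω)
  have n3 := norm_nonneg (U ω + W n ω)
  constructor
  · by_cases h6 : ‖W n ω‖ ≤ ‖U ω‖
    · nlinarith
    · nlinarith
  · nlinarith

variable {ξ : ℤ → Fin T → Ω → ℂ}

lemma HasSpectralDensity.memLp_incDot (h : HasSpectralDensity P g ξ f) (hg : g.Positive)
    (u : Fin T → ℂ) (m : ℤ) : MemLp (incDot g ξ u m) 2 P :=
  memLp_finsetSum _ fun p _ => (h.memLp g.step (fun i => (hg i).1) p m).const_mul (u p)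

/-- The spectral representation of covariances of increments. -/
lemma HasSpectralDensity.integral_incDot_mul (h : HasSpectralDensity P g ξ f) (hg : g.Positive)
    (hf : IsSpectralDensity f) (u w : Fin T → ℂ) (m n : ℤ) :
    ∫ ω, incDot g ξ u m ω * star (incDot g ξ w n ω) ∂P
      = ∫ x, form (wdens g f x) (cis m x • u) (cis n x • w) ∂circ := by
  have hF := isSpectralDensity_wdens hg hf
  have hcov : ∀ p q, ∫ ω, increment g (fun k => ξ k p) m ω *
      star (increment g (fun k => ξ k q) n ω) ∂P = ∫ x, cis (m - n) x * wdens g f x p q ∂circ := by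
    intro p q
    have h1 := h.cov g.step g.step (fun i => (hg i).1) (fun i => (hg i).1) p q (m - n) n
    rw [add_sub_cancel] at h1
    refine h1.trans (integral_congr_ae (Eventually.of_forall fun x => ?_))
    have h2 : (weight g x : ℂ) = chi g x * star (chi g x) * ((‖beta g x‖ ^ 2 : ℝ) : ℂ)⁻¹ := by
      rw [weight, Complex.ofReal_div, div_eq_mul_inv]
      congr 1
      push_cast
      exact (Complex.mul_conj' _).symm
    change cis (m - n) x * chi g x * star (chi g x) * ((‖beta g x‖ ^ 2 : ℝ) : ℂ)⁻¹ * f x p q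
      = cis (m - n) x * ((weight g x : ℂ) * f x p q)
    rw [h2]
    ring
  have hL : ∀ p, MemLp (increment g (fun k => ξ k p) m) 2 P := fun p =>
    h.memLp g.step (fun i => (hg i).1) p m
  have hR : ∀ q, MemLp (fun ω => star (increment g (fun k => ξ k q) n ω)) 2 P := fun q =>
    (h.memLp g.step (fun i => (hg i).1) q n).star
  have hi : ∀ p q, Integrable (fun ω => (u p * star (w q)) * (increment g (fun k => ξ k p) m ω *
      star (increment g (fun k => ξ k q) n ω))) P := fun p q =>
    ((hL p).integrable_mul (hR q)).const_mul _
  have hi' : ∀ p q, Integrable (fun x => (u p * star (w q)) *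
      (cis (m - n) x * wdens g f x p q)) circ := fun p q =>
    (integrable_cis_mul (hF.1 p q) _).const_mul _
  have e1 : ∀ ω, incDot g ξ u m ω * star (incDot g ξ w n ω) = ∑ p, ∑ q, (u p * star (w q)) *
      (increment g (fun k => ξ k p) m ω * star (increment g (fun k => ξ k q) n ω)) := by
    intro ω
    rw [incDot, incDot, star_sum, Finset.sum_mul_sum]
    refine Finset.sum_congr rfl fun p _ => Finset.sum_congr rfl fun q _ => ?_
    rw [star_mul']
    ring
  have e2 : ∀ x, form (wdens g f x) (cis m x • u) (cis n x • w) = ∑ p, ∑ q, (u p * star (w q)) *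
      (cis (m - n) x * wdens g f x p q) := by
    intro x
    rw [form_eq_sum]
    refine Finset.sum_congr rfl fun p _ => Finset.sum_congr rfl fun q _ => ?_
    rw [Pi.smul_apply, Pi.smul_apply, smul_eq_mul, smul_eq_mul, star_mul', star_cis,
      sub_eq_add_neg, cis_add]
    ring
  simp_rw [e1, e2]
  rw [integral_finsetSum _ fun p _ => integrable_finsetSum _ fun q _ => hi p q,
    integral_finsetSum _ fun p _ => integrable_finsetSum _ fun q _ => hi' p q]
  refine Finset.sum_congr rfl fun p _ => ?_
  rw [integral_finsetSum _ fun q _ => hi p q, integral_finsetSum _ fun q _ => hi' p q]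
  refine Finset.sum_congr rfl fun q _ => ?_
  rw [integral_const_mul, integral_const_mul, hcov]

/-- Finite linear combinations of increments are isometric to trigonometric polynomials. -/
lemma HasSpectralDensity.integral_norm_sq (h : HasSpectralDensity P g ξ f) (hg : g.Positive)
    (hf : IsSpectralDensity f) {ι : Type*} (S : Finset ι) (u : ι → Fin T → ℂ) (τ : ι → ℤ) :
    ∫ ω, ‖∑ i ∈ S, incDot g ξ (u i) (τ i) ω‖ ^ 2 ∂P
      = nsq (wdens g f) (fun x => ∑ i ∈ S, cis (τ i) x • u i) := by
  have hF := isSpectralDensity_wdens hg hf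
  have hcm : ∀ i, MemL2 (wdens g f) (fun x => cis (τ i) x • u i) := fun i =>
    memL2_of_bounded hF (K := ‖u i‖) (fun q => (aesm_cis _).mul aestronglyMeasurable_const)
      (Eventually.of_forall fun x => by rw [norm_smul, norm_cis, one_mul])
  have hi : ∀ i j, Integrable (fun ω => incDot g ξ (u i) (τ i) ω *
      star (incDot g ξ (u j) (τ j) ω)) P := fun i j =>
    (h.memLp_incDot hg (u i) (τ i)).integrable_mul (h.memLp_incDot hg (u j) (τ j)).star
  have e1 : ((∫ ω, ‖∑ i ∈ S, incDot g ξ (u i) (τ i) ω‖ ^ 2 ∂P : ℝ) : ℂ)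
      = ∑ i ∈ S, ∑ j ∈ S, ∫ ω, incDot g ξ (u i) (τ i) ω * star (incDot g ξ (u j) (τ j) ω) ∂P := by
    rw [← integral_complex_ofReal]
    simp_rw [← integral_finsetSum S fun j _ => hi _ j]
    rw [← integral_finsetSum S fun i _ => integrable_finsetSum S fun j _ => hi i j]
    refine integral_congr_ae (Eventually.of_forall fun ω => ?_)
    have h1 := Complex.mul_conj' (∑ i ∈ S, incDot g ξ (u i) (τ i) ω)
    rw [map_sum, Finset.sum_mul_sum] at h1
    push_cast
    exact h1.symm
  have hi' : ∀ i j, Integrable (fun x => form (wdens g f x) (cis (τ i) x • u i)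
      (cis (τ j) x • u j)) circ := fun i j => integrable_form hF (hcm i) (hcm j)
  have e2 : ((nsq (wdens g f) (fun x => ∑ i ∈ S, cis (τ i) x • u i) : ℝ) : ℂ)
      = ∑ i ∈ S, ∑ j ∈ S,
        ∫ x, form (wdens g f x) (cis (τ i) x • u i) (cis (τ j) x • u j) ∂circ := by
    rw [nsq, ← integral_complex_ofReal]
    simp_rw [← integral_finsetSum S fun j _ => hi' _ j]
    rw [← integral_finsetSum S fun i _ => integrable_finsetSum S fun j _ => hi' i j]
    refine integral_congr_ae ?_
    filter_upwards [hF.2] with x hx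
    rw [← form_self hx.1]
    simp only [form]
    rw [sum_dotProduct]
    refine Finset.sum_congr rfl fun i _ => ?_
    rw [star_sum, Matrix.mulVec_sum, dotProduct_sum]
  have e3 : ((∫ ω, ‖∑ i ∈ S, incDot g ξ (u i) (τ i) ω‖ ^ 2 ∂P : ℝ) : ℂ)
      = ((nsq (wdens g f) (fun x => ∑ i ∈ S, cis (τ i) x • u i) : ℝ) : ℂ) := by
    rw [e1, e2]
    exact Finset.sum_congr rfl fun i _ => Finset.sum_congr rfl fun j _ =>
      h.integral_incDot_mul hg hf _ _ _ _
  exact_mod_cast e3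

/-- The mean square error of an estimate is computed in the spectral domain. -/
theorem lintegral_eq_mse (hg : g.Positive) (hb : Summable fun k => ‖b k‖)
    (hf : IsSpectralDensity f) (hξ : HasSpectralDensity P g ξ f) {X η : Ω → ℂ}
    (hX : IsFunctional P g ξ b X) {h : ℝ → Fin T → ℂ} (hh : h ∈ L2Past g f)
    (hη : IsEstimate P g ξ f h η) : ∫⁻ ω, ‖X ω - η ω‖ₑ ^ 2 ∂P = mse g b h f := by
  have hF := isSpectralDensity_wdens hg hf
  set v : ℝ → Fin T → ℂ := fun x => (rho g x)⁻¹ • h x with hv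
  have hvm : MemL2 (wdens g f) v := (inv_rho_smul_mem_negPast hg hh).1
  have hB := memL2_bSeries hb hF
  set Bn : ℕ → ℝ → Fin T → ℂ := fun n x => ∑ k ∈ Finset.range n, cis (k : ℤ) x • b k with hBn
  set Xn : ℕ → Ω → ℂ := fun n ω => ∑ k ∈ Finset.range n, incDot g ξ (b k) k ω with hXn
  have hBnb : ∀ n x, ‖Bn n x‖ ≤ ∑' k, ‖b k‖ := by
    intro n x
    refine (norm_sum_le _ _).trans ?_
    simp_rw [norm_smul, norm_cis, one_mul]
    exact hb.sum_le_tsum _ fun k _ => norm_nonneg _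
  have hBnm : ∀ n p, AEStronglyMeasurable (fun x => Bn n x p) circ := by
    intro n p
    refine Continuous.aestronglyMeasurable ?_
    simp only [hBn, Finset.sum_apply, Pi.smul_apply]
    exact continuous_finsetSum _ fun k _ => (continuous_cis _).smul continuous_const
  have hBnL : ∀ n, MemL2 (wdens g f) (Bn n) := fun n =>
    memL2_of_bounded hF (hBnm n) (Eventually.of_forall (hBnb n))
  have hXnL : ∀ n, MemLp (Xn n) 2 P := fun n =>
    memLp_finsetSum _ fun k _ => hξ.memLp_incDot hg _ _
  have hBlim : Tendsto (fun n => normSq (wdens g f) (fun x => Bn n x - bSeries b x))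
      atTop (𝓝 0) := by
    refine tendsto_normSq_of_bounded hF (K := ∑' k, ‖b k‖ + ∑' k, ‖b k‖)
      (fun n p => (hBnm n p).sub (aesm_bSeries hb p)) (Eventually.of_forall fun x => ?_)
      (fun n => Eventually.of_forall fun x =>
        (norm_sub_le _ _).trans (add_le_add (hBnb n x) (norm_bSeries_le hb x)))
    rw [tendsto_sub_nhds_zero_iff]
    exact (summable_cis_smul hb x).hasSum.tendsto_sum_nat
  -- Approximations of the target and of the estimate, in both domains at once.
  have hex : ∀ N : ℕ, ∃ (n m : ℕ) (s : ℕ → Fin T → ℂ),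
      ∫ ω, ‖X ω - Xn n ω‖ ^ 2 ∂P ≤ 1 / ((N : ℝ) + 1) ∧
      nsq (wdens g f) (fun x => Bn n x - bSeries b x) ≤ 1 / ((N : ℝ) + 1) ∧
      ∫ ω, ‖η ω - ∑ k ∈ Finset.range m, incDot g ξ (s k) (-((k : ℤ) + 1)) ω‖ ^ 2 ∂P
        ≤ 1 / ((N : ℝ) + 1) ∧
      nsq (wdens g f) (fun x => v x - negPoly m s x) ≤ 1 / ((N : ℝ) + 1) := by
    intro N
    have hN : 0 < 1 / ((N : ℝ) + 1) := by positivity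
    have hN' : 0 < ENNReal.ofReal (1 / ((N : ℝ) + 1)) := ENNReal.ofReal_pos.2 hN
    obtain ⟨n, hn1, hn2⟩ := ((hX.2.eventually_lt_const hN').and
      (hBlim.eventually_lt_const hN')).exists
    obtain ⟨m, s, hs1, hs2⟩ := hη.2 _ hN'
    refine ⟨n, m, s, ?_, ?_, ?_, ?_⟩
    · rw [← ENNReal.ofReal_le_ofReal_iff hN.le]
      exact (lintegral_enorm_sq (hX.1.sub (hXnL n))).symm.trans_le hn1.le
    · exact (nsq_le_iff hF ((hBnL n).sub hF hB) hN.le).2 hn2.le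
    · rw [← ENNReal.ofReal_le_ofReal_iff hN.le]
      have hS : MemLp (fun ω => ∑ k ∈ Finset.range m, incDot g ξ (s k) (-((k : ℤ) + 1)) ω) 2 P :=
        memLp_finsetSum _ fun k _ => hξ.memLp_incDot hg _ _
      exact (lintegral_enorm_sq (hη.1.sub hS)).symm.trans_le hs2
    · refine (nsq_le_iff hF (hvm.sub hF (IsNegPoly.memL2 hF ⟨m, s, rfl⟩)) hN.le).2 ?_
      rw [← normSq_rho_smul]
      refine le_of_eq_of_le (normSq_congr_ae ?_) hs1
      filter_upwards [rho_smul_inv hg h] with x hx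
      rw [smul_sub, hv, hx, pastPoly_eq]
  choose n m s h1 h2 h3 h4 using hex
  set Sn : ℕ → Ω → ℂ := fun N ω =>
    ∑ k ∈ Finset.range (m N), incDot g ξ (s N k) (-((k : ℤ) + 1)) ω with hSn
  have hSnL : ∀ N, MemLp (Sn N) 2 P := fun N =>
    memLp_finsetSum _ fun k _ => hξ.memLp_incDot hg _ _
  have hpL : ∀ N, MemL2 (wdens g f) (negPoly (m N) (s N)) := fun N =>
    IsNegPoly.memL2 hF ⟨m N, s N, rfl⟩
  have hzero : Tendsto (fun N : ℕ => 4 * (1 / ((N : ℝ) + 1))) atTop (𝓝 0) := by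
    simpa using (tendsto_one_div_add_atTop_nhds_zero_nat (𝕜 := ℝ)).const_mul 4
  have hiso : ∀ N, ∫ ω, ‖Xn (n N) ω - Sn N ω‖ ^ 2 ∂P
      = nsq (wdens g f) (fun x => Bn (n N) x - negPoly (m N) (s N) x) := by
    intro N
    have h5 := hξ.integral_norm_sq hg hf ((Finset.range (n N)).disjSum (Finset.range (m N)))
      (Sum.elim b fun k => -s N k) (Sum.elim (fun k => (k : ℤ)) fun k => -((k : ℤ) + 1))
    have h6 : ∀ (w : Fin T → ℂ) (j : ℤ) ω, incDot g ξ (-w) j ω = -incDot g ξ w j ω := by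
      intro w j ω
      simp [incDot]
    simp only [Finset.sum_disjSum, Sum.elim_inl, Sum.elim_inr, h6, Finset.sum_neg_distrib, smul_neg,
      ← sub_eq_add_neg] at h5
    exact h5
  have hlimF := tendsto_nsq hF (hB.sub hF hvm)
    (fun N => ((hBnL (n N)).sub hF hB).add hF (hvm.sub hF (hpL N)))
    (squeeze_zero (fun N => nsq_nonneg hF _) (fun N => by
      have := nsq_add_le hF ((hBnL (n N)).sub hF hB) (hvm.sub hF (hpL N)) one_pos
      linarith [h2 N, h4 N]) hzero)
  have hlimP := tendsto_integral_norm_sq (hX.1.sub hη.1)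
    (W := fun N ω => (η ω - Sn N ω) - (X ω - Xn (n N) ω))
    (fun N => (hη.1.sub (hSnL N)).sub (hX.1.sub (hXnL (n N))))
    (squeeze_zero (fun N => integral_nonneg fun ω => by positivity) (fun N => by
      have i1 := (memLp_two_iff_integrable_sq_norm (hη.1.sub (hSnL N)).1).1 (hη.1.sub (hSnL N))
      have i2 := (memLp_two_iff_integrable_sq_norm (hX.1.sub (hXnL (n N))).1).1
        (hX.1.sub (hXnL (n N)))
      have hd := (hη.1.sub (hSnL N)).sub (hX.1.sub (hXnL (n N)))
      have i3 := (memLp_two_iff_integrable_sq_norm hd.1).1 hd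
      have h7 := integral_mono i3 ((i1.const_mul 2).add (i2.const_mul 2)) fun ω => by
        have h8 := norm_sub_le (η ω - Sn N ω) (X ω - Xn (n N) ω)
        change ‖(η ω - Sn N ω) - (X ω - Xn (n N) ω)‖ ^ 2
          ≤ 2 * ‖η ω - Sn N ω‖ ^ 2 + 2 * ‖X ω - Xn (n N) ω‖ ^ 2
        nlinarith [norm_nonneg ((η ω - Sn N ω) - (X ω - Xn (n N) ω)),
          sq_nonneg (‖η ω - Sn N ω‖ - ‖X ω - Xn (n N) ω‖)]
      have h9 : ∫ ω, (2 * ‖η ω - Sn N ω‖ ^ 2 + 2 * ‖X ω - Xn (n N) ω‖ ^ 2) ∂P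
          = 2 * ∫ ω, ‖η ω - Sn N ω‖ ^ 2 ∂P + 2 * ∫ ω, ‖X ω - Xn (n N) ω‖ ^ 2 ∂P := by
        rw [← integral_const_mul, ← integral_const_mul]
        exact integral_add (i1.const_mul 2) (i2.const_mul 2)
      have h10 := h7.trans_eq h9
      refine h10.trans ?_
      have h11 := h1 N
      have h12 : ∫ ω, ‖η ω - Sn N ω‖ ^ 2 ∂P ≤ 1 / ((N : ℝ) + 1) := h3 N
      linarith) hzero)
  have hF' : ∀ N, nsq (wdens g f) (fun x => (bSeries b x - v x) + ((Bn (n N) x - bSeries b x)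
      + (v x - negPoly (m N) (s N) x))) = ∫ ω, ‖Xn (n N) ω - Sn N ω‖ ^ 2 ∂P := by
    intro N
    rw [hiso]
    congr 1
    funext x
    abel
  have hP' : ∀ N, ∫ ω, ‖(X - η) ω + ((η ω - Sn N ω) - (X ω - Xn (n N) ω))‖ ^ 2 ∂P
      = ∫ ω, ‖Xn (n N) ω - Sn N ω‖ ^ 2 ∂P := by
    intro N
    refine integral_congr_ae (Eventually.of_forall fun ω => ?_)
    have : (X - η) ω + ((η ω - Sn N ω) - (X ω - Xn (n N) ω)) = Xn (n N) ω - Sn N ω := by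
      rw [Pi.sub_apply]; ring
    simp only [this]
  simp_rw [hF'] at hlimF
  simp_rw [hP'] at hlimP
  rw [mse_eq hg, normSq_eq_ofReal hF (hB.sub hF hvm), tendsto_nhds_unique hlimF hlimP]
  exact lintegral_enorm_sq (hX.1.sub hη.1)

end Stochastic

end GMForecast

theorem mainTheorem12 {T r : ℕ} (g : GMForecast.GMIndex r) (hg : g.Positive)
    (a b : ℕ → Fin T → ℂ) (ha : a ≠ 0) (hb : GMForecast.IsDTransform g a b)
    (ha₁ : Summable fun k => ‖a k‖) (ha₂ : Summable fun k : ℕ => ((k : ℝ) + 1) * ‖a k‖ ^ 2)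
    (hb₁ : Summable fun k => ‖b k‖) (hb₂ : Summable fun k : ℕ => ((k : ℝ) + 1) * ‖b k‖ ^ 2)
    (f₁ : ℝ → Matrix (Fin T) (Fin T) ℂ) (hf₁ : GMForecast.IsSpectralDensity f₁)
    (N : GMForecast.Nbhd T) (hN : N.Admissible) :
    -- `mse` is the mean square error of the estimate with spectral characteristic `h`
    (∀ f, GMForecast.IsSpectralDensity f →
      ∀ (Ω : Type*) [MeasurableSpace Ω] (P : MeasureTheory.Measure Ω)
        [MeasureTheory.IsProbabilityMeasure P] (ξ : ℤ → Fin T → Ω → ℂ) (X η : Ω → ℂ),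
        GMForecast.HasSpectralDensity P g ξ f → GMForecast.IsFunctional P g ξ b X →
        ∀ h ∈ GMForecast.L2Past g f, GMForecast.IsEstimate P g ξ f h η →
          ∫⁻ ω, ‖X ω - η ω‖ₑ ^ 2 ∂P = GMForecast.mse g b h f) ∧
    ∀ f₀, GMForecast.Minimality g f₀ →
      -- least favourable densities satisfy the equations
      (N.NonDegenerate → GMForecast.IsLeastFavourable g b (N.densities g f₁) f₀ →
        ∃ c C M, GMForecast.IsInverseImage g f₀ b c C ∧ N.IsMultiplier g f₁ f₀ M ∧
          GMForecast.DensityEquation g f₀ M C) ∧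
      -- solutions of the equations are least favourable, solve the constrained optimization
      -- problem, and yield the minimax-robust spectral characteristic
      (∀ c C M, f₀ ∈ N.densities g f₁ → GMForecast.IsInverseImage g f₀ b c C →
        N.IsMultiplier g f₁ f₀ M → GMForecast.DensityEquation g f₀ M C →
        GMForecast.IsLeastFavourable g b (N.densities g f₁) f₀ ∧
        GMForecast.mse g b (GMForecast.charFormula g b f₀ C) f₀ =
          ENNReal.ofReal (∑' k, b k ⬝ᵥ star (c k)).re ∧
        GMForecast.IsSpectralCharacteristic g b f₀ (GMForecast.charFormula g b f₀ C) ∧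
        GMForecast.IsMinimaxRobust g b (N.densities g f₁) (GMForecast.charFormula g b f₀ C)) ∧
      -- the same in terms of a canonical factorization of the density
      (∀ (q : ℕ) (φ : ℕ → Matrix (Fin T) (Fin q) ℂ) (Φ : ℝ → Matrix (Fin T) (Fin q) ℂ)
        (R : ℝ → Fin q → ℂ), GMForecast.IsCanonicalFactorization g f₀ φ Φ →
        GMForecast.IsAnalyticSeries R (GMForecast.hankel φ b) →
        (N.NonDegenerate → GMForecast.IsLeastFavourable g b (N.densities g f₁) f₀ →
          ∃ M, N.IsMultiplier g f₁ f₀ M ∧ GMForecast.FactorEquation Φ M R) ∧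
        (∀ M, f₀ ∈ N.densities g f₁ → N.IsMultiplier g f₁ f₀ M →
          GMForecast.FactorEquation Φ M R →
          GMForecast.IsLeastFavourable g b (N.densities g f₁) f₀ ∧
          ∃ c C, GMForecast.IsInverseImage g f₀ b c C ∧ GMForecast.DensityEquation g f₀ M C ∧
            GMForecast.IsMinimaxRobust g b (N.densities g f₁)
              (GMForecast.charFormula g b f₀ C))) := by
  refine ⟨fun f hf Ω _ P _ ξ X η hξ hX h hh hη =>
    GMForecast.lintegral_eq_mse hg hb₁ hf hξ hX hh hη, fun f₀ hm => ⟨fun hnd hLF => ?_,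
    fun c C M hf₀ hC hmul hE =>
      GMForecast.isLeastFavourable_of_densityEquation hg hb₁ hf₁ hN hm hf₀ hC hmul hE,
    fun q φ Φ R hΦ hR => ⟨fun hnd hLF => ?_, fun M hf₀ hmul hE => ?_⟩⟩⟩
  · obtain ⟨v, M, hv, hM, hGM⟩ := hLF.exists_multiplier hg ha hb hb₁ hf₁ hN hnd hm
    have hf₀ := GMForecast.isSpectralDensity_of_mem hLF.1
    obtain ⟨c, hc⟩ := GMForecast.exists_isInverseImage hg hb₁ hf₀ hm hv
    exact ⟨c, _, M, hc, hM, GMForecast.densityEquation_of_vecMulVec hf₀ hGM⟩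
  · obtain ⟨v, M, hv, hM, hGM⟩ := hLF.exists_multiplier hg ha hb hb₁ hf₁ hN hnd hm
    have hF := GMForecast.isSpectralDensity_wdens hg (GMForecast.isSpectralDensity_of_mem hLF.1)
    exact ⟨M, hM, GMForecast.IsCanonicalFactorization.factorEquation_of_vecMulVec
      (hΦ.mulVec_ae_eq hF hb₁ hR hv) hGM⟩
  · have hF := GMForecast.isSpectralDensity_wdens hg (GMForecast.isSpectralDensity_of_mem hf₀)
    obtain ⟨v, hv⟩ := GMForecast.exists_isProj hF (hm.exists_isCoercive hg)
      (GMForecast.memL2_bSeries hb₁ hF)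
    obtain ⟨c, hc⟩ := GMForecast.exists_isInverseImage hg hb₁
      (GMForecast.isSpectralDensity_of_mem hf₀) hm hv
    have hE' := hΦ.densityEquation_of_factorEquation (hΦ.mulVec_ae_eq hF hb₁ hR hv) hE
    obtain ⟨h1, -, -, h2⟩ :=
      GMForecast.isLeastFavourable_of_densityEquation hg hb₁ hf₁ hN hm hf₀ hc hmul hE'
    exact ⟨h1, c, _, hc, hE', h2⟩
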